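/- Let $S^1=\mathbb R/\mathbb Z$, and let $\mathrm{Diff}^1(S^1)$ be the group of $C^1$ diffeomorphisms of $S^1$ with the $C^1$ topology. A diffeomorphism $f\in\mathrm{Diff}^1(S^1)$ is called Morse–Smale if its non-wandering set consists of finitely many hyperbolic periodic points, alternately attracting or repelling. A $C^\infty$ vector field on $S^1$ is called Morse–Smale if the non-wandering set of its flow consists of finitely many hyperbolic zeros. Let $C(f)=\{g\in\mathrm{Diff}^1(S^1): fg=gf\}$. There is a dense subset $\mathcal D\subset\mathrm{Diff}^1(S^1)$ such that every $f\in\mathcal D$ is Morse–Smale and commutes with the flow $(X^t)_{t\in\mathbb R}$ of some $C^\infty$ Morse–Smale vector field $X$ on $S^1$ for which $f^q=X^1$, where $q=2$ if $f$ reverses the orientation, and otherwise $q$ is the common period of all the periodic orbits of $f$ (which exist). Furthermore, there is a group isomorphism from $\mathbb R\times(\mathbb Z/q\mathbb Z)$ onto $C(f)$ that sends $(t,0)$ to $X^t$ for every $t\in\mathbb R$. -/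

import Mathlib

open Function Topology
open scoped ContDiff

/-- A self-map of the circle `ℝ / ℤ` is of class `C^r` when it has a `C^r` lift to the universal
cover `ℝ`. -/
def CircleContDiff (r : WithTop ℕ∞) (f : UnitAddCircle → UnitAddCircle) : Prop :=
  ∃ F : ℝ → ℝ, ContDiff ℝ r F ∧ ∀ x : ℝ, f (x : UnitAddCircle) = (F x : UnitAddCircle)

/-- The group `Diff^r(S¹)` of `C^r` diffeomorphisms of `S¹ = ℝ / ℤ`: the bijections which are of
class `C^r` together with their inverse; the product is composition. -/
def circleDiff (r : WithTop ℕ∞) : Subgroup (Equiv.Perm UnitAddCircle) where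
  carrier := {f | CircleContDiff r f ∧ CircleContDiff r f.symm}
  one_mem' := ⟨⟨id, contDiff_id, fun _ => rfl⟩, ⟨id, contDiff_id, fun _ => rfl⟩⟩
  mul_mem' := by
    rintro f g ⟨⟨F, hF, hfF⟩, ⟨F', hF', hfF'⟩⟩ ⟨⟨G, hG, hgG⟩, ⟨G', hG', hgG'⟩⟩
    refine ⟨⟨F ∘ G, hF.comp hG, fun x => ?_⟩, ⟨G' ∘ F', hG'.comp hF', fun x => ?_⟩⟩
    · change f (g x) = _
      rw [hgG, hfF]; rfl
    · change g.symm (f.symm x) = _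
      rw [hfF', hgG']; rfl
  inv_mem' := by
    rintro f ⟨h, h'⟩
    exact ⟨h', h⟩

/-- The representative in `(-1/2, 1/2]` of a point of `ℝ / ℤ`. -/
noncomputable def circleRep (z : UnitAddCircle) : ℝ :=
  (AddCircle.equivIoc (1 : ℝ) (-1 / 2) z : ℝ)

/-- The derivative at `x` of a self-map of `ℝ / ℤ`, in the natural affine coordinate. -/
noncomputable def circleDeriv (f : UnitAddCircle → UnitAddCircle) (x : UnitAddCircle) : ℝ :=
  deriv (fun t : ℝ => circleRep (f (x + (t : UnitAddCircle)) - f x)) 0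

/-- The derivative of a circle map is the ordinary derivative of any continuous lift. -/
theorem circleDeriv_coe {f : UnitAddCircle → UnitAddCircle} {F : ℝ → ℝ} (hF : Continuous F)
    (hf : ∀ x : ℝ, f (x : UnitAddCircle) = (F x : UnitAddCircle)) (x : ℝ) :
    circleDeriv f (x : UnitAddCircle) = deriv F x := by
  have hc : Continuous fun t : ℝ => F (x + t) - F x := by fun_prop
  have h0 : Set.Ioo (-1 / 2 : ℝ) (1 / 2) ∈ 𝓝 (F (x + 0) - F x) := by
    simpa using Ioo_mem_nhds (show (-1 / 2 : ℝ) < 0 by norm_num) (by norm_num)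
  have hev : (fun t : ℝ => circleRep (f ((x : UnitAddCircle) + (t : UnitAddCircle))
      - f (x : UnitAddCircle))) =ᶠ[𝓝 0] fun t => F (x + t) - F x := by
    filter_upwards [hc.continuousAt.preimage_mem_nhds h0] with t ht
    have ht' : F (x + t) - F x ∈ Set.Ioc (-1 / 2 : ℝ) (-1 / 2 + 1) :=
      ⟨ht.1, by have := ht.2; norm_num at this ⊢; linarith⟩
    rw [← AddCircle.coe_add, hf, hf, ← AddCircle.coe_sub, circleRep,
      AddCircle.equivIoc_coe_eq ht']
  rw [circleDeriv, hev.deriv_eq, deriv_sub_const, deriv_comp_const_add, add_zero]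

/-- The `C¹` topology on `Diff¹(S¹)`: uniform convergence of the maps and of their derivatives. -/
noncomputable instance circleDiffTopology : TopologicalSpace (circleDiff 1) :=
  TopologicalSpace.induced
    (fun f => (UniformFun.ofFun (f.1 : UnitAddCircle → UnitAddCircle),
      UniformFun.ofFun (circleDeriv f.1)))
    (inferInstance : TopologicalSpace
      (UniformFun UnitAddCircle UnitAddCircle × UniformFun UnitAddCircle ℝ))

/-- A circle diffeomorphism reverses the orientation: its derivative is negative. -/
def OrientationReversing (f : UnitAddCircle → UnitAddCircle) : Prop :=
  ∀ x, circleDeriv f x < 0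

/-- The derivative of `f^k` at a point `x`, where `k` is the least period of `x`. -/
noncomputable def periodMultiplier (f : UnitAddCircle → UnitAddCircle) (x : UnitAddCircle) : ℝ :=
  circleDeriv (f^[minimalPeriod f x]) x

/-- Attracting hyperbolic periodic points. -/
def IsAttractingPeriodic (f : UnitAddCircle → UnitAddCircle) (x : UnitAddCircle) : Prop :=
  x ∈ periodicPts f ∧ |periodMultiplier f x| < 1

/-- Repelling hyperbolic periodic points. -/
def IsRepellingPeriodic (f : UnitAddCircle → UnitAddCircle) (x : UnitAddCircle) : Prop :=
  x ∈ periodicPts f ∧ 1 < |periodMultiplier f x|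

/-- The non-wandering set of a map. -/
def nonwanderingSet (f : UnitAddCircle → UnitAddCircle) : Set UnitAddCircle :=
  {x | ∀ U ∈ 𝓝 x, ∃ n : ℕ, 1 ≤ n ∧ (f^[n] '' U ∩ U).Nonempty}

/-- Morse-Smale diffeomorphisms of the circle: the non-wandering set consists of finitely many
hyperbolic periodic points, alternately attracting or repelling. -/
structure IsMorseSmaleDiffeo (f : circleDiff 1) : Prop where
  finite : (nonwanderingSet f.1).Finite
  periodic : ∀ x ∈ nonwanderingSet f.1, x ∈ periodicPts f.1
  hyperbolic : ∀ x ∈ nonwanderingSet f.1, |periodMultiplier f.1 x| ≠ 1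
  alternate : ∀ x ∈ periodicPts f.1, ∀ y ∈ periodicPts f.1, x ≠ y →
    (∀ z, sbtw x z y → z ∉ periodicPts f.1) →
      (IsAttractingPeriodic f.1 x ∧ IsRepellingPeriodic f.1 y) ∨
      (IsRepellingPeriodic f.1 x ∧ IsAttractingPeriodic f.1 y)

/-- `Φ` is the (complete) flow of the vector field `X ∂/∂x` on the circle: every orbit
`t ↦ Φ t x` starts at `x` and lifts to a solution of `γ' = X(γ)` on `ℝ`. -/
def IsFlowOf (X : UnitAddCircle → ℝ) (Φ : ℝ → UnitAddCircle → UnitAddCircle) : Prop :=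
  ∀ x, Φ 0 x = x ∧ ∃ γ : ℝ → ℝ, (∀ t, HasDerivAt γ (X (γ t : UnitAddCircle)) t) ∧
    ∀ t, Φ t x = (γ t : UnitAddCircle)

/-- The non-wandering set of a flow. -/
def flowNonwanderingSet (Φ : ℝ → UnitAddCircle → UnitAddCircle) : Set UnitAddCircle :=
  {x | ∀ U ∈ 𝓝 x, ∀ T : ℝ, ∃ t, T ≤ t ∧ (Φ t '' U ∩ U).Nonempty}

/-- Smooth Morse-Smale vector fields `X ∂/∂x` on the circle (with singularities): `X` is `C^∞`, and
the non-wandering set of its flow consists of finitely many hyperbolic zeros of `X`. -/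
def IsMorseSmaleField (X : UnitAddCircle → ℝ) : Prop :=
  ContDiff ℝ ∞ (fun t : ℝ => X (t : UnitAddCircle)) ∧
  ∃ Φ : ℝ → UnitAddCircle → UnitAddCircle, IsFlowOf X Φ ∧
    (flowNonwanderingSet Φ).Finite ∧
    ∀ x ∈ flowNonwanderingSet Φ,
      X x = 0 ∧ deriv (fun t : ℝ => X (x + (t : UnitAddCircle))) 0 ≠ 0

/-!
The proof takes place on lifts `F : ℝ → ℝ` of circle diffeomorphisms, of degree `d = ±1`.

*The models.* The set `D` consists of the diffeomorphisms with a lift `F` satisfying `IsModel`: off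
a periodic discrete set `p : ℤ → ℝ` there is a smooth periodic "time function" `h` with
`h ∘ F = h + 1 / q`, without critical points, equal to `log |x - p i| / lam i + c i e` on the side
`e = ±1` of `p i`, with `lam i` of alternating signs. The field `1 / h'` is then smooth, linear near
the points `p i`, and Morse-Smale; its flow advances `h` at unit speed, hence it commutes with `F`
and its time-one map is `F^q`. All points off the range of `p` wander, since their time increases. A
diffeomorphism commuting with `F` preserves the set of periodic points and their multipliers. The
multiplier of the orbit of `p 0` being different from all others, some product `g` with a power of
`F` fixes `p 0`; commuting with the contraction or expansion `F^q` at `p 0`, where the time is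
logarithmic, `g` has there the germ of a flow map, first on one side and then, interval by interval,
everywhere. The jumps `c i 1 - c i (-1)` of the constants have a nonzero sum when `F` preserves the
orientation, and this forces the flow times on the different intervals to agree. Therefore the
centralizer consists of the maps `X^t ∘ F^j`.

*Density.* Let `f` be an arbitrary diffeomorphism. It is smoothed, and given a periodic orbit by a
small rotation (a fixed point exists if the orientation is reversed). Then Sard's theorem, applied
to a family of perturbations supported in a fundamental arc between consecutive points of the orbit,
makes all periodic points hyperbolic (`IsBased.exists_hyperbolic`), and `f` can be made affine near
these points (`IsBased.exists_linearized`).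

There are now two time functions (`IsLinearized.exists_timePair`): `H`, logarithmic near the
repelling points, obtained by iterating the inverse of `F^q`, and `H'`, logarithmic near the
attracting ones. On each interval `H = g ∘ H'`, where `g t - t` is `1`-periodic: the class of `g`
is the Mather invariant of `f`, the obstruction to embedding it in a flow. It is removed near the
attracting points, where infinitely many fundamental domains are available: the time `h = Θ ∘ H'`,
with `Θ` interpolating very slowly between `g` and the identity, is logarithmic near all periodic
points, and satisfies `h ∘ F = h + 1 / q` after `F` is composed with a change of time `t + e t`, with
`e` and its derivative as small as desired (`exists_interp`). Near an attracting point such a change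
of time multiplies the distance to the point by a factor close to one, and is `C¹`-close to the
identity (`IsTimePair.timeShift_close`); it would not be `C²`-close.
-/

/-! ### Lifts of circle diffeomorphisms -/

/-- `F : ℝ → ℝ` is a lift of a `C^r` diffeomorphism of degree `d = ±1` of the circle: it commutes
with integer translations up to the sign `d`, and its derivative has the sign of `d`. -/
structure IsCircleLift (r : WithTop ℕ∞) (d : ℤ) (F : ℝ → ℝ) : Prop where
  contDiff : ContDiff ℝ r F
  deg : d = 1 ∨ d = -1
  map_add_one : ∀ x, F (x + 1) = F x + d
  deriv_pos : ∀ x, 0 < d * deriv F x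

/-- A continuous function with integer values is constant. -/
theorem exists_int_const {φ : ℝ → ℝ} (hφ : Continuous φ) (h : ∀ x, ∃ n : ℤ, φ x = n) :
    ∃ n : ℤ, ∀ x, φ x = n := by
  choose g hg using h
  have hc : Continuous g := by
    rw [Int.isClosedEmbedding_coe_real.isInducing.continuous_iff]
    convert hφ using 1
    ext x; exact (hg x).symm
  exact ⟨g 0, fun x => by rw [hg x, PreconnectedSpace.constant inferInstance hc]⟩

/-- A strictly increasing surjective `C^r` map without critical points has a `C^r` inverse. -/
theorem exists_inverse_of_deriv_pos {r : WithTop ℕ∞} (hr : 1 ≤ r) {F : ℝ → ℝ}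
    (hF : ContDiff ℝ r F) (hd : ∀ x, 0 < deriv F x) (hs : Surjective F) :
    ∃ G : ℝ → ℝ, ContDiff ℝ r G ∧ LeftInverse G F ∧ RightInverse G F := by
  have hm : StrictMono F := strictMono_of_deriv_pos hd
  let e := (StrictMono.orderIsoOfSurjective F hm hs).toHomeomorph
  have hdiff : Differentiable ℝ F := hF.differentiable (by positivity)
  refine ⟨e.symm, ?_, e.left_inv, e.right_inv⟩
  exact e.contDiff_symm_deriv (fun x => (hd x).ne') (fun x => (hdiff x).hasDerivAt) hF

namespace IsCircleLift

variable {r : WithTop ℕ∞} {d d' : ℤ} {F G : ℝ → ℝ}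

theorem one_of_le (hr : 1 ≤ r) (L : IsCircleLift r d F) : IsCircleLift 1 d F :=
  ⟨L.contDiff.of_le hr, L.deg, L.map_add_one, L.deriv_pos⟩

theorem one (L : IsCircleLift ∞ d F) : IsCircleLift 1 d F :=
  L.one_of_le (by exact_mod_cast le_top)

theorem sq (L : IsCircleLift r d F) : (d : ℝ) * d = 1 := by
  rcases L.deg with h | h <;> simp [h]

theorem differentiable (L : IsCircleLift 1 d F) : Differentiable ℝ F :=
  L.contDiff.differentiable (by norm_num)

theorem continuous (L : IsCircleLift r d F) : Continuous F := L.contDiff.continuous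

theorem hasDerivAt (L : IsCircleLift 1 d F) (x : ℝ) : HasDerivAt F (deriv F x) x :=
  (L.differentiable x).hasDerivAt

theorem continuous_deriv (L : IsCircleLift 1 d F) : Continuous (deriv F) :=
  L.contDiff.continuous_deriv (le_refl _)

theorem deriv_ne (L : IsCircleLift r d F) (x : ℝ) : deriv F x ≠ 0 := fun h => by
  have := L.deriv_pos x; simp [h] at this

theorem map_add_nat (L : IsCircleLift r d F) (x : ℝ) (n : ℕ) : F (x + n) = F x + d * n := by
  induction n with
  | zero => simp
  | succ n ih => push_cast; rw [← add_assoc, L.map_add_one, ih]; ring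

theorem map_add_int (L : IsCircleLift r d F) (x : ℝ) (n : ℤ) : F (x + n) = F x + d * n := by
  obtain ⟨k, rfl | rfl⟩ := n.eq_nat_or_neg
  · exact_mod_cast L.map_add_nat x k
  · have := L.map_add_nat (x - k) k
    push_cast
    rw [sub_add_cancel] at this
    rw [← sub_eq_add_neg]; linarith

theorem strictMono_mul (L : IsCircleLift r d F) : StrictMono fun x => d * F x := by
  refine strictMono_of_deriv_pos fun x => ?_
  rw [deriv_const_mul_field]; exact L.deriv_pos x

theorem strictMono (L : IsCircleLift r 1 F) : StrictMono F := by
  simpa using L.strictMono_mul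

theorem strictAnti (L : IsCircleLift r (-1) F) : StrictAnti F := by
  intro x y h
  have := L.strictMono_mul h
  simpa using this

theorem injective (L : IsCircleLift r d F) : Injective F := fun x y h =>
  L.strictMono_mul.injective (by simp [h])

theorem surjective (L : IsCircleLift r d F) : Surjective F := by
  intro y
  have hd := L.sq
  have key : ∀ n : ℤ, F (d * n) = F 0 + n := fun n => by
    have := L.map_add_int 0 (d * n)
    push_cast at this
    rw [zero_add] at this
    rw [this]; linear_combination (n : ℝ) * hd
  refine mem_range_of_exists_le_of_exists_ge L.continuous
    ⟨d * (⌊y - F 0⌋ : ℤ), ?_⟩ ⟨d * (⌈y - F 0⌉ : ℤ), ?_⟩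
  · rw [key]; linarith [Int.floor_le (y - F 0)]
  · rw [key]; linarith [Int.le_ceil (y - F 0)]

theorem deriv_add_one (L : IsCircleLift r d F) (x : ℝ) : deriv F (x + 1) = deriv F x := by
  have : (fun y => F (y + 1)) = fun y => F y + d := funext L.map_add_one
  rw [← deriv_comp_add_const, this, deriv_add_const]

theorem deriv_add_int (L : IsCircleLift r d F) (x : ℝ) (n : ℤ) :
    deriv F (x + n) = deriv F x := by
  have : (fun y => F (y + n)) = fun y => F y + d * n := funext fun y => L.map_add_int y n
  rw [← deriv_comp_add_const, this, deriv_add_const]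

/-- For a periodic `C¹` map of degree `±1`, a derivative without zeros has the right sign. -/
theorem of_deriv_ne (hr : 1 ≤ r) (hF : ContDiff ℝ r F) (hd : d = 1 ∨ d = -1)
    (h1 : ∀ x, F (x + 1) = F x + d) (hne : ∀ x, deriv F x ≠ 0) : IsCircleLift r d F := by
  refine ⟨hF, hd, h1, fun x => ?_⟩
  have hdiff : Differentiable ℝ F := hF.differentiable (by positivity)
  have hc : Continuous (deriv F) := hF.continuous_deriv hr
  obtain ⟨c, -, hcd⟩ := exists_deriv_eq_slope F (zero_lt_one' ℝ) hdiff.continuous.continuousOn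
    hdiff.differentiableOn
  have hcd' : deriv F c = d := by
    have := h1 0
    rw [zero_add] at this
    rw [hcd, this]; simp
  have hsq : (d : ℝ) * d = 1 := by rcases hd with h | h <;> simp [h]
  by_contra hx
  push Not at hx
  obtain ⟨z, hz⟩ := mem_range_of_exists_le_of_exists_ge (f := fun x => d * deriv F x) (c := 0)
    (by fun_prop) ⟨x, hx⟩ ⟨c, by rw [hcd', hsq]; norm_num⟩
  rcases mul_eq_zero.1 hz with h | h
  · simp [h] at hsq
  · exact hne z h

theorem comp (hr : 1 ≤ r) (L : IsCircleLift r d F) (L' : IsCircleLift r d' G) :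
    IsCircleLift r (d * d') (F ∘ G) := by
  refine of_deriv_ne hr (L.contDiff.comp L'.contDiff) ?_ (fun x => ?_) fun x => ?_
  · rcases L.deg with h | h <;> rcases L'.deg with h' | h' <;> simp [h, h']
  · simp [L'.map_add_one, L.map_add_int]
  · rw [deriv_comp x ((L.one_of_le hr).differentiable _) ((L'.one_of_le hr).differentiable _)]
    exact mul_ne_zero (L.deriv_ne _) (L'.deriv_ne _)

theorem id : IsCircleLift r 1 (id : ℝ → ℝ) :=
  ⟨contDiff_id, Or.inl rfl, fun x => by simp, fun x => by simp⟩

theorem iterate (hr : 1 ≤ r) (L : IsCircleLift r d F) (n : ℕ) : IsCircleLift r (d ^ n) F^[n] := by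
  induction n with
  | zero => simpa using IsCircleLift.id
  | succ n ih => rw [iterate_succ, pow_succ]; exact comp hr ih L

theorem add_const (L : IsCircleLift r d F) (c : ℝ) : IsCircleLift r d fun x => F x + c :=
  ⟨L.contDiff.add contDiff_const, L.deg, fun x => by rw [L.map_add_one]; ring,
    fun x => by rw [deriv_add_const]; exact L.deriv_pos x⟩

/-- The inverse of a lift is a lift. -/
theorem exists_inverse (hr : 1 ≤ r) (L : IsCircleLift r d F) :
    ∃ G, IsCircleLift r d G ∧ LeftInverse G F ∧ RightInverse G F := by
  have hd := L.sq
  obtain ⟨H, hH, hl, hrt⟩ := exists_inverse_of_deriv_pos hr (F := fun x => d * F x)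
    (contDiff_const.mul L.contDiff) (fun x => by rw [deriv_const_mul_field]; exact L.deriv_pos x)
    (fun y => by
      obtain ⟨x, hx⟩ := L.surjective (d * y)
      exact ⟨x, by simp only [hx]; rw [← mul_assoc, hd, one_mul]⟩)
  have hl' : LeftInverse (fun y => H (d * y)) F := fun x => hl x
  have hr' : RightInverse (fun y => H (d * y)) F := fun y => by
    have := hrt (d * y)
    simp only at this
    calc F (H (d * y)) = d * d * F (H (d * y)) := by rw [hd, one_mul]
      _ = d * d * y := by rw [mul_assoc, this, mul_assoc]
      _ = y := by rw [hd, one_mul]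
  have hc : ContDiff ℝ r fun y => H (d * y) := hH.comp (contDiff_const.mul contDiff_id)
  refine ⟨_, of_deriv_ne hr hc L.deg (fun x => L.injective ?_) (fun x => ?_), hl', hr'⟩
  · rw [hr', L.map_add_int, hr', hd]
  · have h1 : deriv (F ∘ fun y => H (d * y)) x = 1 := by
      rw [show F ∘ (fun y => H (d * y)) = _root_.id from funext hr']; simp
    rw [deriv_comp x ((L.one_of_le hr).differentiable _) (hc.differentiable (by positivity) _)]
      at h1
    exact right_ne_zero_of_mul (h1 ▸ one_ne_zero)

theorem deriv_iterate (L : IsCircleLift 1 d F) (n : ℕ) (x : ℝ) :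
    deriv F^[n] x = ∏ j ∈ Finset.range n, deriv F (F^[j] x) := by
  induction n with
  | zero => simp
  | succ n ih =>
    rw [iterate_succ', deriv_comp x (L.differentiable _)
      ((L.iterate le_rfl n).differentiable _), ih, Finset.prod_range_succ, mul_comm]

end IsCircleLift

/-- A continuous `1`-periodic function is bounded. -/
theorem exists_bound_of_periodic {φ : ℝ → ℝ} (hc : Continuous φ) (hp : ∀ x, φ (x + 1) = φ x) :
    ∃ B, 0 < B ∧ ∀ x, |φ x| ≤ B := by
  obtain ⟨B, hB⟩ := (isCompact_Icc (a := (0 : ℝ)) (b := 1)).exists_bound_of_continuousOn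
    hc.continuousOn
  refine ⟨max B 1, by positivity, fun x => ?_⟩
  have hper : Periodic φ 1 := hp
  have h1 : φ x = φ (Int.fract x) := by
    rw [Int.fract]; exact (hper.sub_int_mul_eq ⌊x⌋ |>.symm.trans (by simp)).trans rfl
  rw [h1]
  exact (hB _ ⟨Int.fract_nonneg x, (Int.fract_lt_one x).le⟩).trans (le_max_left _ _)

/-- A continuous positive `1`-periodic function is bounded away from zero. -/
theorem exists_pos_bound_of_periodic {φ : ℝ → ℝ} (hc : Continuous φ) (hp : ∀ x, φ (x + 1) = φ x)
    (hpos : ∀ x, 0 < φ x) : ∃ m, 0 < m ∧ ∀ x, m ≤ φ x := by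
  obtain ⟨B, hB, h⟩ := exists_bound_of_periodic (φ := fun x => (φ x)⁻¹)
    (hc.inv₀ fun x => (hpos x).ne') (fun x => by simp [hp])
  refine ⟨B⁻¹, by positivity, fun x => ?_⟩
  exact inv_le_of_inv_le₀ (hpos x) ((le_abs_self _).trans (h x))

/-- A continuous `1`-periodic function is uniformly continuous. -/
theorem uniformContinuous_of_periodic {φ : ℝ → ℝ} (hc : Continuous φ)
    (hp : ∀ x, φ (x + 1) = φ x) {ε : ℝ} (hε : 0 < ε) :
    ∃ δ, 0 < δ ∧ ∀ x y, |x - y| < δ → |φ x - φ y| < ε := by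
  have hu := (isCompact_Icc (a := (-1 : ℝ)) (b := 2)).uniformContinuousOn_of_continuous
    hc.continuousOn
  rw [Metric.uniformContinuousOn_iff] at hu
  obtain ⟨δ, hδ, h⟩ := hu ε hε
  refine ⟨min δ 1, by positivity, fun x y hxy => ?_⟩
  have hper : Periodic φ 1 := hp
  have h1 : ∀ z, φ z = φ (z - ⌊x⌋) := fun z => by
    simpa using (hper.sub_int_mul_eq ⌊x⌋ (x := z)).symm
  have h2 := abs_lt.1 (lt_of_lt_of_le hxy (min_le_right _ _))
  have h3 := Int.floor_le x
  have h4 := Int.lt_floor_add_one x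
  rw [h1 x, h1 y]
  have := h (x - ⌊x⌋) ⟨by linarith, by linarith⟩ (y - ⌊x⌋) ⟨by linarith, by linarith⟩
    (by rw [Real.dist_eq, sub_sub_sub_cancel_right]; exact lt_of_lt_of_le hxy (min_le_left _ _))
  rwa [Real.dist_eq] at this

/-- `C¹`-closeness of two functions, uniform over the line. -/
def C1Close (ε : ℝ) (F G : ℝ → ℝ) : Prop :=
  ∀ x, |F x - G x| < ε ∧ |deriv F x - deriv G x| < ε

theorem C1Close.trans {ε₁ ε₂ : ℝ} {F G H : ℝ → ℝ} (h₁ : C1Close ε₁ F G) (h₂ : C1Close ε₂ G H) :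
    C1Close (ε₁ + ε₂) F H := fun x =>
  ⟨(abs_sub_le _ (G x) _).trans_lt (add_lt_add (h₁ x).1 (h₂ x).1),
    (abs_sub_le _ (deriv G x) _).trans_lt (add_lt_add (h₁ x).2 (h₂ x).2)⟩

theorem C1Close.mono {ε₁ ε₂ : ℝ} {F G : ℝ → ℝ} (h : C1Close ε₁ F G) (hε : ε₁ ≤ ε₂) :
    C1Close ε₂ F G := fun x => ⟨(h x).1.trans_le hε, (h x).2.trans_le hε⟩

theorem C1Close.refl {ε : ℝ} (hε : 0 < ε) (F : ℝ → ℝ) : C1Close ε F F := fun x => by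
  simp [hε]

namespace IsCircleLift

variable {r : WithTop ℕ∞} {d d' : ℤ} {F G : ℝ → ℝ}

/-- Being a lift of a diffeomorphism is an open condition in the `C¹` topology. -/
theorem of_close (L : IsCircleLift 1 d F) : ∃ ε, 0 < ε ∧ ∀ (r : WithTop ℕ∞) (G : ℝ → ℝ),
    ContDiff ℝ r G → (∀ x, G (x + 1) = G x + d) → C1Close ε F G → IsCircleLift r d G := by
  obtain ⟨m, hm, h⟩ := exists_pos_bound_of_periodic (φ := fun x => d * deriv F x)
    (continuous_const.mul L.continuous_deriv) (fun x => by rw [L.deriv_add_one]) L.deriv_pos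
  refine ⟨m, hm, fun r G hG h1 hc => ⟨hG, L.deg, h1, fun x => ?_⟩⟩
  have h2 := h x
  have h3 := abs_lt.1 (hc x).2
  rcases L.deg with hd | hd <;> simp only [hd] at h2 ⊢ <;> push_cast at h2 ⊢ <;> linarith

theorem exists_deriv_bound (L : IsCircleLift 1 d F) : ∃ B, 0 < B ∧ ∀ x, |deriv F x| ≤ B :=
  exists_bound_of_periodic L.continuous_deriv L.deriv_add_one

theorem exists_deriv_uniform (L : IsCircleLift 1 d F) {ε : ℝ} (hε : 0 < ε) :
    ∃ δ, 0 < δ ∧ ∀ x y, |x - y| < δ → |deriv F x - deriv F y| < ε :=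
  uniformContinuous_of_periodic L.continuous_deriv L.deriv_add_one hε

theorem abs_sub_le {B : ℝ} (L : IsCircleLift 1 d F) (hB : ∀ x, |deriv F x| ≤ B) (x y : ℝ) :
    |F x - F y| ≤ B * |x - y| := by
  simpa using Convex.norm_image_sub_le_of_norm_deriv_le (𝕜 := ℝ) (s := Set.univ)
    (fun x _ => L.differentiable x) (fun x _ => hB x) convex_univ (Set.mem_univ y) (Set.mem_univ x)

/-- Composition is continuous for the `C¹` topology. -/
theorem close_comp (L : IsCircleLift 1 d F) (L' : IsCircleLift 1 d' G) {ε : ℝ} (hε : 0 < ε) :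
    ∃ δ, 0 < δ ∧ ∀ F₁ G₁ : ℝ → ℝ, Differentiable ℝ F₁ → Differentiable ℝ G₁ →
      C1Close δ F F₁ → C1Close δ G G₁ → C1Close ε (F ∘ G) (F₁ ∘ G₁) := by
  obtain ⟨B, hB0, hB⟩ := L.exists_deriv_bound
  obtain ⟨C, hC0, hC⟩ := L'.exists_deriv_bound
  obtain ⟨η, hη, hu⟩ := L.exists_deriv_uniform (ε := ε / (3 * (C + 1))) (by positivity)
  set δ := min (min η 1) (min (ε / (3 * (C + 1))) (ε / (3 * (B + 1)))) with hδ
  have h1 : δ ≤ η := (min_le_left _ _).trans (min_le_left _ _)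
  have h2 : δ ≤ 1 := (min_le_left _ _).trans (min_le_right _ _)
  have h3 : δ * (3 * (C + 1)) ≤ ε := by
    rw [← le_div_iff₀ (by positivity)]; exact (min_le_right _ _).trans (min_le_left _ _)
  have h4 : δ * (3 * (B + 1)) ≤ ε := by
    rw [← le_div_iff₀ (by positivity)]; exact (min_le_right _ _).trans (min_le_right _ _)
  have hδ0 : 0 < δ := by positivity
  refine ⟨δ, hδ0, fun F₁ G₁ hF₁ hG₁ hF hG x => ⟨?_, ?_⟩⟩
  · have e1 := L.abs_sub_le hB (G x) (G₁ x)
    have e2 := (hF (G₁ x)).1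
    have e3 : B * |G x - G₁ x| ≤ B * δ := by gcongr; exact (hG x).1.le
    have e4 := _root_.abs_sub_le (F (G x)) (F (G₁ x)) (F₁ (G₁ x))
    simp only [comp_apply]
    nlinarith
  · rw [deriv_comp x (L.differentiable _) (L'.differentiable _),
      deriv_comp x (hF₁ _) (hG₁ _)]
    have e1 := hu (G x) (G₁ x) ((hG x).1.trans_le h1)
    have e2 := (hF (G₁ x)).2
    have e3 := (hG x).2
    have e4 : |deriv G₁ x| ≤ C + 1 := by
      have := abs_sub_abs_le_abs_sub (deriv G₁ x) (deriv G x)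
      rw [abs_sub_comm] at this
      linarith [hC x]
    have e5 : deriv F (G x) * deriv G x - deriv F₁ (G₁ x) * deriv G₁ x =
        deriv F (G x) * (deriv G x - deriv G₁ x) +
        (deriv F (G x) - deriv F (G₁ x)) * deriv G₁ x +
        (deriv F (G₁ x) - deriv F₁ (G₁ x)) * deriv G₁ x := by ring
    have e6 : |deriv F (G x) * (deriv G x - deriv G₁ x)| ≤ B * δ := by
      rw [abs_mul]; gcongr; exact hB _
    have e7 : |(deriv F (G x) - deriv F (G₁ x)) * deriv G₁ x| ≤ ε / (3 * (C + 1)) * (C + 1) := by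
      rw [abs_mul]; gcongr
    have e8 : |(deriv F (G₁ x) - deriv F₁ (G₁ x)) * deriv G₁ x| ≤ δ * (C + 1) := by
      rw [abs_mul]; gcongr
    have e9 : ε / (3 * (C + 1)) * (C + 1) = ε / 3 := by field_simp
    rw [e5]
    have e10 := abs_add_three (deriv F (G x) * (deriv G x - deriv G₁ x))
      ((deriv F (G x) - deriv F (G₁ x)) * deriv G₁ x)
      ((deriv F (G₁ x) - deriv F₁ (G₁ x)) * deriv G₁ x)
    nlinarith

/-- Iteration is continuous for the `C¹` topology. -/
theorem close_iterate (L : IsCircleLift 1 d F) (n : ℕ) {ε : ℝ} (hε : 0 < ε) :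
    ∃ δ, 0 < δ ∧ ∀ F₁ : ℝ → ℝ, Differentiable ℝ F₁ → C1Close δ F F₁ →
      C1Close ε F^[n] F₁^[n] := by
  induction n generalizing ε with
  | zero => exact ⟨1, one_pos, fun F₁ _ _ => C1Close.refl hε _⟩
  | succ n ih =>
    obtain ⟨δ, hδ, h⟩ := close_comp (L.iterate le_rfl n) L hε
    obtain ⟨δ', hδ', h'⟩ := ih hδ
    refine ⟨min δ δ', by positivity, fun F₁ hF₁ hc => ?_⟩
    exact h _ _ (hF₁.iterate n) hF₁ (h' F₁ hF₁ (hc.mono (min_le_right _ _)))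
      (hc.mono (min_le_left _ _))

/-! ### Lifts and the group of circle diffeomorphisms -/

theorem periodic_coe (L : IsCircleLift r d F) :
    Periodic (fun x => (F x : UnitAddCircle)) (1 : ℝ) := fun x => by
  simp only [L.map_add_one]
  rw [AddCircle.coe_add, AddCircle.coe_eq_zero_iff (p := (1 : ℝ)) (x := (d : ℝ)) |>.2 ⟨d, by simp⟩,
    add_zero]

/-- The circle diffeomorphism with a given lift. -/
theorem exists_diff (L : IsCircleLift 1 d F) :
    ∃ f : circleDiff 1, ∀ x : ℝ, f.1 (x : UnitAddCircle) = (F x : UnitAddCircle) := by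
  obtain ⟨G, LG, hl, hr⟩ := L.exists_inverse le_rfl
  let e : Equiv.Perm UnitAddCircle :=
    { toFun := L.periodic_coe.lift
      invFun := LG.periodic_coe.lift
      left_inv := fun z => by
        induction z using QuotientAddGroup.induction_on with
        | H x => exact congrArg _ (hl x)
      right_inv := fun z => by
        induction z using QuotientAddGroup.induction_on with
        | H x => exact congrArg _ (hr x) }
  exact ⟨⟨e, ⟨F, L.contDiff, fun x => rfl⟩, ⟨G, LG.contDiff, fun x => rfl⟩⟩, fun x => rfl⟩

end IsCircleLift

theorem circle_coe_eq_iff {x y : ℝ} :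
    (x : UnitAddCircle) = y ↔ ∃ n : ℤ, x = y + n := by
  rw [← sub_eq_zero, ← AddCircle.coe_sub, AddCircle.coe_eq_zero_iff]
  constructor
  · rintro ⟨n, hn⟩; exact ⟨n, by simp at hn; linarith⟩
  · rintro ⟨n, hn⟩; exact ⟨n, by simp; linarith⟩

/-- Every `C¹` diffeomorphism of the circle has a lift of degree `1` or `-1`. -/
theorem exists_circleLift (f : circleDiff 1) : ∃ (d : ℤ) (F : ℝ → ℝ), IsCircleLift 1 d F ∧
    ∀ x : ℝ, f.1 (x : UnitAddCircle) = (F x : UnitAddCircle) := by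
  obtain ⟨⟨F, hF, hf⟩, ⟨G, hG, hg⟩⟩ := f.2
  have per : ∀ x : ℝ, ((x + 1 : ℝ) : UnitAddCircle) = x := fun x =>
    circle_coe_eq_iff.2 ⟨1, by simp⟩
  obtain ⟨d, hd⟩ := exists_int_const (φ := fun x => F (x + 1) - F x)
    (by have := hF.continuous; fun_prop) fun x => by
      have : (F (x + 1) : UnitAddCircle) = F x := by rw [← hf, ← hf, per]
      obtain ⟨n, hn⟩ := circle_coe_eq_iff.1 this
      exact ⟨n, by linarith⟩
  obtain ⟨k, hk⟩ := exists_int_const (φ := fun x => G (x + 1) - G x)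
    (by have := hG.continuous; fun_prop) fun x => by
      have : (G (x + 1) : UnitAddCircle) = G x := by rw [← hg, ← hg, per]
      obtain ⟨n, hn⟩ := circle_coe_eq_iff.1 this
      exact ⟨n, by linarith⟩
  obtain ⟨m, hm⟩ := exists_int_const (φ := fun x => G (F x) - x)
    (by have := hG.continuous; have := hF.continuous; fun_prop) fun x => by
      have : (G (F x) : UnitAddCircle) = x := by rw [← hg, ← hf, Equiv.symm_apply_apply]
      obtain ⟨n, hn⟩ := circle_coe_eq_iff.1 this
      exact ⟨n, by linarith⟩
  have hGn : ∀ (x : ℝ) (n : ℕ), G (x + n) = G x + k * n := fun x n => by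
    induction n with
    | zero => simp
    | succ n ih => push_cast; rw [← add_assoc]; linarith [hk (x + n)]
  have hGd : ∀ (x : ℝ), G (x + d) = G x + k * d := fun x => by
    obtain ⟨n, rfl | rfl⟩ := d.eq_nat_or_neg
    · exact_mod_cast hGn x n
    · have := hGn (x - n) n
      rw [sub_add_cancel] at this
      push_cast; rw [← sub_eq_add_neg]; linarith
  have hkd : k * d = 1 := by
    have h1 := hm 0
    have h2 := hm (0 + 1)
    have h3 := hd 0
    rw [show F (0 + 1) = F 0 + d by linarith, hGd] at h2
    have : (k : ℝ) * d = 1 := by linarith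
    exact_mod_cast this
  have hdeg : d = 1 ∨ d = -1 := Int.eq_one_or_neg_one_of_mul_eq_one (by rw [mul_comm]; exact hkd)
  refine ⟨d, F, IsCircleLift.of_deriv_ne le_rfl hF hdeg (fun x => by linarith [hd x])
    (fun x => ?_), hf⟩
  have h1 : deriv (G ∘ F) x = 1 := by
    rw [show G ∘ F = fun x => x + (m : ℝ) from funext fun x => by simp; linarith [hm x]]
    simp
  rw [deriv_comp x (hG.differentiable (by norm_num) _) (hF.differentiable (by norm_num) _)] at h1
  exact right_ne_zero_of_mul (h1 ▸ one_ne_zero)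

/-! ### Periodic discrete subsets of the line -/

/-- `p : ℤ → ℝ` enumerates increasingly a `1`-periodic discrete set with `N` points per period. -/
structure IsMarking (N : ℕ) (p : ℤ → ℝ) : Prop where
  pos : 0 < N
  strictMono : StrictMono p
  map_add : ∀ i, p (i + N) = p i + 1

theorem int_eq_add_of_strictMono_surjective {σ : ℤ → ℤ} (hm : StrictMono σ)
    (hs : Surjective σ) (i : ℤ) : σ i = σ 0 + i := by
  have step : ∀ j, σ (j + 1) = σ j + 1 := fun j => by
    obtain ⟨k, hk⟩ := hs (σ j + 1)
    have h1 : j < k := hm.lt_iff_lt.1 (by omega)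
    have h2 : σ (j + 1) ≤ σ k := hm.monotone h1
    have h3 := hm (show j < j + 1 by omega)
    omega
  induction i using Int.induction_on with
  | zero => simp
  | succ i ih => rw [step, ih]; ring
  | pred i ih => have := step (-i - 1); rw [sub_add_cancel] at this; omega

namespace IsMarking

variable {N : ℕ} {p : ℤ → ℝ}

theorem map_add_mul (mk : IsMarking N p) (i k : ℤ) : p (i + N * k) = p i + k := by
  induction k using Int.induction_on with
  | zero => simp
  | succ k ih =>
    rw [show i + N * ((k : ℤ) + 1) = i + N * k + N by ring, mk.map_add, ih]; push_cast; ring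
  | pred k ih =>
    have := mk.map_add (i + N * (-(k : ℤ) - 1))
    rw [show i + N * (-(k : ℤ) - 1) + N = i + N * (-k : ℤ) by ring, ih] at this
    push_cast at this ⊢; linarith

theorem exists_mem_Ico (mk : IsMarking N p) (x : ℝ) : ∃ i, p i ≤ x ∧ x < p (i + 1) := by
  have hb : ∃ b : ℤ, ∀ z, p z ≤ x → z ≤ b := by
    refine ⟨N * ⌈x - p 0⌉, fun z hz => ?_⟩
    by_contra hlt
    push Not at hlt
    have h1 := mk.strictMono hlt
    have h2 := mk.map_add_mul 0 ⌈x - p 0⌉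
    rw [zero_add] at h2
    linarith [Int.le_ceil (x - p 0)]
  have he : ∃ z, p z ≤ x := ⟨0 + N * ⌊x - p 0⌋, by
    rw [mk.map_add_mul]; linarith [Int.floor_le (x - p 0)]⟩
  obtain ⟨i, hi, hmax⟩ := Int.exists_greatest_of_bdd hb he
  refine ⟨i, hi, ?_⟩
  by_contra hlt
  push Not at hlt
  have := hmax _ hlt
  omega

theorem exists_mem_Ioo (mk : IsMarking N p) {x : ℝ} (hx : x ∉ Set.range p) :
    ∃ i, x ∈ Set.Ioo (p i) (p (i + 1)) := by
  obtain ⟨i, h1, h2⟩ := mk.exists_mem_Ico x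
  exact ⟨i, lt_of_le_of_ne h1 fun h => hx ⟨i, h⟩, h2⟩

theorem notMem_range (mk : IsMarking N p) {x : ℝ} {i : ℤ}
    (hx : x ∈ Set.Ioo (p i) (p (i + 1))) : x ∉ Set.range p := by
  rintro ⟨j, rfl⟩
  have h1 := mk.strictMono.lt_iff_lt.1 hx.1
  have h2 := mk.strictMono.lt_iff_lt.1 hx.2
  omega

theorem index_unique (mk : IsMarking N p) {x : ℝ} {i j : ℤ}
    (hi : x ∈ Set.Ioo (p i) (p (i + 1))) (hj : x ∈ Set.Ioo (p j) (p (j + 1))) : i = j := by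
  have h1 := mk.strictMono.lt_iff_lt.1 (hi.1.trans hj.2)
  have h2 := mk.strictMono.lt_iff_lt.1 (hj.1.trans hi.2)
  omega

theorem add_int_mem (mk : IsMarking N p) {x : ℝ} (n : ℤ) :
    x + n ∈ Set.range p ↔ x ∈ Set.range p := by
  constructor
  · rintro ⟨i, hi⟩
    refine ⟨i + N * (-n), ?_⟩
    rw [mk.map_add_mul, hi]; push_cast; ring
  · rintro ⟨i, rfl⟩
    exact ⟨i + N * n, mk.map_add_mul i n⟩

theorem isOpen_compl (mk : IsMarking N p) : IsOpen (Set.range p)ᶜ := by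
  rw [isOpen_iff_mem_nhds]
  intro x hx
  obtain ⟨i, hi⟩ := mk.exists_mem_Ioo hx
  filter_upwards [Ioo_mem_nhds hi.1 hi.2] with y hy using mk.notMem_range hy

/-- A locally finite `1`-periodic set containing `α` has an increasing enumeration starting
at `α`. -/
theorem exists_of_locallyFinite {S : Set ℝ} (h1 : ∀ x, x + 1 ∈ S ↔ x ∈ S)
    (hfin : ∀ a b, (S ∩ Set.Icc a b).Finite) {α : ℝ} (hα : α ∈ S) :
    ∃ (N : ℕ) (p : ℤ → ℝ), IsMarking N p ∧ Set.range p = S ∧ p 0 = α := by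
  have hfin' : ∀ a b : S, (Set.Icc a b).Finite := fun a b => by
    refine Set.Finite.of_finite_image (f := Subtype.val) ((hfin a b).subset ?_)
      Subtype.val_injective.injOn
    rintro _ ⟨x, hx, rfl⟩
    exact ⟨x.2, hx.1, hx.2⟩
  let := LocallyFiniteOrder.ofFiniteIcc hfin'
  let := LinearLocallyFiniteOrder.succOrder S
  let := LinearLocallyFiniteOrder.predOrder S
  have : Nonempty S := ⟨⟨α, hα⟩⟩
  have : NoMaxOrder S := ⟨fun a => ⟨⟨a + 1, (h1 _).2 a.2⟩, by
    rw [← Subtype.coe_lt_coe]; simp⟩⟩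
  have : NoMinOrder S := ⟨fun a => ⟨⟨a - 1, (h1 _).1 (by simp)⟩, by
    rw [← Subtype.coe_lt_coe]; simp⟩⟩
  let e : S ≃o ℤ := orderIsoIntOfLinearSuccPredArch
  let k : ℤ := e ⟨α, hα⟩
  let p : ℤ → ℝ := fun i => (e.symm (i + k)).1
  have hp : StrictMono p := fun i j hij => by
    have : e.symm (i + k) < e.symm (j + k) := e.symm.strictMono (by omega)
    exact this
  have hr : Set.range p = S := by
    ext x
    constructor
    · rintro ⟨i, rfl⟩; exact (e.symm (i + k)).2
    · intro hx; exact ⟨e ⟨x, hx⟩ - k, by simp [p]⟩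
  have hmem : ∀ i, p i ∈ S := fun i => hr ▸ Set.mem_range_self i
  have hex : ∀ i, ∃ j, p j = p i + 1 := fun i => by
    have : p i + 1 ∈ Set.range p := by rw [hr]; exact (h1 _).2 (hmem i)
    exact this
  choose τ hτ using hex
  have hτm : StrictMono τ := fun i j hij => by
    rw [← hp.lt_iff_lt, hτ, hτ]; linarith [hp hij]
  have hτs : Surjective τ := fun j => by
    have : p j - 1 ∈ Set.range p := by rw [hr]; exact (h1 _).1 (by simpa using hmem j)
    obtain ⟨i, hi⟩ := this
    exact ⟨i, hp.injective (by rw [hτ, hi]; ring)⟩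
  have hτ0 : 0 < τ 0 := by rw [← hp.lt_iff_lt, hτ]; linarith
  refine ⟨(τ 0).toNat, p, ⟨by omega, hp, fun i => ?_⟩, hr, by simp [p, k]⟩
  rw [Int.toNat_of_nonneg hτ0.le, ← hτ, int_eq_add_of_strictMono_surjective hτm hτs i, add_comm]

/-- A lift preserving the set enumerated by `p` shifts the indices, up to reflection. -/
theorem exists_shift (mk : IsMarking N p) {d : ℤ} {F : ℝ → ℝ} (L : IsCircleLift 1 d F)
    (h : ∀ x, F x ∈ Set.range p ↔ x ∈ Set.range p) : ∃ m, ∀ i, F (p i) = p (m + d * i) := by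
  have hex : ∀ i, ∃ j, p j = F (p i) := fun i => (h (p i)).2 ⟨i, rfl⟩
  choose σ hσ using hex
  have hm := mk.strictMono
  have hs : Surjective σ := fun j => by
    obtain ⟨x, hx⟩ := L.surjective (p j)
    obtain ⟨i, rfl⟩ := (h x).1 (hx ▸ ⟨j, rfl⟩)
    exact ⟨i, hm.injective (by rw [hσ, hx])⟩
  rcases L.deg with rfl | rfl
  · have : StrictMono σ := fun i j hij => by
      rw [← hm.lt_iff_lt, hσ, hσ]; exact L.strictMono (hm hij)
    exact ⟨σ 0, fun i => by
      rw [← hσ, int_eq_add_of_strictMono_surjective this hs, one_mul]⟩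
  · have h1 : StrictMono fun i => -σ i := fun i j hij => by
      have : σ j < σ i := by rw [← hm.lt_iff_lt, hσ, hσ]; exact L.strictAnti (hm hij)
      simpa using this
    have h2 : Surjective fun i => -σ i := fun j => by
      obtain ⟨i, hi⟩ := hs (-j); exact ⟨i, by simp [hi]⟩
    exact ⟨σ 0, fun i => by
      have := int_eq_add_of_strictMono_surjective h1 h2 i
      rw [← hσ]; congr 1; linarith⟩

theorem exists_interval_map (mk : IsMarking N p) {d : ℤ} {F : ℝ → ℝ} (L : IsCircleLift 1 d F)
    (h : ∀ x, F x ∈ Set.range p ↔ x ∈ Set.range p) :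
    ∃ τ : ℤ → ℤ, ∀ i, ∀ x ∈ Set.Ioo (p i) (p (i + 1)),
      F x ∈ Set.Ioo (p (τ i)) (p (τ i + 1)) := by
  obtain ⟨m, hm⟩ := mk.exists_shift L h
  rcases L.deg with rfl | rfl
  · refine ⟨fun i => m + i, fun i x hx => ?_⟩
    have h1 := L.strictMono hx.1
    have h2 := L.strictMono hx.2
    rw [hm, one_mul] at h1 h2
    exact ⟨h1, by rwa [add_assoc]⟩
  · refine ⟨fun i => m - i - 1, fun i x hx => ?_⟩
    have h1 := L.strictAnti hx.1
    have h2 := L.strictAnti hx.2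
    rw [hm] at h1 h2
    exact ⟨by convert h2 using 2; ring, by convert h1 using 2; ring⟩

end IsMarking

/-! ### Time functions and their flows -/

/-- A local inverse of a `C^n` function with nonzero derivative is `C^n`. -/
theorem contDiffAt_of_leftInvOn {n : WithTop ℕ∞} (hn : 1 ≤ n) {h g : ℝ → ℝ} {x : ℝ} {U : Set ℝ}
    (hU : U ∈ 𝓝 x) (hh : ContDiffAt ℝ n h x) (hne : deriv h x ≠ 0) (hg : ∀ y ∈ U, g (h y) = y) :
    ContDiffAt ℝ n g (h x) ∧ HasDerivAt g (deriv h x)⁻¹ (h x) := by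
  have hn0 : n ≠ 0 := by rintro rfl; simp at hn
  have hd : HasDerivAt h (deriv h x) x := (hh.differentiableAt hn0).hasDerivAt
  let f' : ℝ ≃L[ℝ] ℝ := ContinuousLinearEquiv.unitsEquivAut ℝ (Units.mk0 _ hne)
  have hf' : HasFDerivAt h (f' : ℝ →L[ℝ] ℝ) x := hd.hasFDerivAt_equiv hne
  let e := hh.toOpenPartialHomeomorph h hf' hn0
  have hxe : x ∈ e.source := hh.mem_toOpenPartialHomeomorph_source hf' hn0
  have hex : e x = h x := rfl
  have hev : g =ᶠ[𝓝 (h x)] e.symm := by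
    have hc : ContinuousAt e.symm (h x) := e.symm.continuousAt (e.map_source hxe)
    have hU' : U ∈ 𝓝 (e.symm (h x)) := by rw [← hex, e.left_inv hxe]; exact hU
    filter_upwards [hc.preimage_mem_nhds hU', e.open_target.mem_nhds (e.map_source hxe)]
      with y hy hyt
    have h1 : h (e.symm y) = y := e.right_inv hyt
    have h2 := hg _ hy
    rwa [h1] at h2
  have hes : ContDiffAt ℝ n e.symm (h x) := by
    have := e.contDiffAt_symm_deriv (f₀' := deriv h x) (n := n) (a := h x) hne (e.map_source hxe)
    rw [← hex, e.left_inv hxe] at this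
    exact this hd hh
  have hgc : ContDiffAt ℝ n g (h x) := hes.congr_of_eventuallyEq hev
  refine ⟨hgc, ?_⟩
  have hgd := (hgc.differentiableAt hn0).hasDerivAt
  have h1 : HasDerivAt (g ∘ h) (deriv g (h x) * deriv h x) x := hgd.comp x hd
  have h2 : HasDerivAt (g ∘ h) 1 x := by
    refine (hasDerivAt_id x).congr_of_eventuallyEq ?_
    filter_upwards [hU] with y hy using hg y hy
  rw [← eq_inv_of_mul_eq_one_left (h1.unique h2)]
  exact hgd

/-- A time function for a Morse-Smale vector field with zeros `p i` and exponents `lam i`: a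
`1`-periodic function off the zeros along whose flow lines time elapses at unit speed. Near a zero,
on its side `e = ±1`, it is `log |x - p i| / lam i` up to the constant `c i e`, that is, the field
is linear. -/
structure IsTimeFn (N : ℕ) (p : ℤ → ℝ) (lam : ℤ → ℝ) (c : ℤ → ℤ → ℝ) (δ : ℝ) (h : ℝ → ℝ) :
    Prop where
  mark : IsMarking N p
  lam_ne : ∀ i, lam i ≠ 0
  lam_add : ∀ i, lam (i + N) = lam i
  alternate : ∀ i, lam i * lam (i + 1) < 0
  map_add_one : ∀ x, h (x + 1) = h x
  δ_pos : 0 < δ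
  gap : ∀ i, p i + δ ≤ p (i + 1)
  near : ∀ (i e : ℤ) (u : ℝ), e = 1 ∨ e = -1 → 0 < u → u < δ →
    h (p i + e * u) = Real.log u / lam i + c i e
  smooth : ∀ x ∉ Set.range p, ContDiffAt ℝ ∞ h x
  deriv_ne : ∀ x ∉ Set.range p, deriv h x ≠ 0

/-- The inverse of the restriction of `h` to the interval `(p i, p (i + 1))`. -/
noncomputable def timeBranch (p : ℤ → ℝ) (h : ℝ → ℝ) (i : ℤ) : ℝ → ℝ :=
  invFunOn h (Set.Ioo (p i) (p (i + 1)))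

open Classical in
/-- The lift to the line of the time-`t` map of the flow with time function `h`. -/
noncomputable def flowLift (p : ℤ → ℝ) (h : ℝ → ℝ) (t x : ℝ) : ℝ :=
  if x ∈ Set.range p then x
  else timeBranch p h (Classical.epsilon fun i => x ∈ Set.Ioo (p i) (p (i + 1))) (h x + t)

open Classical in
/-- The vector field with time function `h`. -/
noncomputable def fieldLift (p : ℤ → ℝ) (h : ℝ → ℝ) (x : ℝ) : ℝ :=
  if x ∈ Set.range p then 0 else (deriv h x)⁻¹

/-- `h` restricts to a smooth chart, onto the line, of each interval between consecutive points
of `p`. -/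
structure IsTimeChart (N : ℕ) (p : ℤ → ℝ) (h : ℝ → ℝ) : Prop where
  mark : IsMarking N p
  smooth : ∀ x ∉ Set.range p, ContDiffAt ℝ ∞ h x
  deriv_ne : ∀ x ∉ Set.range p, deriv h x ≠ 0
  surjOn : ∀ (i : ℤ) (y : ℝ), ∃ x ∈ Set.Ioo (p i) (p (i + 1)), h x = y

namespace IsTimeChart

variable {N : ℕ} {p : ℤ → ℝ} {h : ℝ → ℝ}

theorem differentiableAt (T : IsTimeChart N p h) {x : ℝ} (hx : x ∉ Set.range p) :
    DifferentiableAt ℝ h x := (T.smooth x hx).differentiableAt (by simp)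

theorem injOn (T : IsTimeChart N p h) (i : ℤ) : Set.InjOn h (Set.Ioo (p i) (p (i + 1))) := by
  have key : ∀ x ∈ Set.Ioo (p i) (p (i + 1)), ∀ y ∈ Set.Ioo (p i) (p (i + 1)), x < y →
      h x ≠ h y := by
    intro x hx y hy hxy he
    have hsub : Set.Icc x y ⊆ Set.Ioo (p i) (p (i + 1)) := fun z hz =>
      ⟨hx.1.trans_le hz.1, hz.2.trans_lt hy.2⟩
    obtain ⟨z, hz, hz0⟩ := exists_deriv_eq_zero hxy (fun z hz =>
      (T.differentiableAt (T.mark.notMem_range (hsub hz))).continuousAt.continuousWithinAt) he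
    exact T.deriv_ne z (T.mark.notMem_range (hsub (Set.Ioo_subset_Icc_self hz))) hz0
  intro x hx y hy he
  rcases lt_trichotomy x y with h1 | h1 | h1
  · exact absurd he (key x hx y hy h1)
  · exact h1
  · exact absurd he.symm (key y hy x hx h1)

theorem branch_mem (T : IsTimeChart N p h) (i : ℤ) (y : ℝ) :
    timeBranch p h i y ∈ Set.Ioo (p i) (p (i + 1)) := invFunOn_mem (T.surjOn i y)

theorem apply_branch (T : IsTimeChart N p h) (i : ℤ) (y : ℝ) :
    h (timeBranch p h i y) = y := invFunOn_eq (T.surjOn i y)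

theorem branch_apply (T : IsTimeChart N p h) {i : ℤ} {x : ℝ}
    (hx : x ∈ Set.Ioo (p i) (p (i + 1))) : timeBranch p h i (h x) = x :=
  T.injOn i (T.branch_mem i _) hx (T.apply_branch i _)

theorem branch_eq (T : IsTimeChart N p h) {i : ℤ} {x y : ℝ}
    (hx : x ∈ Set.Ioo (p i) (p (i + 1))) (hy : h x = y) : timeBranch p h i y = x := by
  rw [← hy, T.branch_apply hx]

theorem branch_contDiffAt (T : IsTimeChart N p h) (i : ℤ) (y : ℝ) :
    ContDiffAt ℝ ∞ (timeBranch p h i) y ∧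
      HasDerivAt (timeBranch p h i) (fieldLift p h (timeBranch p h i y)) y := by
  have hm := T.branch_mem i y
  have hn := T.mark.notMem_range hm
  have := contDiffAt_of_leftInvOn (n := ∞) (by exact_mod_cast le_top) (Ioo_mem_nhds hm.1 hm.2)
    (T.smooth _ hn) (T.deriv_ne _ hn) (fun z hz => T.branch_apply hz)
  rw [T.apply_branch] at this
  rwa [fieldLift, if_neg hn]

end IsTimeChart

namespace IsTimeFn

variable {N : ℕ} {p : ℤ → ℝ} {lam : ℤ → ℝ} {c : ℤ → ℤ → ℝ} {δ : ℝ} {h : ℝ → ℝ}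

theorem mem_right (T : IsTimeFn N p lam c δ h) {i : ℤ} {u : ℝ} (h0 : 0 < u) (h1 : u < δ) :
    p i + u ∈ Set.Ioo (p i) (p (i + 1)) := ⟨by linarith, by linarith [T.gap i]⟩

theorem mem_left (T : IsTimeFn N p lam c δ h) {i : ℤ} {u : ℝ} (h0 : 0 < u) (h1 : u < δ) :
    p (i + 1) - u ∈ Set.Ioo (p i) (p (i + 1)) := ⟨by linarith [T.gap i], by linarith⟩

theorem notMem (T : IsTimeFn N p lam c δ h) {i e : ℤ} (he : e = 1 ∨ e = -1) {u : ℝ} (h0 : 0 < u)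
    (h1 : u < δ) : p i + e * u ∉ Set.range p := by
  rcases he with rfl | rfl
  · simpa using T.mark.notMem_range (T.mem_right (i := i) h0 h1)
  · have := T.mark.notMem_range (T.mem_left (i := i - 1) h0 h1)
    rw [sub_add_cancel] at this
    simpa [sub_eq_add_neg] using this

theorem near_right (T : IsTimeFn N p lam c δ h) {i : ℤ} {u : ℝ} (h0 : 0 < u) (h1 : u < δ) :
    h (p i + u) = Real.log u / lam i + c i 1 := by
  simpa using T.near i 1 u (Or.inl rfl) h0 h1

theorem near_left (T : IsTimeFn N p lam c δ h) {i : ℤ} {u : ℝ} (h0 : 0 < u) (h1 : u < δ) :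
    h (p i - u) = Real.log u / lam i + c i (-1) := by
  simpa [sub_eq_add_neg] using T.near i (-1) u (Or.inr rfl) h0 h1

theorem map_add_int (T : IsTimeFn N p lam c δ h) (x : ℝ) (n : ℤ) : h (x + n) = h x := by
  have : Periodic h 1 := T.map_add_one
  simpa using this.int_mul n x

theorem differentiableAt (T : IsTimeFn N p lam c δ h) {x : ℝ} (hx : x ∉ Set.range p) :
    DifferentiableAt ℝ h x := (T.smooth x hx).differentiableAt (by simp)

theorem exists_right (T : IsTimeFn N p lam c δ h) (i : ℤ) (y : ℝ)
    (hy : Real.exp (lam i * (y - c i 1)) < δ) :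
    h (p i + Real.exp (lam i * (y - c i 1))) = y := by
  have := T.lam_ne i
  rw [T.near_right (Real.exp_pos _) hy, Real.log_exp]; field_simp; ring

theorem exists_left (T : IsTimeFn N p lam c δ h) (i : ℤ) (y : ℝ)
    (hy : Real.exp (lam i * (y - c i (-1))) < δ) :
    h (p i - Real.exp (lam i * (y - c i (-1)))) = y := by
  have := T.lam_ne i
  rw [T.near_left (Real.exp_pos _) hy, Real.log_exp]; field_simp; ring

/-- Since the exponents at the two ends have opposite signs, `h` takes all real values on each
interval. -/
theorem surjOn (T : IsTimeFn N p lam c δ h) (i : ℤ) (y : ℝ) :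
    ∃ x ∈ Set.Ioo (p i) (p (i + 1)), h x = y := by
  have small : ∀ (l c₀ : ℝ), (0 < l → ∃ s ≤ y, Real.exp (l * (s - c₀)) < δ) ∧
      (l < 0 → ∃ s, y ≤ s ∧ Real.exp (l * (s - c₀)) < δ) := by
    intro l c₀
    have hδ : Real.exp (Real.log δ - 1) < δ := by
      rw [Real.exp_sub, Real.exp_log T.δ_pos]
      exact div_lt_self T.δ_pos (by simp)
    constructor <;> intro hl
    · refine ⟨min y ((Real.log δ - 1) / l + c₀), min_le_left _ _, lt_of_le_of_lt ?_ hδ⟩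
      rw [Real.exp_le_exp]
      calc _ ≤ l * ((Real.log δ - 1) / l + c₀ - c₀) := by gcongr; exact min_le_right _ _
        _ = _ := by field_simp; ring
    · refine ⟨max y ((Real.log δ - 1) / l + c₀), le_max_left _ _, lt_of_le_of_lt ?_ hδ⟩
      rw [Real.exp_le_exp]
      calc _ ≤ l * ((Real.log δ - 1) / l + c₀ - c₀) :=
            mul_le_mul_of_nonpos_left (by gcongr; exact le_max_right _ _) hl.le
        _ = _ := by have := hl.ne; field_simp; ring
  have hc : ContinuousOn h (Set.Ioo (p i) (p (i + 1))) := fun x hx =>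
    (T.differentiableAt (T.mark.notMem_range hx)).continuousAt.continuousWithinAt
  have hconn : IsPreconnected (Set.Ioo (p i) (p (i + 1))) := isPreconnected_Ioo
  have fin : ∀ a ∈ Set.Ioo (p i) (p (i + 1)), ∀ b ∈ Set.Ioo (p i) (p (i + 1)), h a ≤ y → y ≤ h b →
      ∃ x ∈ Set.Ioo (p i) (p (i + 1)), h x = y := fun a ha b hb h1 h2 =>
    hconn.intermediate_value ha hb hc ⟨h1, h2⟩
  have halt := T.alternate i
  rcases lt_or_gt_of_ne (T.lam_ne i) with h0 | h0
  · have h1 : 0 < lam (i + 1) := by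
      by_contra hn; push Not at hn; nlinarith
    obtain ⟨s, hs, hsδ⟩ := (small _ (c (i + 1) (-1))).1 h1
    obtain ⟨s', hs', hsδ'⟩ := (small _ (c i 1)).2 h0
    exact fin _ (T.mem_left (Real.exp_pos _) hsδ) _ (T.mem_right (Real.exp_pos _) hsδ')
      (by rwa [T.exists_left _ _ hsδ]) (by rwa [T.exists_right _ _ hsδ'])
  · have h1 : lam (i + 1) < 0 := by
      by_contra hn; push Not at hn; nlinarith
    obtain ⟨s, hs, hsδ⟩ := (small _ (c (i + 1) (-1))).2 h1
    obtain ⟨s', hs', hsδ'⟩ := (small _ (c i 1)).1 h0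
    exact fin _ (T.mem_right (Real.exp_pos _) hsδ') _ (T.mem_left (Real.exp_pos _) hsδ)
      (by rwa [T.exists_right _ _ hsδ']) (by rwa [T.exists_left _ _ hsδ])

theorem chart (T : IsTimeFn N p lam c δ h) : IsTimeChart N p h :=
  ⟨T.mark, T.smooth, T.deriv_ne, T.surjOn⟩

/-! ### The flow of a time function -/

theorem flow_of_mem (T : IsTimeFn N p lam c δ h) {i : ℤ} {x : ℝ}
    (hx : x ∈ Set.Ioo (p i) (p (i + 1))) (t : ℝ) :
    flowLift p h t x = timeBranch p h i (h x + t) := by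
  rw [flowLift, if_neg (T.mark.notMem_range hx)]
  congr 1
  exact T.mark.index_unique (Classical.epsilon_spec (p := fun i => x ∈ Set.Ioo (p i) (p (i + 1)))
    ⟨i, hx⟩) hx

theorem flow_marked (t : ℝ) (i : ℤ) : flowLift p h t (p i) = p i := by
  rw [flowLift, if_pos ⟨i, rfl⟩]

theorem flow_mem (T : IsTimeFn N p lam c δ h) {i : ℤ} {x : ℝ}
    (hx : x ∈ Set.Ioo (p i) (p (i + 1))) (t : ℝ) :
    flowLift p h t x ∈ Set.Ioo (p i) (p (i + 1)) := by
  rw [T.flow_of_mem hx]; exact T.chart.branch_mem _ _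

theorem flow_notMem (T : IsTimeFn N p lam c δ h) {x : ℝ} (hx : x ∉ Set.range p) (t : ℝ) :
    flowLift p h t x ∉ Set.range p := by
  obtain ⟨i, hi⟩ := T.mark.exists_mem_Ioo hx
  exact T.mark.notMem_range (T.flow_mem hi t)

theorem time_flow (T : IsTimeFn N p lam c δ h) {x : ℝ} (hx : x ∉ Set.range p) (t : ℝ) :
    h (flowLift p h t x) = h x + t := by
  obtain ⟨i, hi⟩ := T.mark.exists_mem_Ioo hx
  rw [T.flow_of_mem hi, T.chart.apply_branch]

theorem flow_eq (T : IsTimeFn N p lam c δ h) {i : ℤ} {x y : ℝ}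
    (hx : x ∈ Set.Ioo (p i) (p (i + 1))) (hy : y ∈ Set.Ioo (p i) (p (i + 1))) {t : ℝ}
    (hxy : h y = h x + t) : flowLift p h t x = y := by
  rw [T.flow_of_mem hx, T.chart.branch_eq hy hxy]

theorem flow_zero (T : IsTimeFn N p lam c δ h) (x : ℝ) : flowLift p h 0 x = x := by
  by_cases hx : x ∈ Set.range p
  · rw [flowLift, if_pos hx]
  · obtain ⟨i, hi⟩ := T.mark.exists_mem_Ioo hx
    exact T.flow_eq hi hi (by simp)

theorem flow_add (T : IsTimeFn N p lam c δ h) (s t x : ℝ) :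
    flowLift p h (s + t) x = flowLift p h s (flowLift p h t x) := by
  by_cases hx : x ∈ Set.range p
  · obtain ⟨i, rfl⟩ := hx
    rw [flow_marked, flow_marked, flow_marked]
  · obtain ⟨i, hi⟩ := T.mark.exists_mem_Ioo hx
    refine T.flow_eq hi (T.flow_mem (T.flow_mem hi _) _) ?_
    rw [T.time_flow (T.flow_notMem hx _), T.time_flow hx]; ring

theorem flow_add_one (T : IsTimeFn N p lam c δ h) (t x : ℝ) :
    flowLift p h t (x + 1) = flowLift p h t x + 1 := by
  by_cases hx : x ∈ Set.range p
  · obtain ⟨i, rfl⟩ := hx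
    rw [flow_marked, ← T.mark.map_add, flow_marked]
  · obtain ⟨i, hi⟩ := T.mark.exists_mem_Ioo hx
    have hs : ∀ y ∈ Set.Ioo (p i) (p (i + 1)), y + 1 ∈ Set.Ioo (p (i + N)) (p (i + N + 1)) := by
      intro y hy
      rw [show i + N + 1 = i + 1 + N by ring, T.mark.map_add, T.mark.map_add]
      exact ⟨by linarith [hy.1], by linarith [hy.2]⟩
    refine T.flow_eq (hs _ hi) (hs _ (T.flow_mem hi t)) ?_
    rw [T.map_add_one, T.map_add_one, T.time_flow hx]

/-- Near its zeros the flow is linear. -/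
theorem flow_near (T : IsTimeFn N p lam c δ h) (t : ℝ) (i : ℤ) :
    ∀ᶠ x in 𝓝 (p i), flowLift p h t x = p i + Real.exp (lam i * t) * (x - p i) := by
  set E := Real.exp (lam i * t) with hE
  have hE0 : 0 < E := Real.exp_pos _
  have hl := T.lam_ne i
  have h1 : Set.Ioo (p i - min δ (δ / E)) (p i + min δ (δ / E)) ∈ 𝓝 (p i) := by
    have : 0 < min δ (δ / E) := by have := T.δ_pos; positivity
    exact Ioo_mem_nhds (by linarith) (by linarith)
  filter_upwards [h1] with x hx
  have key : ∀ u, u < min δ (δ / E) → u < δ ∧ E * u < δ := fun u hu => by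
    refine ⟨hu.trans_le (min_le_left _ _), ?_⟩
    have := hu.trans_le (min_le_right _ _)
    rwa [lt_div_iff₀' hE0] at this
  rcases lt_trichotomy x (p i) with hlt | rfl | hgt
  · obtain ⟨k1, k2⟩ := key (p i - x) (by linarith [hx.1])
    have k0 : 0 < p i - x := by linarith
    have m1 := T.mem_left (i := i - 1) k0 k1
    have m2 := T.mem_left (i := i - 1) (by positivity) k2
    rw [sub_add_cancel] at m1 m2
    have n1 := T.near_left (i := i) k0 k1
    have n2 := T.near_left (i := i) (by positivity) k2
    rw [sub_sub_cancel] at m1 n1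
    have m3 : p i - E * (p i - x) = p i + E * (x - p i) := by ring
    rw [m3] at m2 n2
    refine T.flow_eq (i := i - 1) (by rwa [sub_add_cancel]) (by rwa [sub_add_cancel]) ?_
    rw [n1, n2, Real.log_mul hE0.ne' k0.ne', hE, Real.log_exp]; field_simp; ring
  · rw [flow_marked]; ring
  · obtain ⟨k1, k2⟩ := key (x - p i) (by linarith [hx.2])
    have k0 : 0 < x - p i := by linarith
    have m1 := T.mem_right (i := i) k0 k1
    have m2 := T.mem_right (i := i) (by positivity) k2
    have n1 := T.near_right (i := i) k0 k1
    have n2 := T.near_right (i := i) (by positivity) k2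
    rw [add_sub_cancel] at m1 n1
    refine T.flow_eq (i := i) m1 m2 ?_
    rw [n1, n2, Real.log_mul hE0.ne' k0.ne', hE, Real.log_exp]; field_simp; ring

theorem flow_isCircleLift (T : IsTimeFn N p lam c δ h) (t : ℝ) :
    IsCircleLift 1 1 (flowLift p h t) := by
  have hc : ∀ s, ContDiff ℝ 1 (flowLift p h s) := by
    intro s
    rw [contDiff_iff_contDiffAt]
    intro x
    by_cases hx : x ∈ Set.range p
    · obtain ⟨i, rfl⟩ := hx
      refine ContDiffAt.congr_of_eventuallyEq ?_ (T.flow_near s i)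
      fun_prop
    · obtain ⟨i, hi⟩ := T.mark.exists_mem_Ioo hx
      have hev : flowLift p h s =ᶠ[𝓝 x] timeBranch p h i ∘ fun y => h y + s := by
        filter_upwards [Ioo_mem_nhds hi.1 hi.2] with y hy using T.flow_of_mem hy s
      refine ContDiffAt.congr_of_eventuallyEq ?_ hev
      have hle : (1 : WithTop ℕ∞) ≤ ∞ := by exact_mod_cast le_top
      exact ((T.chart.branch_contDiffAt i _).1.of_le hle).comp x
        (((T.smooth x hx).of_le hle).add contDiffAt_const)
  refine IsCircleLift.of_deriv_ne le_rfl (hc t) (Or.inl rfl)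
    (fun x => by rw [T.flow_add_one]; simp) fun x => ?_
  have h1 : deriv (flowLift p h (-t) ∘ flowLift p h t) x = 1 := by
    rw [show flowLift p h (-t) ∘ flowLift p h t = _root_.id from funext fun y => by
      rw [comp_apply, ← T.flow_add, neg_add_cancel, T.flow_zero]; rfl]
    simp
  rw [deriv_comp x ((hc _).differentiable (by norm_num) _)
    ((hc _).differentiable (by norm_num) _)] at h1
  exact right_ne_zero_of_mul (h1 ▸ one_ne_zero)

theorem hasDerivAt_flow (T : IsTimeFn N p lam c δ h) (x t : ℝ) :
    HasDerivAt (fun s => flowLift p h s x) (fieldLift p h (flowLift p h t x)) t := by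
  by_cases hx : x ∈ Set.range p
  · obtain ⟨i, rfl⟩ := hx
    have h0 : fieldLift p h (p i) = 0 := if_pos ⟨i, rfl⟩
    simp only [flow_marked, h0]
    exact hasDerivAt_const t (p i)
  · obtain ⟨i, hi⟩ := T.mark.exists_mem_Ioo hx
    simp only [T.flow_of_mem hi]
    exact HasDerivAt.comp_const_add (h x) t (T.chart.branch_contDiffAt i (h x + t)).2

theorem field_add_one (T : IsTimeFn N p lam c δ h) (x : ℝ) :
    fieldLift p h (x + 1) = fieldLift p h x := by
  have h1 : (x + 1 ∈ Set.range p) ↔ x ∈ Set.range p := by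
    simpa using T.mark.add_int_mem (x := x) 1
  have h2 : deriv h (x + 1) = deriv h x := by
    rw [← deriv_comp_add_const, show (fun y => h (y + 1)) = h from funext T.map_add_one]
  by_cases hx : x ∈ Set.range p
  · rw [fieldLift, fieldLift, if_pos hx, if_pos (h1.2 hx)]
  · rw [fieldLift, fieldLift, if_neg hx, if_neg (h1.not.2 hx), h2]

theorem field_near (T : IsTimeFn N p lam c δ h) (i : ℤ) :
    ∀ᶠ x in 𝓝 (p i), fieldLift p h x = lam i * (x - p i) := by
  have hδ := T.δ_pos
  filter_upwards [Ioo_mem_nhds (show p i - δ < p i by linarith)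
    (show p i < p i + δ by linarith)] with x hx
  have hl := T.lam_ne i
  have key : ∀ (e : ℤ), e = 1 ∨ e = -1 → 0 < e * (x - p i) →
      fieldLift p h x = lam i * (x - p i) := by
    intro e he hpos
    have hsq : (e : ℝ) * e = 1 := by rcases he with rfl | rfl <;> simp
    have hlt : ∀ y ∈ Set.Ioo (p i - δ) (p i + δ), e * (y - p i) < δ := fun y hy => by
      rcases he with rfl | rfl <;> push_cast <;> linarith [hy.1, hy.2]
    have hx' : ∀ y : ℝ, p i + e * (e * (y - p i)) = y := fun y => by
      rw [← mul_assoc, hsq]; ring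
    have hn : x ∉ Set.range p := by
      have := T.notMem (i := i) he hpos (hlt x hx); rwa [hx'] at this
    have hne : x - p i ≠ 0 := fun h0 => by simp [h0] at hpos
    have hev : h =ᶠ[𝓝 x] fun y => Real.log (e * (y - p i)) / lam i + c i e := by
      have ho : {y : ℝ | 0 < e * (y - p i)} ∈ 𝓝 x :=
        (isOpen_lt continuous_const (by fun_prop)).mem_nhds hpos
      filter_upwards [Ioo_mem_nhds hx.1 hx.2, ho] with y hy hy0
      have := T.near i e _ he hy0 (hlt y hy)
      rwa [hx'] at this
    have hd : HasDerivAt (fun y : ℝ => (e : ℝ) * (y - p i)) (e * 1) x :=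
      ((hasDerivAt_id x).sub_const (p i)).const_mul (e : ℝ)
    have hd2 := ((hd.log hpos.ne').div_const (lam i)).add_const (c i e)
    have he0 : (e : ℝ) ≠ 0 := fun h0 => by simp [h0] at hsq
    rw [fieldLift, if_neg hn, hev.deriv_eq, hd2.deriv]
    field_simp
  rcases lt_trichotomy x (p i) with hlt | rfl | hgt
  · exact key (-1) (Or.inr rfl) (by push_cast; linarith)
  · simp [fieldLift]
  · exact key 1 (Or.inl rfl) (by push_cast; linarith)

theorem field_contDiff (T : IsTimeFn N p lam c δ h) : ContDiff ℝ ∞ (fieldLift p h) := by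
  rw [contDiff_iff_contDiffAt]
  intro x
  by_cases hx : x ∈ Set.range p
  · obtain ⟨i, rfl⟩ := hx
    refine ContDiffAt.congr_of_eventuallyEq ?_ (T.field_near i)
    fun_prop
  · have ho := T.mark.isOpen_compl
    have hev : fieldLift p h =ᶠ[𝓝 x] fun y => (deriv h y)⁻¹ := by
      filter_upwards [ho.mem_nhds hx] with y hy
      rw [fieldLift, if_neg hy]
    refine ContDiffAt.congr_of_eventuallyEq ?_ hev
    refine ContDiffAt.inv ?_ (T.deriv_ne x hx)
    have hon : ContDiffOn ℝ ∞ h (Set.range p)ᶜ := fun y hy => (T.smooth y hy).contDiffWithinAt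
    exact (hon.deriv_of_isOpen ho (m := ∞) (by simp)).contDiffAt (ho.mem_nhds hx)

end IsTimeFn

/-! ### Circle diffeomorphisms with a given lift -/

/-- `F` is a lift, of degree `d`, of the circle diffeomorphism `f`. -/
structure IsLiftOf (f : circleDiff 1) (d : ℤ) (F : ℝ → ℝ) : Prop where
  isLift : IsCircleLift 1 d F
  map_coe : ∀ x : ℝ, f.1 (x : UnitAddCircle) = (F x : UnitAddCircle)

theorem circleDiff_ext {f g : circleDiff 1}
    (h : ∀ x : ℝ, f.1 (x : UnitAddCircle) = g.1 (x : UnitAddCircle)) : f = g := by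
  ext z
  induction z using QuotientAddGroup.induction_on with
  | H x => exact h x

namespace IsLiftOf

variable {f g : circleDiff 1} {d d' : ℤ} {F G : ℝ → ℝ}

theorem mul (hf : IsLiftOf f d F) (hg : IsLiftOf g d' G) : IsLiftOf (f * g) (d * d') (F ∘ G) :=
  ⟨hf.isLift.comp le_rfl hg.isLift, fun x => by
    change f.1 (g.1 x) = _
    rw [hg.map_coe, hf.map_coe]; rfl⟩

theorem inv (hf : IsLiftOf f d F) : ∃ G, IsLiftOf f⁻¹ d G ∧ LeftInverse G F ∧ RightInverse G F := by
  obtain ⟨G, LG, hl, hr⟩ := hf.isLift.exists_inverse le_rfl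
  refine ⟨G, ⟨LG, fun x => ?_⟩, hl, hr⟩
  change f.1.symm x = _
  rw [Equiv.symm_apply_eq, hf.map_coe, hr]

theorem pow (hf : IsLiftOf f d F) (n : ℕ) : IsLiftOf (f ^ n) (d ^ n) F^[n] := by
  induction n with
  | zero => exact ⟨by simpa using IsCircleLift.id, fun x => rfl⟩
  | succ n ih => rw [pow_succ, pow_succ, iterate_succ]; exact ih.mul hf

theorem iterate_coe (hf : IsLiftOf f d F) (n : ℕ) (x : ℝ) :
    f.1^[n] (x : UnitAddCircle) = (F^[n] x : UnitAddCircle) := by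
  rw [← (hf.pow n).map_coe]
  have : (f ^ n).1 = f.1 ^ n := rfl
  rw [this, Equiv.Perm.iterate_eq_pow]

theorem add_int (hf : IsLiftOf f d F) (n : ℤ) : IsLiftOf f d fun x => F x + n :=
  ⟨hf.isLift.add_const _, fun x => by
    rw [hf.map_coe]; exact circle_coe_eq_iff.2 ⟨-n, by push_cast; ring⟩⟩

theorem exists_int (hf : IsLiftOf f d F) (hg : IsLiftOf f d' G) : ∃ n : ℤ, ∀ x, F x = G x + n := by
  obtain ⟨n, hn⟩ := exists_int_const (φ := fun x => F x - G x)
    (hf.isLift.continuous.sub hg.isLift.continuous) fun x => by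
      obtain ⟨n, hn⟩ := circle_coe_eq_iff.1 ((hf.map_coe x).symm.trans (hg.map_coe x))
      exact ⟨n, by linarith⟩
  exact ⟨n, fun x => by linarith [hn x]⟩

theorem deg_unique (hf : IsLiftOf f d F) (hg : IsLiftOf f d' G) : d = d' := by
  obtain ⟨n, hn⟩ := hf.exists_int hg
  have h1 := hf.isLift.map_add_one 0
  have h2 := hg.isLift.map_add_one 0
  rw [hn, hn, h2] at h1
  have : (d : ℝ) = d' := by linarith
  exact_mod_cast this

end IsLiftOf

theorem exists_isLiftOf (f : circleDiff 1) : ∃ d F, IsLiftOf f d F := by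
  obtain ⟨d, F, h1, h2⟩ := exists_circleLift f
  exact ⟨d, F, h1, h2⟩

theorem circle_sbtw {a a' b : ℝ} (h1 : a < a') (h2 : a' < b) (h3 : b < a + 1) :
    sbtw (a : UnitAddCircle) a' b := by
  rw [sbtw_iff_not_btw, btw_cyclic, QuotientAddGroup.btw_coe_iff, not_le]
  have e1 : toIcoMod (zero_lt_one' ℝ) a b = b := by
    rw [toIcoMod_eq_iff]; exact ⟨⟨by linarith, by linarith⟩, 0, by simp⟩
  have e2 : toIocMod (zero_lt_one' ℝ) a a' = a' := by
    rw [toIocMod_eq_iff]; exact ⟨⟨by linarith, by linarith⟩, 0, by simp⟩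
  rw [e1, e2]; exact h2

/-! ### Wandering points -/

namespace IsTimeFn

variable {N : ℕ} {p : ℤ → ℝ} {lam : ℤ → ℝ} {c : ℤ → ℤ → ℝ} {δ : ℝ} {h : ℝ → ℝ}

theorem coe_mem_iff (T : IsTimeFn N p lam c δ h) {x : ℝ} :
    (x : UnitAddCircle) ∈ Set.range (fun i => (p i : UnitAddCircle)) ↔ x ∈ Set.range p := by
  constructor
  · rintro ⟨i, hi⟩
    obtain ⟨n, hn⟩ := circle_coe_eq_iff.1 hi
    rw [← T.mark.add_int_mem n, ← hn]; exact ⟨i, rfl⟩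
  · rintro ⟨i, rfl⟩; exact ⟨i, rfl⟩

theorem finite_coe (T : IsTimeFn N p lam c δ h) :
    (Set.range fun i => (p i : UnitAddCircle)).Finite := by
  refine ((Finset.range N).finite_toSet.image fun k : ℕ => (p k : UnitAddCircle)).subset ?_
  rintro _ ⟨i, rfl⟩
  have hN : (0 : ℤ) < N := by exact_mod_cast T.mark.pos
  have h1 := Int.emod_nonneg i hN.ne'
  have h2 := Int.emod_lt_of_pos i hN
  refine ⟨(i % N).toNat, by simp; omega, ?_⟩
  have h3 : (((i % N).toNat : ℕ) : ℤ) = i % N := Int.toNat_of_nonneg h1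
  simp only [h3]
  refine circle_coe_eq_iff.2 ⟨-(i / N), ?_⟩
  rw [← T.mark.map_add_mul]
  congr 1
  have := Int.emod_add_mul_ediv i N
  linarith

theorem periodic (T : IsTimeFn N p lam c δ h) : Periodic h (1 : ℝ) := T.map_add_one

/-- A point off the zeros is wandering for any map advancing the time function: nearby points have
nearby times. -/
theorem exists_wandering_nhds (T : IsTimeFn N p lam c δ h) {z : UnitAddCircle}
    (hz : z ∉ Set.range fun i => (p i : UnitAddCircle)) {s : ℝ} (hs : 0 < s) :
    ∃ U ∈ 𝓝 z, ∀ ψ : UnitAddCircle → UnitAddCircle, ∀ t, s ≤ t →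
      (∀ x ∉ Set.range p, T.periodic.lift (ψ (x : UnitAddCircle)) = h x + t) →
      ¬(ψ '' U ∩ U).Nonempty := by
  induction z using QuotientAddGroup.induction_on with
  | H x =>
    have hx : x ∉ Set.range p := T.coe_mem_iff.not.1 hz
    refine ⟨(fun y : ℝ => (y : UnitAddCircle)) ''
      ({y | |h y - h x| < s / 2} ∩ (Set.range p)ᶜ), ?_, ?_⟩
    · have hn : 𝓝 (x : UnitAddCircle) = Filter.map (fun y : ℝ => (y : UnitAddCircle)) (𝓝 x) :=
        QuotientAddGroup.nhds_eq _ x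
      change _ ∈ 𝓝 (x : UnitAddCircle)
      rw [hn]
      refine Filter.image_mem_map (Filter.inter_mem ?_ (T.mark.isOpen_compl.mem_nhds hx))
      have hc : ContinuousAt (fun y => |h y - h x|) x :=
        ((T.differentiableAt hx).continuousAt.sub continuousAt_const).abs
      exact hc.eventually_lt continuousAt_const (by simpa using hs)
    · rintro ψ t ht hψ ⟨w, ⟨_, ⟨y, ⟨hy, hyp⟩, rfl⟩, rfl⟩, ⟨y', ⟨hy', -⟩, hw⟩⟩
      have h1 := hψ y hyp
      simp only at hw
      rw [← hw, T.periodic.lift_coe] at h1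
      have h2 := abs_lt.1 (show |h y - h x| < s / 2 from hy)
      have h3 := abs_lt.1 (show |h y' - h x| < s / 2 from hy')
      linarith [h2.1, h3.2]

end IsTimeFn

/-! ### The dynamics of a diffeomorphism with a time function -/

/-- The combinatorial description of the diffeomorphisms of the dense set: `F` lifts a
diffeomorphism advancing the time function `h` by `1 / q`, so that its `q`-th iterate is the time-one
map of the flow. The exponent of `p 0` singles out its orbit; if `F` preserves the orientation, the
jumps of `h` do not compensate, which forbids reflections commuting with `F`. -/
structure IsModel (d : ℤ) (F : ℝ → ℝ) (q : ℕ) (M : ℤ) (N : ℕ) (p : ℤ → ℝ) (lam : ℤ → ℝ)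
    (c : ℤ → ℤ → ℝ) (δ : ℝ) (h : ℝ → ℝ) : Prop where
  time : IsTimeFn N p lam c δ h
  isLift : IsCircleLift 1 d F
  q_pos : 0 < q
  deg_pow : d ^ q = 1
  map_mem : ∀ x, F x ∈ Set.range p ↔ x ∈ Set.range p
  time_map : ∀ x ∉ Set.range p, h (F x) = h x + 1 / q
  iterate_map : ∀ i, F^[q] (p i) = p i + M
  base : ∀ i, lam i = lam 0 → ∃ (j : ℕ) (n : ℤ), F^[j] (p 0) = p i + n
  preserving : d = 1 → (∀ (j : ℕ) (n : ℤ), F^[j] (p 0) = p 0 + n → q ∣ j) ∧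
    ∑ i ∈ Finset.range N, (c i 1 - c i (-1)) ≠ 0
  reversing : d = -1 → q = 2 ∧ ∃ n : ℤ, F (p 0) = p 0 + n

namespace IsModel

variable {d : ℤ} {F : ℝ → ℝ} {q : ℕ} {M : ℤ} {N : ℕ} {p : ℤ → ℝ} {lam : ℤ → ℝ} {c : ℤ → ℤ → ℝ}
  {δ : ℝ} {h : ℝ → ℝ} {f : circleDiff 1}

theorem iterate_mem (m : IsModel d F q M N p lam c δ h) (n : ℕ) (x : ℝ) :
    F^[n] x ∈ Set.range p ↔ x ∈ Set.range p := by
  induction n with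
  | zero => rfl
  | succ n ih => rw [iterate_succ_apply', m.map_mem, ih]

theorem time_iterate (m : IsModel d F q M N p lam c δ h) (n : ℕ) {x : ℝ} (hx : x ∉ Set.range p) :
    h (F^[n] x) = h x + n / q := by
  induction n with
  | zero => simp
  | succ n ih =>
    rw [iterate_succ_apply', m.time_map _ ((m.iterate_mem n x).not.2 hx), ih]; push_cast; ring

theorem isLift_iterate (m : IsModel d F q M N p lam c δ h) : IsCircleLift 1 1 F^[q] := by
  have := m.isLift.iterate le_rfl q
  rwa [m.deg_pow] at this

theorem iterate_eq_flow (m : IsModel d F q M N p lam c δ h) (x : ℝ) :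
    F^[q] x = flowLift p h 1 x + M := by
  by_cases hx : x ∈ Set.range p
  · obtain ⟨i, rfl⟩ := hx
    rw [m.iterate_map, IsTimeFn.flow_marked]
  · obtain ⟨i, hi⟩ := m.time.mark.exists_mem_Ioo hx
    have hs := m.isLift_iterate.strictMono
    have h1 := hs hi.1
    have h2 := hs hi.2
    rw [m.iterate_map] at h1 h2
    have hq : (q : ℝ) ≠ 0 := by exact_mod_cast m.q_pos.ne'
    rw [m.time.flow_eq hi (y := F^[q] x - M) ⟨by linarith, by linarith⟩ ?_]
    · ring
    · have := m.time.map_add_int (F^[q] x - M) M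
      rw [sub_add_cancel] at this
      rw [← this, m.time_iterate q hx, div_self hq]

theorem map_flow (m : IsModel d F q M N p lam c δ h) (t x : ℝ) :
    F (flowLift p h t x) = flowLift p h t (F x) := by
  by_cases hx : x ∈ Set.range p
  · obtain ⟨i, rfl⟩ := hx
    obtain ⟨j, hj⟩ := (m.map_mem (p i)).2 ⟨i, rfl⟩
    rw [IsTimeFn.flow_marked, ← hj, IsTimeFn.flow_marked]
  · obtain ⟨i, hi⟩ := m.time.mark.exists_mem_Ioo hx
    obtain ⟨τ, hτ⟩ := m.time.mark.exists_interval_map m.isLift m.map_mem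
    symm
    refine m.time.flow_eq (hτ i _ hi) (hτ i _ (m.time.flow_mem hi t)) ?_
    rw [m.time_map _ (m.time.flow_notMem hx t), m.time.time_flow hx, m.time_map _ hx]; ring

theorem periodicPts_eq (m : IsModel d F q M N p lam c δ h) (hf : IsLiftOf f d F) :
    periodicPts f.1 = Set.range fun i => (p i : UnitAddCircle) := by
  have hq : (0 : ℝ) < q := by exact_mod_cast m.q_pos
  ext z
  constructor
  · rintro ⟨n, hn, hz⟩
    induction z using QuotientAddGroup.induction_on with
    | H x =>
      by_contra hx
      have hx' : x ∉ Set.range p := m.time.coe_mem_iff.not.1 hx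
      have h1 : f.1^[n] (x : UnitAddCircle) = x := hz
      rw [hf.iterate_coe] at h1
      obtain ⟨k, hk⟩ := circle_coe_eq_iff.1 h1
      have h2 := m.time_iterate n hx'
      rw [hk, m.time.map_add_int] at h2
      have : (0 : ℝ) < n / q := by have : (0 : ℝ) < n := by exact_mod_cast hn
                                   positivity
      linarith
  · rintro ⟨i, rfl⟩
    refine ⟨q, m.q_pos, ?_⟩
    change f.1^[q] (p i : UnitAddCircle) = p i
    rw [hf.iterate_coe, m.iterate_map]
    exact circle_coe_eq_iff.2 ⟨M, rfl⟩

theorem nonwandering_subset (m : IsModel d F q M N p lam c δ h) (hf : IsLiftOf f d F) :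
    nonwanderingSet f.1 ⊆ Set.range fun i => (p i : UnitAddCircle) := by
  intro z hz
  by_contra hn
  have hq : (0 : ℝ) < q := by exact_mod_cast m.q_pos
  obtain ⟨U, hU, hw⟩ := m.time.exists_wandering_nhds hn (s := 1 / q) (by positivity)
  obtain ⟨n, hn1, hne⟩ := hz U hU
  refine hw _ (n / q) ?_ (fun x hx => ?_) hne
  · have : (1 : ℝ) ≤ n := by exact_mod_cast hn1
    gcongr
  · rw [hf.iterate_coe, m.time.periodic.lift_coe, m.time_iterate n hx]

theorem deriv_iterate_marked (m : IsModel d F q M N p lam c δ h) (i : ℤ) :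
    deriv F^[q] (p i) = Real.exp (lam i) := by
  have h1 : F^[q] = fun x => flowLift p h 1 x + M := funext m.iterate_eq_flow
  have h2 := Filter.EventuallyEq.deriv_eq (m.time.flow_near 1 i)
  rw [h1, deriv_add_const, h2]
  have : HasDerivAt (fun x => p i + Real.exp (lam i * 1) * (x - p i))
      (Real.exp (lam i * 1) * 1) (p i) :=
    (((hasDerivAt_id _).sub_const _).const_mul _).const_add _
  rw [this.deriv]; simp

/-- A power of the multiplier of a periodic point is the exponential of the exponent there. -/
theorem exists_multiplier_pow (m : IsModel d F q M N p lam c δ h) (hf : IsLiftOf f d F) (i : ℤ) :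
    ∃ k, k ≠ 0 ∧ |periodMultiplier f.1 (p i : UnitAddCircle)| ^ k = Real.exp (lam i) := by
  set r := minimalPeriod f.1 (p i : UnitAddCircle) with hr
  have hper : IsPeriodicPt f.1 q (p i : UnitAddCircle) := by
    change f.1^[q] (p i : UnitAddCircle) = p i
    rw [hf.iterate_coe, m.iterate_map]
    exact circle_coe_eq_iff.2 ⟨M, rfl⟩
  obtain ⟨k, hk⟩ : r ∣ q := hper.minimalPeriod_dvd
  have hk0 : k ≠ 0 := by rintro rfl; have := m.q_pos; omega
  refine ⟨k, hk0, ?_⟩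
  have hrp : f.1^[r] (p i : UnitAddCircle) = p i := isPeriodicPt_minimalPeriod _ _
  rw [hf.iterate_coe] at hrp
  obtain ⟨n, hn⟩ := circle_coe_eq_iff.1 hrp
  have LR := m.isLift.iterate le_rfl r
  have hmul : periodMultiplier f.1 (p i : UnitAddCircle) = deriv F^[r] (p i) := by
    rw [periodMultiplier, ← hr]
    exact circleDeriv_coe LR.continuous (hf.iterate_coe r) (p i)
  have hint : ∀ j : ℕ, ∃ l : ℤ, (F^[r])^[j] (p i) = p i + l := fun j => by
    induction j with
    | zero => exact ⟨0, by simp⟩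
    | succ j ih =>
      obtain ⟨l, hl⟩ := ih
      refine ⟨n + d ^ r * l, ?_⟩
      rw [iterate_succ_apply', hl, LR.map_add_int, hn]; push_cast; ring
  rw [hmul, ← abs_pow, ← m.deriv_iterate_marked, hk, iterate_mul, LR.deriv_iterate]
  rw [Finset.prod_congr rfl (g := fun _ => deriv F^[r] (p i)), Finset.prod_const,
    Finset.card_range, abs_of_pos]
  · have h1 : deriv F^[q] (p i) = deriv F^[r] (p i) ^ k := by
      rw [hk, iterate_mul, LR.deriv_iterate]
      rw [Finset.prod_congr rfl (g := fun _ => deriv F^[r] (p i)), Finset.prod_const,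
        Finset.card_range]
      intro j _
      obtain ⟨l, hl⟩ := hint j
      rw [hl, LR.deriv_add_int]
    rw [← h1, m.deriv_iterate_marked]; exact Real.exp_pos _
  · intro j _
    obtain ⟨l, hl⟩ := hint j
    rw [hl, LR.deriv_add_int]

theorem isAttracting_of_neg (m : IsModel d F q M N p lam c δ h) (hf : IsLiftOf f d F) {i : ℤ}
    (hi : lam i < 0) : IsAttractingPeriodic f.1 (p i : UnitAddCircle) := by
  refine ⟨by rw [m.periodicPts_eq hf]; exact ⟨i, rfl⟩, ?_⟩
  obtain ⟨k, hk, he⟩ := m.exists_multiplier_pow hf i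
  have := Real.exp_lt_one_iff.2 hi
  rw [← he] at this
  exact (pow_lt_one_iff_of_nonneg (abs_nonneg _) hk).1 this

theorem isRepelling_of_pos (m : IsModel d F q M N p lam c δ h) (hf : IsLiftOf f d F) {i : ℤ}
    (hi : 0 < lam i) : IsRepellingPeriodic f.1 (p i : UnitAddCircle) := by
  refine ⟨by rw [m.periodicPts_eq hf]; exact ⟨i, rfl⟩, ?_⟩
  obtain ⟨k, hk, he⟩ := m.exists_multiplier_pow hf i
  have := Real.one_lt_exp_iff.2 hi
  rw [← he] at this
  exact (one_lt_pow_iff_of_nonneg (abs_nonneg _) hk).1 this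

theorem isMorseSmale (m : IsModel d F q M N p lam c δ h) (hf : IsLiftOf f d F) :
    IsMorseSmaleDiffeo f := by
  have hP := m.periodicPts_eq hf
  refine ⟨m.time.finite_coe.subset (m.nonwandering_subset hf), fun x hx => ?_, fun x hx => ?_, ?_⟩
  · rw [hP]; exact m.nonwandering_subset hf hx
  · obtain ⟨i, rfl⟩ := m.nonwandering_subset hf hx
    rcases lt_or_gt_of_ne (m.time.lam_ne i) with hi | hi
    · exact (m.isAttracting_of_neg hf hi).2.ne
    · exact (m.isRepelling_of_pos hf hi).2.ne'
  · intro x hx y hy hxy hno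
    rw [hP] at hx hy
    obtain ⟨i, rfl⟩ := hx
    obtain ⟨k, rfl⟩ := hy
    beta_reduce at hxy hno ⊢
    have mk := m.time.mark
    -- a representative of `y` in the period starting at `x`
    obtain ⟨b, hb, hbI⟩ : ∃ b : ℝ, (b : UnitAddCircle) = p k ∧ b ∈ Set.Ico (p i) (p i + 1) :=
      ⟨toIcoMod zero_lt_one (p i) (p k), by
        refine circle_coe_eq_iff.2 ⟨-toIcoDiv zero_lt_one (p i) (p k), ?_⟩
        rw [toIcoMod]; simp; ring, toIcoMod_mem_Ico _ _ _⟩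
    obtain ⟨j, rfl⟩ : b ∈ Set.range p := by
      rw [← m.time.coe_mem_iff, hb]; exact ⟨k, rfl⟩
    have hij : i < j := by
      rw [← mk.strictMono.lt_iff_lt]
      refine lt_of_le_of_ne hbI.1 fun he => hxy ?_
      rw [he, hb]
    have hj : j = i + 1 := by
      by_contra hne
      have h1 : i + 1 < j := by omega
      have := circle_sbtw (mk.strictMono (show i < i + 1 by omega)) (mk.strictMono h1) hbI.2
      rw [hb] at this
      exact hno _ this (by rw [hP]; exact ⟨i + 1, rfl⟩)
    subst hj
    rw [← hb]
    have halt := m.time.alternate i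
    rcases lt_or_gt_of_ne (m.time.lam_ne i) with hi | hi
    · exact Or.inl ⟨m.isAttracting_of_neg hf hi, m.isRepelling_of_pos hf (by nlinarith)⟩
    · exact Or.inr ⟨m.isRepelling_of_pos hf hi, m.isAttracting_of_neg hf (by nlinarith)⟩

end IsModel

/-! ### The centralizer -/

theorem IsTimeFn.hasDerivAt_flow_marked {N : ℕ} {p : ℤ → ℝ} {lam : ℤ → ℝ} {c : ℤ → ℤ → ℝ} {δ : ℝ}
    {h : ℝ → ℝ} (T : IsTimeFn N p lam c δ h) (t : ℝ) (i : ℤ) :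
    HasDerivAt (flowLift p h t) (Real.exp (lam i * t)) (p i) := by
  have : HasDerivAt (fun x => p i + Real.exp (lam i * t) * (x - p i))
      (Real.exp (lam i * t) * 1) (p i) :=
    (((hasDerivAt_id _).sub_const _).const_mul _).const_add _
  rw [mul_one] at this
  exact this.congr_of_eventuallyEq (T.flow_near t i)

/-- A point moved by an integer under the time-one map is a zero. -/
theorem IsTimeFn.mem_range_iff {N : ℕ} {p : ℤ → ℝ} {lam : ℤ → ℝ} {c : ℤ → ℤ → ℝ} {δ : ℝ}
    {h : ℝ → ℝ} (T : IsTimeFn N p lam c δ h) {x : ℝ} :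
    x ∈ Set.range p ↔ ∃ n : ℤ, flowLift p h 1 x = x + n := by
  constructor
  · rintro ⟨i, rfl⟩; exact ⟨0, by simp [IsTimeFn.flow_marked]⟩
  · rintro ⟨n, hn⟩
    by_contra hx
    have := T.time_flow hx 1
    rw [hn, T.map_add_int] at this
    linarith

/-- A lift commuting up to an integer with the time-one map of a flow. -/
structure CommutesWithTimeOne (p : ℤ → ℝ) (h : ℝ → ℝ) (d : ℤ) (G : ℝ → ℝ) : Prop where
  isLift : IsCircleLift 1 d G
  commute : ∃ n : ℤ, ∀ x, G (flowLift p h 1 x) = flowLift p h 1 (G x) + n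

namespace CommutesWithTimeOne

variable {N : ℕ} {p : ℤ → ℝ} {lam : ℤ → ℝ} {c : ℤ → ℤ → ℝ} {δ : ℝ} {h : ℝ → ℝ} {d : ℤ} {G : ℝ → ℝ}

theorem map_mem (C : CommutesWithTimeOne p h d G) (T : IsTimeFn N p lam c δ h) (x : ℝ) :
    G x ∈ Set.range p ↔ x ∈ Set.range p := by
  obtain ⟨n, hn⟩ := C.commute
  constructor
  · rintro ⟨i, hi⟩
    refine T.mem_range_iff.2 ⟨d * n, C.isLift.injective ?_⟩
    rw [hn, ← hi, IsTimeFn.flow_marked, C.isLift.map_add_int, hi]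
    push_cast
    rw [← mul_assoc, C.isLift.sq, one_mul]
  · rintro ⟨i, rfl⟩
    have := hn (p i)
    rw [IsTimeFn.flow_marked] at this
    exact T.mem_range_iff.2 ⟨-n, by push_cast; linarith⟩

/-- A diffeomorphism commuting with the time-one map preserves the exponents. -/
theorem lam_eq (C : CommutesWithTimeOne p h d G) (T : IsTimeFn N p lam c δ h) {i j : ℤ}
    (hij : G (p i) = p j) : lam j = lam i := by
  obtain ⟨n, hn⟩ := C.commute
  have h1 : HasDerivAt (fun x => G (flowLift p h 1 x)) (deriv G (p i) * Real.exp (lam i * 1))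
      (p i) := by
    refine HasDerivAt.comp (p i) ?_ (T.hasDerivAt_flow_marked 1 i)
    rw [IsTimeFn.flow_marked]; exact C.isLift.hasDerivAt _
  have h2 : HasDerivAt (fun x => flowLift p h 1 (G x) + n)
      (Real.exp (lam j * 1) * deriv G (p i)) (p i) := by
    have h0 : HasDerivAt (flowLift p h 1) (Real.exp (lam j * 1)) (G (p i)) := by
      rw [hij]; exact T.hasDerivAt_flow_marked 1 j
    exact (h0.comp (p i) (C.isLift.hasDerivAt _)).add_const _
  rw [show (fun x => G (flowLift p h 1 x)) = fun x => flowLift p h 1 (G x) + n from funext hn] at h1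
  have h3 := h1.unique h2
  rw [mul_comm, mul_one, mul_one] at h3
  exact (Real.exp_injective (mul_right_cancel₀ (C.isLift.deriv_ne _) h3)).symm

/-- The limit at a zero of the change of time under `G`: the map is asymptotically linear there and
time is a logarithm. -/
theorem tendsto_time_sub (C : CommutesWithTimeOne p h d G) (T : IsTimeFn N p lam c δ h) {i j : ℤ}
    (hij : G (p i) = p j) {e : ℤ} (he : e = 1 ∨ e = -1) :
    Filter.Tendsto (fun u => h (G (p i + e * u)) - h (p i + e * u)) (𝓝[>] (0 : ℝ))
      (𝓝 (Real.log |deriv G (p i)| / lam i + c j (d * e) - c i e)) := by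
  have hδ := T.δ_pos
  have hd := C.isLift.sq
  have hes : (e : ℝ) * e = 1 := by rcases he with rfl | rfl <;> simp
  have hde : d * e = 1 ∨ d * e = -1 := by
    rcases he with rfl | rfl <;> rcases C.isLift.deg with h | h <;> simp [h]
  have habs : |deriv G (p i)| = d * deriv G (p i) := by
    have h1 := C.isLift.deriv_pos (p i)
    rcases C.isLift.deg with h | h <;> simp only [h] at h1 ⊢ <;> push_cast at h1 ⊢
    · rw [abs_of_pos (by linarith), one_mul]
    · rw [abs_of_neg (by linarith)]; ring
  set v : ℝ → ℝ := fun u => d * e * (G (p i + e * u) - p j) with hv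
  have hG : ∀ u, G (p i + e * u) = p j + (d * e : ℤ) * v u := fun u => by
    simp only [hv]; push_cast
    linear_combination (-(G (p i + e * u) - p j) * e * e) * hd - (G (p i + e * u) - p j) * hes
  have hvd : HasDerivAt v (d * deriv G (p i)) 0 := by
    have h1 : HasDerivAt (fun u : ℝ => p i + e * u) (e * 1) 0 :=
      ((hasDerivAt_id _).const_mul _).const_add _
    have h0 : HasDerivAt G (deriv G (p i)) (p i + e * 0) := by
      simpa using C.isLift.hasDerivAt (p i)
    have h2 : HasDerivAt (fun u : ℝ => G (p i + e * u)) (deriv G (p i) * (e * 1)) 0 :=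
      h0.comp (0 : ℝ) h1
    have h3 := (h2.sub_const (p j)).const_mul ((d : ℝ) * e)
    refine h3.congr_deriv ?_
    linear_combination ((d : ℝ) * deriv G (p i)) * hes
  have hv0 : v 0 = 0 := by simp [hv, hij]
  have hq : Filter.Tendsto (fun u => v u / u) (𝓝[>] (0 : ℝ)) (𝓝 |deriv G (p i)|) := by
    have := hvd.tendsto_slope_zero_right
    simp only [zero_add, hv0, sub_zero, smul_eq_mul] at this
    rw [habs]
    refine this.congr fun u => ?_
    rw [div_eq_inv_mul]
  have hpos : 0 < |deriv G (p i)| := abs_pos.2 (C.isLift.deriv_ne _)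
  have hvc : Filter.Tendsto v (𝓝[>] (0 : ℝ)) (𝓝 0) := by
    have := hvd.continuousAt.tendsto
    rw [hv0] at this
    exact this.mono_left nhdsWithin_le_nhds
  have hlog : Filter.Tendsto
      (fun u => Real.log (v u / u) / lam i + c j (d * e) - c i e) (𝓝[>] (0 : ℝ))
      (𝓝 (Real.log |deriv G (p i)| / lam i + c j (d * e) - c i e)) :=
    (((hq.log hpos.ne').div_const _).add_const _).sub_const _
  refine hlog.congr' ?_
  filter_upwards [hq.eventually (lt_mem_nhds hpos), hvc.eventually (gt_mem_nhds hδ),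
    Ioo_mem_nhdsGT hδ] with u h1 h2 h3
  have hvu : 0 < v u := by
    have := mul_pos h1 h3.1
    rwa [div_mul_cancel₀ _ h3.1.ne'] at this
  rw [hG, T.near j _ _ hde hvu h2, T.near i e u he h3.1 h3.2, C.lam_eq T hij,
    Real.log_div hvu.ne' h3.1.ne']
  ring

/-- The change of time under `G` is constant along flow lines, since it is periodic in time and has
a limit at the end of the flow line. -/
theorem time_sub_eq_of_tendsto (C : CommutesWithTimeOne p h d G) (T : IsTimeFn N p lam c δ h)
    {i : ℤ} {x : ℝ} (hx : x ∉ Set.range p) {e : ℤ} {l : ℝ}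
    (hl : Filter.Tendsto (fun u => h (G (p i + e * u)) - h (p i + e * u)) (𝓝[>] (0 : ℝ)) (𝓝 l))
    (hend : ∀ t, Real.exp (lam i * (h x + t - c i e)) < δ →
      flowLift p h t x = p i + e * Real.exp (lam i * (h x + t - c i e))) :
    h (G x) - h x = l := by
  obtain ⟨n, hn⟩ := C.commute
  have step : ∀ y ∉ Set.range p, h (G (flowLift p h 1 y)) - h (flowLift p h 1 y) =
      h (G y) - h y := fun y hy => by
    rw [hn, T.map_add_int, T.time_flow hy, T.time_flow ((C.map_mem T y).not.2 hy)]; ring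
  have stepn : ∀ (k : ℕ) (y : ℝ), y ∉ Set.range p →
      h (G (flowLift p h k y)) - h (flowLift p h k y) = h (G y) - h y := fun k y hy => by
    induction k with
    | zero => simp [T.flow_zero]
    | succ k ih =>
      rw [← ih, ← step _ (T.flow_notMem hy k), ← T.flow_add, add_comm (1 : ℝ)]; push_cast; rfl
  have stepn' : ∀ (k : ℕ) (y : ℝ), y ∉ Set.range p →
      h (G (flowLift p h (-k) y)) - h (flowLift p h (-k) y) = h (G y) - h y := fun k y hy => by
    have := stepn k _ (T.flow_notMem hy (-k))
    rw [← T.flow_add, add_neg_cancel, T.flow_zero] at this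
    exact this.symm
  have hlam := T.lam_ne i
  -- the direction of time in which the flow line tends to the zero `p i`
  obtain ⟨s, hs, hstep⟩ : ∃ s : ℝ, lam i * s < 0 ∧ ∀ k : ℕ,
      h (G (flowLift p h (s * k) x)) - h (flowLift p h (s * k) x) = h (G x) - h x := by
    rcases lt_or_gt_of_ne hlam with h0 | h0
    · exact ⟨1, by linarith, fun k => by rw [one_mul]; exact stepn k x hx⟩
    · exact ⟨-1, by linarith, fun k => by rw [neg_one_mul]; exact stepn' k x hx⟩
  have hexp : Filter.Tendsto (fun k : ℕ => Real.exp (lam i * (h x + s * k - c i e)))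
      Filter.atTop (𝓝 0) := by
    refine Real.tendsto_exp_atBot.comp ?_
    have : (fun k : ℕ => lam i * (h x + s * k - c i e)) =
        fun k : ℕ => lam i * (h x - c i e) + (lam i * s) * k := by ext k; ring
    rw [this]
    exact Filter.tendsto_atBot_add_const_left _ _
      (tendsto_natCast_atTop_atTop.const_mul_atTop_of_neg hs)
  have hexp' : Filter.Tendsto (fun k : ℕ => Real.exp (lam i * (h x + s * k - c i e)))
      Filter.atTop (𝓝[>] 0) :=
    tendsto_nhdsWithin_iff.2 ⟨hexp, Filter.Eventually.of_forall fun _ => Real.exp_pos _⟩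
  have h1 := hl.comp hexp'
  refine tendsto_nhds_unique (f := fun _ : ℕ => h (G x) - h x) tendsto_const_nhds (h1.congr' ?_)
  filter_upwards [hexp.eventually (gt_mem_nhds T.δ_pos)] with k hk
  rw [comp_apply, ← hend _ hk, hstep]

theorem time_sub_right (C : CommutesWithTimeOne p h d G) (T : IsTimeFn N p lam c δ h) {i j : ℤ}
    (hij : G (p i) = p j) {x : ℝ} (hx : x ∈ Set.Ioo (p i) (p (i + 1))) :
    h (G x) - h x = Real.log |deriv G (p i)| / lam i + c j d - c i 1 := by
  have hl := C.tendsto_time_sub T hij (Or.inl rfl)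
  rw [mul_one] at hl
  refine C.time_sub_eq_of_tendsto T (T.mark.notMem_range hx) hl fun t ht => ?_
  have := T.mem_right (i := i) (Real.exp_pos _) ht
  push_cast
  rw [one_mul]
  exact T.flow_eq hx this (T.exists_right _ _ ht)

theorem time_sub_left (C : CommutesWithTimeOne p h d G) (T : IsTimeFn N p lam c δ h) {i j : ℤ}
    (hij : G (p (i + 1)) = p j) {x : ℝ} (hx : x ∈ Set.Ioo (p i) (p (i + 1))) :
    h (G x) - h x =
      Real.log |deriv G (p (i + 1))| / lam (i + 1) + c j (-d) - c (i + 1) (-1) := by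
  have hl := C.tendsto_time_sub T hij (Or.inr rfl)
  rw [mul_neg_one] at hl
  refine C.time_sub_eq_of_tendsto T (T.mark.notMem_range hx) hl fun t ht => ?_
  have := T.mem_left (i := i) (Real.exp_pos _) ht
  push_cast
  rw [neg_one_mul, ← sub_eq_add_neg]
  exact T.flow_eq hx this (T.exists_left _ _ ht)

theorem nonempty_interval (T : IsTimeFn N p lam c δ h) (i : ℤ) :
    ∃ x, x ∈ Set.Ioo (p i) (p (i + 1)) :=
  Set.nonempty_Ioo.2 (T.mark.strictMono (by omega))

/-- An orientation-preserving diffeomorphism commuting with the time-one map and fixing a zero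
belongs to the flow. -/
theorem exists_eq_flow (C : CommutesWithTimeOne p h 1 G) (T : IsTimeFn N p lam c δ h)
    (h0 : G (p 0) = p 0) : ∃ t, ∀ x, G x = flowLift p h t x := by
  obtain ⟨m, hm⟩ := T.mark.exists_shift C.isLift (C.map_mem T)
  have hm0 : m = 0 := by
    have := hm 0
    rw [h0] at this
    have := T.mark.strictMono.injective this
    omega
  have hfix : ∀ i, G (p i) = p i := fun i => by rw [hm, hm0]; congr 1; ring
  set τ : ℤ → ℝ := fun i => Real.log |deriv G (p i)| / lam i with hτ
  have hr : ∀ i, ∀ x ∈ Set.Ioo (p i) (p (i + 1)), h (G x) - h x = τ i := fun i x hx => by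
    rw [C.time_sub_right T (hfix i) hx]; simp [hτ]
  have hstep : ∀ i, τ (i + 1) = τ i := fun i => by
    obtain ⟨x, hx⟩ := CommutesWithTimeOne.nonempty_interval T i
    rw [← hr i x hx, C.time_sub_left T (hfix (i + 1)) hx]; simp [hτ]
  have hconst : ∀ i, τ i = τ 0 := fun i => by
    induction i using Int.induction_on with
    | zero => rfl
    | succ i ih => rw [hstep, ih]
    | pred i ih => rw [← ih, ← hstep, sub_add_cancel]
  refine ⟨τ 0, fun x => ?_⟩
  by_cases hx : x ∈ Set.range p
  · obtain ⟨i, rfl⟩ := hx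
    rw [hfix, IsTimeFn.flow_marked]
  · obtain ⟨i, hi⟩ := T.mark.exists_mem_Ioo hx
    have h1 := C.isLift.strictMono hi.1
    have h2 := C.isLift.strictMono hi.2
    rw [hfix] at h1 h2
    rw [T.flow_eq hi ⟨h1, h2⟩ (t := τ 0)]
    rw [← hconst i, ← hr i x hi]; ring

end CommutesWithTimeOne

/-- Reflecting the indices does not change the sum over a period of a periodic sequence. -/
theorem sum_range_reflect_of_periodic {N : ℕ} (hN : 0 < N) {a : ℤ → ℝ}
    (ha : ∀ i, a (i + N) = a i) (m : ℤ) :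
    ∑ i ∈ Finset.range N, a (m - i) = ∑ i ∈ Finset.range N, a i := by
  have : NeZero N := ⟨hN.ne'⟩
  have hper : Periodic a (N : ℤ) := ha
  have hcast : ∀ i : ℤ, a i = a ((i : ZMod N).val : ℤ) := fun i => by
    rw [ZMod.val_intCast]
    have h1 := hper.sub_int_mul_eq (i / N) (x := i)
    have h2 : i - (i / (N : ℤ) : ℤ) * N = i % N := by
      have := Int.emod_add_mul_ediv i N; linarith
    rw [← h1, Int.cast_id, h2]
  have hsum : ∀ b : ZMod N → ℝ, ∑ i ∈ Finset.range N, b (i : ZMod N) = ∑ z, b z := fun b => by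
    refine Finset.sum_bij' (fun i _ => (i : ZMod N)) (fun z _ => z.val) (by simp)
      (fun z _ => by simpa using ZMod.val_lt z) (fun i hi => ?_) (by simp) (by simp)
    rw [ZMod.val_natCast, Nat.mod_eq_of_lt (Finset.mem_range.1 hi)]
  let b : ZMod N → ℝ := fun z => a (z.val : ℤ)
  calc ∑ i ∈ Finset.range N, a (m - i)
      = ∑ i ∈ Finset.range N, b ((m : ZMod N) - (i : ZMod N)) := by
        refine Finset.sum_congr rfl fun i _ => ?_
        rw [hcast]; simp [b]
    _ = ∑ z : ZMod N, b ((m : ZMod N) - z) := hsum fun z => b ((m : ZMod N) - z)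
    _ = ∑ z : ZMod N, b z := Equiv.sum_comp (Equiv.subLeft (m : ZMod N)) b
    _ = ∑ i ∈ Finset.range N, b (i : ZMod N) := (hsum b).symm
    _ = _ := by
        refine Finset.sum_congr rfl fun i _ => ?_
        simp only [b]
        rw [hcast i]; simp

namespace IsTimeFn

variable {N : ℕ} {p : ℤ → ℝ} {lam : ℤ → ℝ} {c : ℤ → ℤ → ℝ} {δ : ℝ} {h : ℝ → ℝ}

theorem const_add (T : IsTimeFn N p lam c δ h) {e : ℤ} (he : e = 1 ∨ e = -1) (i : ℤ) :
    c (i + N) e = c i e := by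
  have hδ := T.δ_pos
  have h1 := T.near (i + N) e (δ / 2) he (by linarith) (by linarith)
  have h2 := T.near i e (δ / 2) he (by linarith) (by linarith)
  rw [T.mark.map_add, T.lam_add, add_right_comm, T.map_add_one, h2] at h1
  linarith

end IsTimeFn

/-- If an orientation-reversing diffeomorphism commutes with the time-one map, then the total jump
of the time function vanishes. -/
theorem CommutesWithTimeOne.sum_jump_eq_zero {N : ℕ} {p : ℤ → ℝ} {lam : ℤ → ℝ} {c : ℤ → ℤ → ℝ}
    {δ : ℝ} {h G : ℝ → ℝ} (C : CommutesWithTimeOne p h (-1) G) (T : IsTimeFn N p lam c δ h) :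
    ∑ i ∈ Finset.range N, (c i 1 - c i (-1)) = 0 := by
  obtain ⟨m, hm⟩ := T.mark.exists_shift C.isLift (C.map_mem T)
  set τ : ℤ → ℝ := fun i => Real.log |deriv G (p i)| / lam i with hτ
  have hstep : ∀ i, τ i + c (m - i) (-1) - c i 1 =
      τ (i + 1) + c (m - (i + 1)) 1 - c (i + 1) (-1) := fun i => by
    obtain ⟨x, hx⟩ := CommutesWithTimeOne.nonempty_interval T i
    have h1 := C.time_sub_right T (hm i) hx
    have h2 := C.time_sub_left T (hm (i + 1)) hx
    rw [h1, neg_one_mul, neg_neg, neg_one_mul, ← sub_eq_add_neg, ← sub_eq_add_neg] at h2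
    exact h2
  have hτN : ∀ i, τ (i + N) = τ i := fun i => by
    simp only [hτ, T.mark.map_add, T.lam_add, C.isLift.deriv_add_one]
  have hsum := Finset.sum_congr rfl fun (i : ℕ) (_ : i ∈ Finset.range N) => hstep i
  have shift : ∀ a : ℤ → ℝ, (∀ i, a (i + N) = a i) →
      ∑ i ∈ Finset.range N, a ((i : ℤ) + 1) = ∑ i ∈ Finset.range N, a i := fun a ha => by
    have h1 := Finset.sum_range_succ' (fun i : ℕ => a i) N
    have h2 := Finset.sum_range_succ (fun i : ℕ => a i) N
    have h3 := ha 0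
    rw [zero_add] at h3
    push_cast at h1 h2
    rw [h2, h3] at h1
    linarith
  have k1 := shift τ hτN
  have k2 := shift (fun i => c (m - i) 1) fun i => by
    have := T.const_add (Or.inl rfl) (m - (i + N))
    rw [← this]; congr 1; ring
  have k3 := shift (fun i => c i (-1)) (T.const_add (Or.inr rfl))
  have k4 := sum_range_reflect_of_periodic T.mark.pos (a := fun i => c i 1)
    (T.const_add (Or.inl rfl)) m
  have k5 := sum_range_reflect_of_periodic T.mark.pos (a := fun i => c i (-1))
    (T.const_add (Or.inr rfl)) m
  simp only [Finset.sum_add_distrib, Finset.sum_sub_distrib] at hsum ⊢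
  linarith

namespace IsModel

variable {d : ℤ} {F : ℝ → ℝ} {q : ℕ} {M : ℤ} {N : ℕ} {p : ℤ → ℝ} {lam : ℤ → ℝ} {c : ℤ → ℤ → ℝ}
  {δ : ℝ} {h : ℝ → ℝ} {f g : circleDiff 1} {Φ : ℝ → circleDiff 1}

theorem pow_eq (m : IsModel d F q M N p lam c δ h) (hf : IsLiftOf f d F)
    (hΦ : ∀ t, IsLiftOf (Φ t) 1 (flowLift p h t)) : f ^ q = Φ 1 :=
  circleDiff_ext fun x => by
    rw [(hf.pow q).map_coe, (hΦ 1).map_coe, m.iterate_eq_flow]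
    exact circle_coe_eq_iff.2 ⟨M, rfl⟩

theorem commute (m : IsModel d F q M N p lam c δ h) (hf : IsLiftOf f d F)
    (hΦ : ∀ t, IsLiftOf (Φ t) 1 (flowLift p h t)) (t : ℝ) : Commute f (Φ t) :=
  circleDiff_ext fun x => by
    rw [(hf.mul (hΦ t)).map_coe, ((hΦ t).mul hf).map_coe, comp_apply, comp_apply, m.map_flow]

theorem flow_mul (m : IsModel d F q M N p lam c δ h)
    (hΦ : ∀ t, IsLiftOf (Φ t) 1 (flowLift p h t)) (s t : ℝ) : Φ (s + t) = Φ s * Φ t :=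
  circleDiff_ext fun x => by
    rw [(hΦ _).map_coe, ((hΦ s).mul (hΦ t)).map_coe, comp_apply, m.time.flow_add]

theorem flow_zero (m : IsModel d F q M N p lam c δ h)
    (hΦ : ∀ t, IsLiftOf (Φ t) 1 (flowLift p h t)) : Φ 0 = 1 :=
  circleDiff_ext fun x => by
    rw [(hΦ _).map_coe, m.time.flow_zero]; rfl

theorem commutesWithTimeOne (m : IsModel d F q M N p lam c δ h) (hf : IsLiftOf f d F)
    (hΦ : ∀ t, IsLiftOf (Φ t) 1 (flowLift p h t)) {e : ℤ} {G : ℝ → ℝ} (hg : IsLiftOf g e G)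
    (hfg : Commute f g) : CommutesWithTimeOne p h e G := by
  have h1 : Φ 1 * g = g * Φ 1 := by rw [← m.pow_eq hf hΦ]; exact (hfg.pow_left q).eq
  obtain ⟨n, hn⟩ := (h1 ▸ hg.mul (hΦ 1) : IsLiftOf (Φ 1 * g) _ _).exists_int ((hΦ 1).mul hg)
  exact ⟨hg.isLift, n, hn⟩

/-- An element of the centralizer fixing the base point and the orientation is a flow map. -/
theorem exists_eq_flow_of_fix (m : IsModel d F q M N p lam c δ h) (hf : IsLiftOf f d F)
    (hΦ : ∀ t, IsLiftOf (Φ t) 1 (flowLift p h t)) {G : ℝ → ℝ} (hg : IsLiftOf g 1 G)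
    (hfg : Commute f g) {n : ℤ} (hG : G (p 0) = p 0 + n) : ∃ t, g = Φ t := by
  have hg' := hg.add_int (-n)
  obtain ⟨t, ht⟩ := (m.commutesWithTimeOne hf hΦ hg' hfg).exists_eq_flow m.time
    (by rw [hG]; push_cast; ring)
  exact ⟨t, circleDiff_ext fun x => by rw [hg'.map_coe, ht, (hΦ t).map_coe]⟩

/-- The centralizer is generated by `f` and the flow. -/
theorem exists_eq_pow_mul (m : IsModel d F q M N p lam c δ h) (hf : IsLiftOf f d F)
    (hΦ : ∀ t, IsLiftOf (Φ t) 1 (flowLift p h t)) (hfg : Commute f g) :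
    ∃ (j : ℕ) (t : ℝ), g = f ^ j * Φ t := by
  obtain ⟨e, G, hg⟩ := exists_isLiftOf g
  have C := m.commutesWithTimeOne hf hΦ hg hfg
  obtain ⟨i, hi⟩ := (C.map_mem m.time (p 0)).2 ⟨0, rfl⟩
  obtain ⟨j, n, hj⟩ := m.base i (C.lam_eq m.time hi.symm)
  -- up to a power of `f`, the base point is fixed
  obtain ⟨H, hH, hl, -⟩ := (hf.pow j).inv
  set g' := (f ^ j)⁻¹ * g with hg'
  have hL := hH.mul hg
  rw [← hg'] at hL
  have hfg' : Commute f g' := ((Commute.refl f).pow_right j).inv_right.mul_right hfg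
  obtain ⟨n', hn'⟩ : ∃ n' : ℤ, (H ∘ G) (p 0) = p 0 + n' := by
    refine ⟨d ^ j * (-n), ?_⟩
    have h1 : G (p 0) = F^[j] (p 0) + (-n : ℤ) := by rw [hj, hi]; push_cast; ring
    rw [comp_apply, h1, hH.isLift.map_add_int, hl]; push_cast; ring
  suffices h1 : ∃ (k : ℕ) (t : ℝ), g' = f ^ k * Φ t by
    obtain ⟨k, t, hk⟩ := h1
    exact ⟨j + k, t, by rw [pow_add, mul_assoc, ← hk, hg', mul_inv_cancel_left]⟩
  rcases hL.isLift.deg with hdeg | hdeg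
  · rw [hdeg] at hL
    obtain ⟨t, ht⟩ := m.exists_eq_flow_of_fix hf hΦ hL hfg' hn'
    exact ⟨0, t, by rw [pow_zero, one_mul, ht]⟩
  · rw [hdeg] at hL
    rcases m.isLift.deg with rfl | rfl
    · exact absurd ((m.commutesWithTimeOne hf hΦ hL hfg').sum_jump_eq_zero m.time)
        (m.preserving rfl).2
    · obtain ⟨-, n₀, hn₀⟩ := m.reversing rfl
      obtain ⟨K, hK, hKl, -⟩ := hf.inv
      have hL2 := hK.mul hL
      norm_num at hL2
      have hfg2 : Commute f (f⁻¹ * g') := (Commute.refl f).inv_right.mul_right hfg'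
      obtain ⟨t, ht⟩ := m.exists_eq_flow_of_fix hf hΦ (n := -(n' - n₀)) hL2 hfg2 (by
        have h1 : p 0 + (n' : ℝ) = F (p 0) + (n' - n₀ : ℤ) := by rw [hn₀]; push_cast; ring
        rw [comp_apply, hn', h1, hK.isLift.map_add_int, hKl]; push_cast; ring)
      exact ⟨1, t, by rw [pow_one, ← ht, mul_inv_cancel_left]⟩

/-- A power of `f` belongs to the flow only if the exponent is a multiple of `q`. -/
theorem dvd_of_pow_eq (m : IsModel d F q M N p lam c δ h) (hf : IsLiftOf f d F)
    (hΦ : ∀ t, IsLiftOf (Φ t) 1 (flowLift p h t)) {j : ℕ} {t : ℝ} (hj : f ^ j = Φ t) : q ∣ j := by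
  have h1 := hf.pow j
  rw [hj] at h1
  rcases m.isLift.deg with rfl | rfl
  · obtain ⟨n, hn⟩ := h1.exists_int (hΦ t)
    refine (m.preserving rfl).1 j n ?_
    rw [hn, IsTimeFn.flow_marked]
  · have h2 := h1.deg_unique (hΦ t)
    rw [(m.reversing rfl).1]
    exact ((neg_one_pow_eq_one_iff_even (by norm_num)).1 h2).two_dvd

theorem eq_zero_of_flow_eq_one (m : IsModel d F q M N p lam c δ h)
    (hΦ : ∀ t, IsLiftOf (Φ t) 1 (flowLift p h t)) {t : ℝ} (ht : Φ t = 1) : t = 0 := by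
  obtain ⟨x, hx⟩ := CommutesWithTimeOne.nonempty_interval m.time 0
  have hn := m.time.mark.notMem_range hx
  have h1 := (hΦ t).map_coe x
  rw [ht] at h1
  obtain ⟨n, hn'⟩ := circle_coe_eq_iff.1 (show (x : UnitAddCircle) = _ from h1)
  have h2 := m.time.time_flow hn t
  have h3 := m.time.map_add_int (flowLift p h t x) n
  rw [← hn', h2] at h3
  linarith

/-- The centralizer of `f` is the product of the flow and of the cyclic group of order `q`
generated by `f ∘ Φ (-1 / q)`. -/
theorem exists_centralizer_equiv (m : IsModel d F q M N p lam c δ h) (hf : IsLiftOf f d F)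
    (hΦ : ∀ t, IsLiftOf (Φ t) 1 (flowLift p h t)) :
    ∃ e : Multiplicative (ℝ × ZMod q) ≃* Subgroup.centralizer ({f} : Set (circleDiff 1)),
      ∀ t, (e (Multiplicative.ofAdd (t, 0))).1 = Φ t := by
  have hq : (q : ℝ) ≠ 0 := by exact_mod_cast m.q_pos.ne'
  have hcom := m.commute hf hΦ
  have hpow : ∀ (t : ℝ) (n : ℕ), Φ t ^ n = Φ (n * t) := fun t n => by
    induction n with
    | zero => simp [m.flow_zero hΦ]
    | succ n ih => rw [pow_succ, ih, ← m.flow_mul hΦ]; push_cast; congr 1; ring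
  set η : circleDiff 1 := f * Φ (-1 / q) with hη
  have hηpow : ∀ n : ℕ, η ^ n = f ^ n * Φ (n * (-1 / q)) := fun n => by
    rw [hη, (hcom _).mul_pow, hpow]
  have hηq : η ^ q = 1 := by
    rw [hηpow, m.pow_eq hf hΦ, ← m.flow_mul hΦ]
    rw [show (1 : ℝ) + q * (-1 / q) = 0 by field_simp; ring, m.flow_zero hΦ]
  have hΦΦ : ∀ s t, Commute (Φ s) (Φ t) := fun s t => by
    change Φ s * Φ t = Φ t * Φ s
    rw [← m.flow_mul hΦ, ← m.flow_mul hΦ, add_comm]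
  have hηf : Commute f η := (Commute.refl f).mul_right (hcom _)
  have hηΦ : ∀ t, Commute η (Φ t) := fun t => (hcom t).mul_left (hΦΦ _ _)
  obtain ⟨κ, hκ⟩ : ∃ κ : ZMod q →+ Additive (circleDiff 1), ∀ n : ℕ, (κ n).toMul = η ^ n := by
    let z : { z : ℤ →+ Additive (circleDiff 1) // z q = 0 } :=
      ⟨zmultiplesHom _ (Additive.ofMul η), by
        simp only [zmultiplesHom_apply, natCast_zsmul, ← ofMul_pow, hηq, ofMul_one]⟩
    refine ⟨ZMod.lift q z, fun n => ?_⟩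
    have := ZMod.lift_coe q z n
    rw [Int.cast_natCast] at this
    rw [this]
    simp only [z, zmultiplesHom_apply, natCast_zsmul, ← ofMul_pow, toMul_ofMul]
  have : NeZero q := ⟨m.q_pos.ne'⟩
  have hκ' : ∀ b : ZMod q, ∃ n : ℕ, b = n ∧ (κ b).toMul = η ^ n := fun b =>
    ⟨b.val, (ZMod.natCast_zmod_val b).symm, by rw [← hκ, ZMod.natCast_zmod_val]⟩
  let φ : Multiplicative (ℝ × ZMod q) →* Subgroup.centralizer ({f} : Set (circleDiff 1)) :=
    MonoidHom.mk' (fun x => ⟨Φ x.toAdd.1 * (κ x.toAdd.2).toMul, by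
      obtain ⟨n, -, hn⟩ := hκ' x.toAdd.2
      rw [hn, Subgroup.mem_centralizer_singleton_iff]
      exact ((hcom _).mul_right (hηf.pow_right n)).symm.eq⟩) (fun x y => by
      obtain ⟨n, -, hn⟩ := hκ' x.toAdd.2
      obtain ⟨k, -, hk⟩ := hκ' y.toAdd.2
      ext1
      simp only [toAdd_mul, Prod.fst_add, Prod.snd_add, map_add, toMul_add, hn, hk,
        m.flow_mul hΦ, Subgroup.coe_mul]
      have := (((hηΦ y.toAdd.1).pow_left n)).eq
      calc _ = Φ x.toAdd.1 * (Φ y.toAdd.1 * η ^ n) * η ^ k := by simp only [mul_assoc]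
        _ = _ := by rw [← this]; simp only [mul_assoc])
  have hφ : ∀ (t : ℝ) (n : ℕ), (φ (Multiplicative.ofAdd (t, (n : ZMod q)))).1 = Φ t * η ^ n :=
    fun t n => by rw [← hκ]; rfl
  have hinj : Injective φ := by
    rw [injective_iff_map_eq_one]
    intro x hx
    obtain ⟨n, hn, -⟩ := hκ' x.toAdd.2
    have hx' : x = Multiplicative.ofAdd (x.toAdd.1, (n : ZMod q)) := by rw [← hn]; rfl
    have h1 := hφ x.toAdd.1 n
    rw [← hx', hx, hηpow, ← mul_assoc, ← ((hcom _).pow_left n).eq, mul_assoc,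
      ← m.flow_mul hΦ] at h1
    have h2 : f ^ n = Φ (-(x.toAdd.1 + n * (-1 / q))) := by
      rw [eq_comm, ← mul_one (Φ _), ← Subgroup.coe_one, h1, (((hcom _).pow_left n)).eq,
        ← mul_assoc, ← m.flow_mul hΦ, neg_add_cancel, m.flow_zero hΦ, one_mul]
    have hdvd := m.dvd_of_pow_eq hf hΦ h2
    have hn0 : x.toAdd.2 = 0 := by rw [hn]; exact (ZMod.natCast_eq_zero_iff _ _).2 hdvd
    have h3 := hφ x.toAdd.1 0
    rw [Nat.cast_zero, ← hn0, pow_zero, mul_one] at h3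
    have h4 : Φ x.toAdd.1 = 1 := by
      rw [← h3]; exact congrArg Subtype.val hx
    have h5 := m.eq_zero_of_flow_eq_one hΦ h4
    exact Multiplicative.toAdd.injective (Prod.ext h5 hn0)
  have hsurj : Surjective φ := by
    rintro ⟨g, hg⟩
    rw [Subgroup.mem_centralizer_singleton_iff] at hg
    obtain ⟨j, t, rfl⟩ := m.exists_eq_pow_mul hf hΦ (g := g) hg.symm
    refine ⟨Multiplicative.ofAdd (j / q + t, (j : ZMod q)), Subtype.ext ?_⟩
    rw [hφ, hηpow, ← mul_assoc, ← ((hcom _).pow_left j).eq, mul_assoc, ← m.flow_mul hΦ]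
    congr 2; ring
  exact ⟨MulEquiv.ofBijective φ ⟨hinj, hsurj⟩, fun t => by
    have := hφ t 0
    rw [Nat.cast_zero, pow_zero, mul_one] at this
    exact this⟩

/-! ### Summary of the properties of a model -/

theorem minimalPeriod_eq (m : IsModel 1 F q M N p lam c δ h) (hf : IsLiftOf f 1 F)
    {x : UnitAddCircle} (hx : x ∈ periodicPts f.1) : minimalPeriod f.1 x = q := by
  rw [m.periodicPts_eq hf] at hx
  obtain ⟨i, rfl⟩ := hx
  refine Nat.dvd_antisymm (IsPeriodicPt.minimalPeriod_dvd ?_) ?_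
  · change f.1^[q] (p i : UnitAddCircle) = p i
    rw [hf.iterate_coe, m.iterate_map]
    exact circle_coe_eq_iff.2 ⟨M, rfl⟩
  · set r := minimalPeriod f.1 (p i : UnitAddCircle)
    have hr : f.1^[r] (p i : UnitAddCircle) = p i := isPeriodicPt_minimalPeriod _ _
    rw [hf.iterate_coe] at hr
    obtain ⟨n, hn⟩ := circle_coe_eq_iff.1 hr
    -- an iterate shifts all the indices by the same amount
    have L := m.isLift.iterate le_rfl r
    obtain ⟨s, hs⟩ := m.time.mark.exists_shift L (m.iterate_mem r)
    simp only [one_pow, one_mul] at hs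
    rw [hs, ← m.time.mark.map_add_mul] at hn
    have hsN := m.time.mark.strictMono.injective hn
    refine (m.preserving rfl).1 r n ?_
    rw [hs, ← m.time.mark.map_add_mul]
    congr 1; omega

theorem orientationReversing_iff (hf : IsLiftOf f d F) : OrientationReversing f.1 ↔ d = -1 := by
  have key : ∀ x : ℝ, circleDeriv f.1 (x : UnitAddCircle) = deriv F x :=
    circleDeriv_coe hf.isLift.continuous hf.map_coe
  constructor
  · intro h
    have h1 := h (0 : ℝ)
    rw [key] at h1
    have h2 := hf.isLift.deriv_pos 0
    rcases hf.isLift.deg with rfl | rfl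
    · push_cast at h2; linarith
    · rfl
  · rintro rfl z
    induction z using QuotientAddGroup.induction_on with
    | H x =>
      have h2 := hf.isLift.deriv_pos x
      push_cast at h2
      have := key x
      rw [show circleDeriv f.1 (QuotientAddGroup.mk x) = deriv F x from this]
      linarith

/-- The vector field on the circle with time function `h`. -/
theorem exists_field (m : IsModel d F q M N p lam c δ h)
    (hΦ : ∀ t, IsLiftOf (Φ t) 1 (flowLift p h t)) :
    ∃ X : UnitAddCircle → ℝ, IsMorseSmaleField X ∧ IsFlowOf X fun t => (Φ t).1 := by
  have T := m.time
  have hper : Periodic (fieldLift p h) (1 : ℝ) := T.field_add_one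
  have hflow : IsFlowOf hper.lift fun t => (Φ t).1 := fun z => by
    induction z using QuotientAddGroup.induction_on with
    | H x =>
      refine ⟨?_, fun t => flowLift p h t x, T.hasDerivAt_flow x, fun t => (hΦ t).map_coe x⟩
      beta_reduce
      rw [m.flow_zero hΦ]; rfl
  have hsub : flowNonwanderingSet (fun t => (Φ t).1) ⊆ Set.range fun i => (p i : UnitAddCircle) := by
    intro z hz
    by_contra hn
    obtain ⟨U, hU, hw⟩ := T.exists_wandering_nhds hn one_pos
    obtain ⟨t, ht, hne⟩ := hz U hU 1
    refine hw _ t ht (fun x hx => ?_) hne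
    beta_reduce
    rw [(hΦ t).map_coe, T.periodic.lift_coe, T.time_flow hx]
  refine ⟨hper.lift, ⟨T.field_contDiff, _, hflow, T.finite_coe.subset hsub, fun z hz => ?_⟩, hflow⟩
  obtain ⟨i, rfl⟩ := hsub hz
  refine ⟨?_, ?_⟩
  · exact if_pos ⟨i, rfl⟩
  · have h1 : (fun t : ℝ => hper.lift ((p i : UnitAddCircle) + (t : UnitAddCircle))) =
        fun t => fieldLift p h (p i + t) := rfl
    rw [h1, deriv_comp_const_add, add_zero, Filter.EventuallyEq.deriv_eq (T.field_near i)]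
    have : HasDerivAt (fun x => lam i * (x - p i)) (lam i * 1) (p i) :=
      ((hasDerivAt_id _).sub_const _).const_mul _
    rw [this.deriv, mul_one]
    exact T.lam_ne i

theorem main (m : IsModel d F q M N p lam c δ h) (hf : IsLiftOf f d F) :
    IsMorseSmaleDiffeo f ∧
      (periodicPts f.1).Nonempty ∧
      ∃ q : ℕ,
        (OrientationReversing f.1 → q = 2) ∧
        (¬ OrientationReversing f.1 → ∀ x ∈ periodicPts f.1, minimalPeriod f.1 x = q) ∧
        ∃ (X : UnitAddCircle → ℝ) (Φ : ℝ → UnitAddCircle → UnitAddCircle),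
          IsMorseSmaleField X ∧ IsFlowOf X Φ ∧
          (∀ t x, f.1 (Φ t x) = Φ t (f.1 x)) ∧
          (∀ x, (f ^ q).1 x = Φ 1 x) ∧
          ∃ e : Multiplicative (ℝ × ZMod q) ≃* Subgroup.centralizer ({f} : Set (circleDiff 1)),
            ∀ t x, (e (Multiplicative.ofAdd (t, 0))).1.1 x = Φ t x := by
  have hex : ∀ t, ∃ φ : circleDiff 1, IsLiftOf φ 1 (flowLift p h t) := fun t => by
    obtain ⟨φ, hφ⟩ := (m.time.flow_isCircleLift t).exists_diff
    exact ⟨φ, m.time.flow_isCircleLift t, hφ⟩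
  choose Φ hΦ using hex
  obtain ⟨X, hX, hXΦ⟩ := m.exists_field hΦ
  obtain ⟨e, he⟩ := m.exists_centralizer_equiv hf hΦ
  refine ⟨m.isMorseSmale hf, ?_, q, fun h => ?_, fun h x hx => ?_, X, fun t => (Φ t).1, hX, hXΦ,
    fun t x => ?_, fun x => ?_, e, fun t x => ?_⟩
  · rw [m.periodicPts_eq hf]; exact ⟨_, 0, rfl⟩
  · exact (m.reversing ((orientationReversing_iff hf).1 h)).1
  · rcases m.isLift.deg with rfl | rfl
    · exact m.minimalPeriod_eq hf hx
    · exact absurd ((orientationReversing_iff hf).2 rfl) h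
  · exact congrArg (fun φ : circleDiff 1 => φ.1 x) (m.commute hf hΦ t).eq
  · rw [m.pow_eq hf hΦ]
  · rw [he]

end IsModel

/-! ### Smoothing -/

open MeasureTheory in
/-- A continuous `1`-periodic function is a uniform limit of smooth `1`-periodic functions. -/
theorem exists_smooth_periodic_close {φ : ℝ → ℝ} (hc : Continuous φ)
    (hp : ∀ x, φ (x + 1) = φ x) {ε : ℝ} (hε : 0 < ε) :
    ∃ w : ℝ → ℝ, ContDiff ℝ ∞ w ∧ (∀ x, w (x + 1) = w x) ∧ ∀ x, |w x - φ x| ≤ ε := by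
  obtain ⟨δ, hδ, hu⟩ := uniformContinuous_of_periodic hc hp hε
  let b : ContDiffBump (0 : ℝ) := ⟨δ / 3, δ / 2, by positivity, by linarith⟩
  refine ⟨convolution (b.normed volume) φ (ContinuousLinearMap.lsmul ℝ ℝ) volume, ?_, fun x => ?_,
    fun x => ?_⟩
  · exact b.hasCompactSupport_normed.contDiff_convolution_left _ b.contDiff_normed
      hc.locallyIntegrable
  · simp only [convolution_def]
    congr 1; ext t
    rw [show x + 1 - t = x - t + 1 by ring, hp]
  · have := b.dist_normed_convolution_le (μ := volume) (g := φ) (x₀ := x) (ε := ε)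
      hc.aestronglyMeasurable fun y hy => by
        rw [Metric.mem_ball, Real.dist_eq] at hy
        rw [Real.dist_eq]
        exact (hu y x (hy.trans (show δ / 2 < δ by linarith))).le
    rwa [Real.dist_eq] at this

namespace IsCircleLift

variable {d : ℤ} {F G : ℝ → ℝ}

theorem fract_reduce {E : ℝ → ℝ} (hE : ∀ x, E (x + 1) = E x) (x : ℝ) : E x = E (Int.fract x) := by
  have hper : Periodic E 1 := hE
  have := hper.sub_int_mul_eq ⌊x⌋ (x := x)
  rw [mul_one] at this
  exact this.symm

/-- Smooth diffeomorphisms are dense in the `C¹` topology. -/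
theorem exists_smooth_close (L : IsCircleLift 1 d F) {ε : ℝ} (hε : 0 < ε) :
    ∃ G, IsCircleLift ∞ d G ∧ C1Close ε F G := by
  obtain ⟨ε₀, hε₀, hopen⟩ := L.of_close
  set ε₁ := min ε ε₀ / 3 with hε₁
  have hε₁0 : 0 < ε₁ := by positivity
  obtain ⟨w, hw, hw1, hwF⟩ := exists_smooth_periodic_close L.continuous_deriv L.deriv_add_one hε₁0
  have hwc : Continuous w := hw.continuous
  have hint : ∀ a b, IntervalIntegrable w MeasureTheory.volume a b := fun a b =>
    hwc.intervalIntegrable a b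
  -- `w` is corrected by a constant, so that its primitive has degree `d`
  set k : ℝ := d - ∫ t in (0 : ℝ)..1, w t with hk
  have hprim : ∀ x, HasDerivAt (fun x => F 0 + ∫ t in (0 : ℝ)..x, w t) (w x) x := fun x =>
    (hwc.integral_hasStrictDerivAt 0 x).hasDerivAt.const_add _
  have hkε : |k| ≤ ε₁ := by
    have h1 : F 1 - F 0 = ∫ t in (0 : ℝ)..1, deriv F t := by
      rw [intervalIntegral.integral_deriv_eq_sub (fun x _ => L.differentiable x)
        (L.continuous_deriv.intervalIntegrable _ _)]
    have h2 := L.map_add_one 0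
    rw [zero_add] at h2
    have h3 : k = ∫ t in (0 : ℝ)..1, (deriv F t - w t) := by
      rw [intervalIntegral.integral_sub (L.continuous_deriv.intervalIntegrable _ _) (hint _ _), ← h1,
        h2, hk]
      ring
    rw [h3]
    have := intervalIntegral.norm_integral_le_of_norm_le_const (a := (0 : ℝ)) (b := 1) (C := ε₁)
      (f := fun t => deriv F t - w t) fun x _ => by
        rw [Real.norm_eq_abs, abs_sub_comm]; exact hwF x
    simpa using this
  set G : ℝ → ℝ := fun x => F 0 + (∫ t in (0 : ℝ)..x, w t) + k * x with hG
  have hGd : ∀ x, HasDerivAt G (w x + k) x := fun x => by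
    have := (hprim x).add ((hasDerivAt_id x).const_mul k)
    rw [mul_one] at this
    exact this
  have hGderiv : deriv G = fun x => w x + k := funext fun x => (hGd x).deriv
  have hGs : ContDiff ℝ ∞ G := by
    rw [contDiff_infty_iff_deriv, hGderiv]
    exact ⟨fun x => (hGd x).differentiableAt, hw.add contDiff_const⟩
  have hG1 : ∀ x, G (x + 1) = G x + d := fun x => by
    have hper : Periodic w 1 := hw1
    have h1 := hper.intervalIntegral_add_eq x 0
    rw [zero_add] at h1
    have h2 := intervalIntegral.integral_add_adjacent_intervals (hint 0 x) (hint x (x + 1))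
    simp only [hG]
    rw [← h2, h1, hk]; ring
  have hder : ∀ x, |deriv F x - deriv G x| ≤ 2 * ε₁ := fun x => by
    rw [hGderiv]
    have h1 := abs_le.1 (hwF x)
    have h2 := abs_le.1 hkε
    simp only
    rw [abs_le]; constructor <;> linarith [h1.1, h1.2, h2.1, h2.2]
  have hclose : C1Close (min ε ε₀) F G := fun x => by
    have h3 : 3 * ε₁ = min ε ε₀ := by rw [hε₁]; ring
    refine ⟨?_, (hder x).trans_lt (by linarith)⟩
    have hE := fract_reduce (E := fun x => F x - G x)
      (fun x => by simp only [L.map_add_one, hG1]; ring) x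
    rw [hE]
    have h0 : F 0 - G 0 = 0 := by simp [hG]
    have := Convex.norm_image_sub_le_of_norm_deriv_le (𝕜 := ℝ) (f := fun x => F x - G x)
      (s := Set.univ) (C := 2 * ε₁) (x := 0) (y := Int.fract x)
      (fun x _ => (L.differentiable x).sub (hGd x).differentiableAt)
      (fun x _ => by
        rw [deriv_fun_sub (L.differentiable x) (hGd x).differentiableAt]; exact hder x)
      convex_univ trivial trivial
    simp only [h0, sub_zero, Real.norm_eq_abs, abs_of_nonneg (Int.fract_nonneg x)] at this
    nlinarith [Int.fract_lt_one x, Int.fract_nonneg x]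
  exact ⟨G, hopen ∞ G hGs hG1 (hclose.mono (min_le_right _ _)), hclose.mono (min_le_left _ _)⟩

end IsCircleLift

/-! ### Creating a periodic orbit -/

/-- `α` is a base point for the lift `F`: it projects to a periodic point, of exact period `q` if
`F` preserves the orientation; otherwise it is a fixed point and `q = 2`. -/
structure IsBased (d : ℤ) (q : ℕ) (M : ℤ) (α : ℝ) (F : ℝ → ℝ) : Prop where
  q_pos : 0 < q
  deg_pow : d ^ q = 1
  deg_mul : d * M = M
  iterate_eq : F^[q] α = α + M
  preserving : d = 1 → ∀ (j : ℕ) (n : ℤ), F^[j] α = α + n → q ∣ j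
  reversing : d = -1 → q = 2 ∧ F α = α

theorem IsBased.congr {d : ℤ} {q : ℕ} {M : ℤ} {α : ℝ} {F G : ℝ → ℝ} (B : IsBased d q M α F)
    (h : ∀ j, G (F^[j] α) = F (F^[j] α)) : IsBased d q M α G ∧ ∀ j, G^[j] α = F^[j] α := by
  have hj : ∀ j, G^[j] α = F^[j] α := fun j => by
    induction j with
    | zero => rfl
    | succ j ih => rw [iterate_succ_apply', iterate_succ_apply', ih, h]
  refine ⟨⟨B.q_pos, B.deg_pow, B.deg_mul, by rw [hj, B.iterate_eq], fun hd j n hn => ?_,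
    fun hd => ⟨(B.reversing hd).1, ?_⟩⟩, hj⟩
  · exact B.preserving hd j n (by rw [← hj, hn])
  · have := h 0
    rw [iterate_zero, id] at this
    rw [this, (B.reversing hd).2]

/-- Some orbit of any map returns close to its starting point, modulo integers. -/
theorem exists_close_return (F : ℝ → ℝ) {ε : ℝ} (hε : 0 < ε) :
    ∃ (x : ℝ) (q : ℕ) (M : ℤ), 0 < q ∧ |F^[q] x - x - M| < ε := by
  obtain ⟨K, hK⟩ := exists_nat_gt (1 / ε)
  have hK0 : (0 : ℝ) < K := (by positivity : (0 : ℝ) < 1 / ε).trans hK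
  have hmem : ∀ i : ℕ, ⌊K * Int.fract (F^[i] 0)⌋ ∈ Finset.Ico (0 : ℤ) K := fun i => by
    rw [Finset.mem_Ico]
    constructor
    · exact Int.floor_nonneg.2 (mul_nonneg hK0.le (Int.fract_nonneg _))
    · rw [Int.floor_lt]
      have := Int.fract_lt_one (F^[i] 0)
      push_cast
      nlinarith
  obtain ⟨i, j, hij, he⟩ := Finite.exists_ne_map_eq_of_infinite
    (fun i : ℕ => (⟨_, hmem i⟩ : Finset.Ico (0 : ℤ) K))
  have he' : ⌊K * Int.fract (F^[i] 0)⌋ = ⌊K * Int.fract (F^[j] 0)⌋ := congrArg Subtype.val he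
  have habs := Int.abs_sub_lt_one_of_floor_eq_floor he'
  have hd : |Int.fract (F^[i] 0) - Int.fract (F^[j] 0)| < ε := by
    rw [← mul_sub, abs_mul, abs_of_pos hK0] at habs
    rw [div_lt_iff₀ hε] at hK
    by_contra hcon
    push Not at hcon
    nlinarith
  have key : ∀ a b : ℕ, a < b → |Int.fract (F^[b] 0) - Int.fract (F^[a] 0)| < ε →
      ∃ (x : ℝ) (q : ℕ) (M : ℤ), 0 < q ∧ |F^[q] x - x - M| < ε := fun a b hab h => by
    refine ⟨F^[a] 0, b - a, ⌊F^[b] 0⌋ - ⌊F^[a] 0⌋, by omega, ?_⟩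
    rw [← iterate_add_apply, Nat.sub_add_cancel hab.le]
    convert h using 2
    rw [Int.fract, Int.fract]; push_cast; ring
  rcases lt_or_gt_of_ne hij with h | h
  · exact key i j h (by rwa [abs_sub_comm])
  · exact key j i h hd

/-- Every orientation-preserving diffeomorphism becomes one with a periodic point after composition
with a small rotation: a returning orbit is closed up, its end moving monotonically with the angle
of the rotation. -/
theorem IsCircleLift.exists_rotation_periodic {F : ℝ → ℝ} (L : IsCircleLift 1 1 F) {ε : ℝ}
    (hε : 0 < ε) : ∃ θ, |θ| < ε ∧ ∃ (x : ℝ) (q : ℕ) (M : ℤ), 0 < q ∧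
      (fun y => F y + θ)^[q] x = x + M := by
  obtain ⟨x, q, M, hq, hx⟩ := exists_close_return F (half_pos hε)
  have hcont : ∀ n : ℕ, Continuous fun θ : ℝ => (fun y => F y + θ)^[n] x := fun n => by
    induction n with
    | zero => exact continuous_const
    | succ n ih =>
      simp only [iterate_succ_apply']
      exact (L.continuous.comp ih).add continuous_id
  have hmono := L.strictMono.monotone
  have hup : ∀ θ : ℝ, 0 ≤ θ → ∀ n : ℕ, F^[n + 1] x + θ ≤ (fun y => F y + θ)^[n + 1] x ∧
      (fun y => F y - θ)^[n + 1] x ≤ F^[n + 1] x - θ := fun θ hθ n => by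
    induction n with
    | zero => simp
    | succ n ih =>
      rw [iterate_succ_apply' _ (n + 1), iterate_succ_apply' _ (n + 1),
        iterate_succ_apply' _ (n + 1)]
      exact ⟨by gcongr; exact hmono (by linarith [ih.1]),
        by gcongr; exact hmono (by linarith [ih.2])⟩
  obtain ⟨n, rfl⟩ : ∃ n, q = n + 1 := ⟨q - 1, by omega⟩
  have h1 := hup (ε / 2) (by positivity) n
  have h2 := abs_lt.1 hx
  have hivt := intermediate_value_Icc (show -(ε / 2) ≤ ε / 2 by linarith)
    (hcont (n + 1)).continuousOn
  obtain ⟨θ, hθ, he⟩ := hivt (show x + M ∈ _ from ⟨by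
    simp only [← sub_eq_add_neg]; linarith [h1.2, h2.2], by linarith [h1.1, h2.1]⟩)
  exact ⟨θ, by rw [abs_lt]; constructor <;> linarith [hθ.1, hθ.2], x, n + 1, M, hq, he⟩

/-- Diffeomorphisms with a base point are dense. -/
theorem IsCircleLift.exists_based {d : ℤ} {F : ℝ → ℝ} (L : IsCircleLift ∞ d F) {ε : ℝ}
    (hε : 0 < ε) : ∃ (G : ℝ → ℝ) (q : ℕ) (M : ℤ) (α : ℝ),
      IsCircleLift ∞ d G ∧ C1Close ε F G ∧ IsBased d q M α G := by
  rcases L.deg with rfl | rfl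
  · obtain ⟨θ, hθ, x, q₀, M₀, hq₀, hx⟩ := L.one.exists_rotation_periodic hε
    have LG := L.add_const θ
    obtain ⟨f, hf⟩ := LG.one.exists_diff
    have hL : IsLiftOf f 1 fun x => F x + θ := ⟨LG.one, hf⟩
    have hmem : (x : UnitAddCircle) ∈ periodicPts f.1 := by
      refine ⟨q₀, hq₀, ?_⟩
      change f.1^[q₀] (x : UnitAddCircle) = x
      rw [hL.iterate_coe, hx]
      exact circle_coe_eq_iff.2 ⟨M₀, rfl⟩
    have hper : f.1^[minimalPeriod f.1 (x : UnitAddCircle)] (x : UnitAddCircle) = x :=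
      isPeriodicPt_minimalPeriod _ _
    rw [hL.iterate_coe] at hper
    obtain ⟨M, hM⟩ := circle_coe_eq_iff.1 hper
    refine ⟨_, minimalPeriod f.1 (x : UnitAddCircle), M, x, LG, fun y => ?_,
      minimalPeriod_pos_of_mem_periodicPts hmem, by simp, by simp, hM, fun _ j n hj => ?_,
      fun h => by norm_num at h⟩
    · rw [deriv_add_const]
      exact ⟨by simpa using hθ, by simpa using hε⟩
    · refine IsPeriodicPt.minimalPeriod_dvd ?_
      change f.1^[j] (x : UnitAddCircle) = x
      rw [hL.iterate_coe, hj]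
      exact circle_coe_eq_iff.2 ⟨n, rfl⟩
  · have key : ∀ n : ℤ, F n - n = F 0 - 2 * n := fun n => by
      have := L.map_add_int 0 n
      rw [zero_add] at this
      rw [this]; push_cast; ring
    obtain ⟨α, hα⟩ := mem_range_of_exists_le_of_exists_ge (f := fun x => F x - x) (c := 0)
      (L.continuous.sub continuous_id)
      ⟨(⌈F 0 / 2⌉ : ℤ), by rw [key]; linarith [Int.le_ceil (F 0 / 2)]⟩
      ⟨(⌊F 0 / 2⌋ : ℤ), by rw [key]; linarith [Int.floor_le (F 0 / 2)]⟩
    have hα' : F α = α := by linarith [show F α - α = 0 from hα]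
    exact ⟨F, 2, 0, α, L, C1Close.refl hε F, by norm_num, by norm_num, by simp,
      by simp [hα'], fun h => by norm_num at h, fun _ => ⟨rfl, hα'⟩⟩

/-! ### Modifications near a periodic discrete set -/

theorem exists_forall_le_of_int_periodic {N : ℕ} (hN : 0 < N) {a : ℤ → ℝ}
    (ha : ∀ i, a (i + N) = a i) : ∃ j, ∀ i, a j ≤ a i := by
  obtain ⟨j, -, hj⟩ := (Finset.range N).exists_min_image (fun i : ℕ => a i) ⟨0, by simpa using hN⟩
  refine ⟨j, fun i => ?_⟩
  have hper : Periodic a (N : ℤ) := ha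
  have hN' : (0 : ℤ) < N := by exact_mod_cast hN
  have h1 := Int.emod_nonneg i hN'.ne'
  have h2 := Int.emod_lt_of_pos i hN'
  have h3 := hper.sub_int_mul_eq (i / N) (x := i)
  have h4 : i - (i / (N : ℤ) : ℤ) * N = i % N := by
    have := Int.emod_add_mul_ediv i N; linarith
  rw [Int.cast_id, h4] at h3
  have h5 := hj (i % N).toNat (by rw [Finset.mem_range]; omega)
  rwa [Int.toNat_of_nonneg h1, h3] at h5

theorem exists_pos_le_of_int_periodic {N : ℕ} (hN : 0 < N) {a : ℤ → ℝ}
    (ha : ∀ i, a (i + N) = a i) (hpos : ∀ i, 0 < a i) : ∃ m, 0 < m ∧ ∀ i, m ≤ a i := by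
  obtain ⟨j, hj⟩ := exists_forall_le_of_int_periodic hN ha
  exact ⟨a j, hpos j, hj⟩

theorem exists_bound_of_int_periodic {N : ℕ} (hN : 0 < N) {a : ℤ → ℝ}
    (ha : ∀ i, a (i + N) = a i) : ∃ B, 0 < B ∧ ∀ i, |a i| ≤ B := by
  obtain ⟨j, hj⟩ := exists_forall_le_of_int_periodic hN (a := fun i => -|a i|) (by simp [ha])
  exact ⟨|a j| + 1, by positivity, fun i => by have := hj i; linarith⟩

namespace IsMarking

variable {N : ℕ} {p : ℤ → ℝ}

theorem exists_gap (mk : IsMarking N p) : ∃ γ, 0 < γ ∧ ∀ i, p i + γ ≤ p (i + 1) := by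
  obtain ⟨γ, h0, h⟩ := exists_pos_le_of_int_periodic mk.pos (a := fun i => p (i + 1) - p i)
    (fun i => by
      rw [show i + N + 1 = i + 1 + N by ring, mk.map_add, mk.map_add]; ring)
    (fun i => sub_pos.2 (mk.strictMono (by omega)))
  exact ⟨γ, h0, fun i => by have := h i; linarith⟩

theorem add_gap_le (mk : IsMarking N p) {γ : ℝ} (hγ : ∀ i, p i + γ ≤ p (i + 1)) {i j : ℤ}
    (hij : i < j) : p i + γ ≤ p j :=
  (hγ i).trans (mk.strictMono.monotone (by omega))

theorem index_eq_of_close (mk : IsMarking N p) {γ : ℝ} (hγ : ∀ i, p i + γ ≤ p (i + 1)) {i j : ℤ}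
    {x : ℝ} (hi : |x - p i| < γ / 2) (hj : |x - p j| < γ / 2) : i = j := by
  rw [abs_lt] at hi hj
  rcases lt_trichotomy i j with h | h | h
  · linarith [mk.add_gap_le hγ h]
  · exact h
  · linarith [mk.add_gap_le hγ h]

end IsMarking

open Classical in
/-- The function equal to `u i` in the `δ`-neighbourhood of `p i` and to `F` elsewhere. -/
noncomputable def glue (p : ℤ → ℝ) (δ : ℝ) (u : ℤ → ℝ → ℝ) (F : ℝ → ℝ) (x : ℝ) : ℝ :=
  if h : ∃ i, |x - p i| < δ then u h.choose x else F x

section Glue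

variable {N : ℕ} {p : ℤ → ℝ} {γ δ δ' : ℝ} {u : ℤ → ℝ → ℝ} {F : ℝ → ℝ}

theorem glue_near (mk : IsMarking N p) (hγ : ∀ i, p i + γ ≤ p (i + 1)) (hδ : δ ≤ γ / 2) {i : ℤ}
    {x : ℝ} (hx : |x - p i| < δ) : glue p δ u F x = u i x := by
  have h : ∃ i, |x - p i| < δ := ⟨i, hx⟩
  rw [glue, dif_pos h,
    mk.index_eq_of_close hγ (h.choose_spec.trans_le hδ) (hx.trans_le hδ)]

theorem glue_far {x : ℝ} (h : ∀ i, |x - p i| < δ → u i x = F x) : glue p δ u F x = F x := by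
  by_cases hx : ∃ i, |x - p i| < δ
  · rw [glue, dif_pos hx]; exact h _ hx.choose_spec
  · rw [glue, dif_neg hx]

/-- If `u i = F` in the outer part of the neighbourhoods, then the glued function is locally one of
the given functions. -/
theorem glue_cases (mk : IsMarking N p) (hγ : ∀ i, p i + γ ≤ p (i + 1)) (hδ : δ ≤ γ / 2)
    (hδ' : δ' < δ) (hu : ∀ i x, δ' ≤ |x - p i| → |x - p i| < δ → u i x = F x) (x : ℝ) :
    (∃ i, |x - p i| < δ ∧ glue p δ u F =ᶠ[𝓝 x] u i) ∨
      ((∀ i, δ ≤ |x - p i|) ∧ glue p δ u F =ᶠ[𝓝 x] F) := by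
  by_cases hx : ∃ i, |x - p i| < δ
  · obtain ⟨i, hi⟩ := hx
    refine Or.inl ⟨i, hi, ?_⟩
    have ho : IsOpen {y | |y - p i| < δ} := isOpen_lt (by fun_prop) continuous_const
    filter_upwards [ho.mem_nhds hi] with y hy using glue_near mk hγ hδ hy
  · push Not at hx
    refine Or.inr ⟨hx, ?_⟩
    filter_upwards [Metric.ball_mem_nhds x (sub_pos.2 hδ')] with y hy
    refine glue_far fun i hi => hu i y ?_ hi
    rw [Metric.mem_ball, Real.dist_eq, abs_sub_comm] at hy
    linarith [hx i, abs_sub_le x y (p i)]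

theorem glue_add_one (mk : IsMarking N p) (hγ : ∀ i, p i + γ ≤ p (i + 1)) (hδ : δ ≤ γ / 2) {a : ℝ}
    (hF : ∀ x, F (x + 1) = F x + a)
    (hu : ∀ i x, |x - p i| < δ → u (i + N) (x + 1) = u i x + a) (x : ℝ) :
    glue p δ u F (x + 1) = glue p δ u F x + a := by
  have hs : ∀ i, x + 1 - p (i + N) = x - p i := fun i => by rw [mk.map_add]; ring
  by_cases hx : ∃ i, |x - p i| < δ
  · obtain ⟨i, hi⟩ := hx
    rw [glue_near mk hγ hδ hi, glue_near mk hγ hδ (i := i + N) (by rwa [hs]), hu i x hi]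
  · rw [glue, glue, dif_neg hx, dif_neg, hF]
    rintro ⟨i, hi⟩
    refine hx ⟨i - N, ?_⟩
    rwa [← hs, sub_add_cancel]

end Glue

/-- A smooth function equal to `1` on `[-1, 1]` and to `0` outside `(-2, 2)`. -/
theorem exists_cutoff : ∃ (χ : ℝ → ℝ) (C : ℝ), ContDiff ℝ ∞ χ ∧ 0 < C ∧ (∀ y, |y| ≤ 1 → χ y = 1) ∧
    (∀ y, 2 ≤ |y| → χ y = 0) ∧ (∀ y, |χ y| ≤ 1) ∧ ∀ y, |deriv χ y| ≤ C := by
  let b : ContDiffBump (0 : ℝ) := ⟨1, 2, by norm_num, by norm_num⟩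
  have hs : ContDiff ℝ ∞ b := b.contDiff
  obtain ⟨C, hC⟩ := (b.hasCompactSupport.deriv).exists_bound_of_continuous
    (hs.continuous_deriv (by exact_mod_cast le_top))
  refine ⟨b, max C 1, hs, by positivity, fun y hy => b.one_of_mem_closedBall ?_,
    fun y hy => b.zero_of_le_dist ?_, fun y => ?_, fun y => (hC y).trans (le_max_left _ _)⟩
  · simpa [Real.dist_eq] using hy
  · simpa [Real.dist_eq] using hy
  · rw [abs_of_nonneg b.nonneg]; exact b.le_one

/-- A diffeomorphism can be made affine near the points of a finite set, with prescribed slopes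
close to the derivatives, by a `C¹`-small perturbation which keeps the values at these points. -/
theorem IsCircleLift.exists_affine_near {d : ℤ} {F : ℝ → ℝ} (L : IsCircleLift ∞ d F) {N : ℕ}
    {p : ℤ → ℝ} (mk : IsMarking N p) {ε : ℝ} (hε : 0 < ε) :
    ∃ ε', 0 < ε' ∧ ∀ s : ℤ → ℝ, (∀ i, s (i + N) = s i) → (∀ i, |s i - deriv F (p i)| < ε') →
      ∃ G, IsCircleLift ∞ d G ∧ C1Close ε F G ∧
        ∃ δ, 0 < δ ∧ ∀ i u, |u| < δ → G (p i + u) = F (p i) + s i * u := by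
  obtain ⟨χ, C, hχ, hC, hχ1, hχ0, hχb, hχd⟩ := exists_cutoff
  obtain ⟨ε₀, hε₀, hopen⟩ := L.one.of_close
  set ρ := min ε ε₀ / (3 * C + 2) with hρ
  have hρ0 : 0 < ρ := by positivity
  have hρε : ρ * (3 * C + 2) = min ε ε₀ := by rw [hρ]; field_simp
  refine ⟨ρ / 2, by positivity, fun s hsN hs => ?_⟩
  obtain ⟨γ, hγ0, hγ⟩ := mk.exists_gap
  obtain ⟨η₀, hη₀, hu⟩ := L.one.exists_deriv_uniform (half_pos hρ0)
  set η := min (η₀ / 3) (min (γ / 6) (1 / 3)) with hη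
  have hη0 : 0 < η := by positivity
  have e1 : 3 * η ≤ η₀ := by linarith [min_le_left (η₀ / 3) (min (γ / 6) (1 / 3))]
  have e2 : 3 * η ≤ γ / 2 := by
    linarith [min_le_right (η₀ / 3) (min (γ / 6) (1 / 3)), min_le_left (γ / 6) (1 / 3 : ℝ)]
  have e3 : 3 * η ≤ 1 := by
    linarith [min_le_right (η₀ / 3) (min (γ / 6) (1 / 3)), min_le_right (γ / 6) (1 / 3 : ℝ)]
  -- the deviation of `F` from the affine map at `p i`
  set R : ℤ → ℝ → ℝ := fun i x => F x - F (p i) - s i * (x - p i) with hR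
  have hRd : ∀ i x, HasDerivAt (R i) (deriv F x - s i) x := fun i x => by
    have := ((L.one.hasDerivAt x).sub_const (F (p i))).sub
      (((hasDerivAt_id x).sub_const (p i)).const_mul (s i))
    rw [mul_one] at this
    exact this
  have hRdb : ∀ i x, |x - p i| < 3 * η → |deriv F x - s i| ≤ ρ := fun i x hx => by
    have h1 := hu x (p i) (hx.trans_le e1)
    have h2 := hs i
    rw [abs_sub_comm] at h2
    linarith [_root_.abs_sub_le (deriv F x) (deriv F (p i)) (s i)]
  have hRb : ∀ i x, |x - p i| < 3 * η → |R i x| ≤ ρ * (3 * η) := fun i x hx => by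
    have := Convex.norm_image_sub_le_of_norm_hasDerivWithin_le (f := R i) (x := p i) (y := x)
      (s := Metric.ball (p i) (3 * η)) (C := ρ) (fun y _ => (hRd i y).hasDerivWithinAt)
      (fun y hy => hRdb i y (by rwa [← Real.dist_eq])) (convex_ball _ _)
      (Metric.mem_ball_self (by positivity)) (by rwa [Metric.mem_ball, Real.dist_eq])
    have h0 : R i (p i) = 0 := by simp [hR]
    rw [h0, sub_zero, Real.norm_eq_abs, Real.norm_eq_abs] at this
    exact this.trans (by gcongr)
  set u : ℤ → ℝ → ℝ := fun i x => F x - χ ((x - p i) / η) * R i x with hudef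
  have hRs : ∀ i, ContDiff ℝ ∞ (R i) := fun i =>
    (L.contDiff.sub contDiff_const).sub (contDiff_const.mul (contDiff_id.sub contDiff_const))
  have hus : ∀ i, ContDiff ℝ ∞ (u i) := fun i =>
    L.contDiff.sub ((hχ.comp ((contDiff_id.sub contDiff_const).div_const η)).mul (hRs i))
  have hud : ∀ i x, HasDerivAt (u i) (deriv F x -
      (deriv χ ((x - p i) / η) * (1 / η) * R i x + χ ((x - p i) / η) * (deriv F x - s i))) x :=
    fun i x => by
      have h1 : HasDerivAt (fun x => (x - p i) / η) (1 / η) x :=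
        ((hasDerivAt_id x).sub_const (p i)).div_const η
      have h2 : HasDerivAt χ (deriv χ ((x - p i) / η)) ((x - p i) / η) :=
        (hχ.differentiable (by simp) _).hasDerivAt
      exact (L.one.hasDerivAt x).sub ((h2.comp x h1).mul (hRd i x))
  have hout : ∀ i x, 2 * η ≤ |x - p i| → |x - p i| < 3 * η → u i x = F x := fun i x h1 _ => by
    simp only [hudef]
    rw [hχ0, zero_mul, sub_zero]
    rwa [abs_div, abs_of_pos hη0, le_div_iff₀ hη0]
  have hcases := glue_cases (F := F) mk hγ e2 (show 2 * η < 3 * η by linarith) hout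
  set G := glue p (3 * η) u F with hG
  have hGs : ContDiff ℝ ∞ G := by
    rw [contDiff_iff_contDiffAt]
    intro x
    rcases hcases x with ⟨i, -, he⟩ | ⟨-, he⟩
    · exact (hus i).contDiffAt.congr_of_eventuallyEq he
    · exact L.contDiff.contDiffAt.congr_of_eventuallyEq he
  have hclose : C1Close (min ε ε₀) F G := fun x => by
    rcases hcases x with ⟨i, hi, he⟩ | ⟨-, he⟩
    · rw [he.deriv_eq, he.eq_of_nhds, (hud i x).deriv, ← hρε]
      have h1 := hRb i x hi
      have h2 := hRdb i x hi
      have h3 := hχb ((x - p i) / η)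
      have h4 := hχd ((x - p i) / η)
      constructor
      · simp only [hudef, sub_sub_cancel, abs_mul]
        calc |χ ((x - p i) / η)| * |R i x| ≤ 1 * (ρ * (3 * η)) := by gcongr
          _ < ρ * (3 * C + 2) := by nlinarith
      · rw [sub_sub_cancel]
        have k1 : |deriv χ ((x - p i) / η) * (1 / η) * R i x| ≤ C * (1 / η) * (ρ * (3 * η)) := by
          rw [abs_mul, abs_mul, abs_of_pos (show 0 < 1 / η by positivity)]
          gcongr
        have k2 : |χ ((x - p i) / η) * (deriv F x - s i)| ≤ 1 * ρ := by
          rw [abs_mul]; gcongr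
        have k3 : C * (1 / η) * (ρ * (3 * η)) = 3 * C * ρ := by field_simp
        refine (abs_add_le _ _).trans_lt ?_
        nlinarith
    · rw [he.deriv_eq, he.eq_of_nhds]
      have : 0 < min ε ε₀ := by positivity
      simpa using this
  have hG1 : ∀ x, G (x + 1) = G x + d := glue_add_one mk hγ e2 L.map_add_one fun i x _ => by
    have h1 : F (p i + 1) = F (p i) + d := L.map_add_one _
    simp only [hudef, hR, mk.map_add, L.map_add_one, hsN]
    rw [show x + 1 - (p i + 1) = x - p i by ring]; ring
  refine ⟨G, hopen ∞ G hGs hG1 (hclose.mono (min_le_right _ _)), hclose.mono (min_le_left _ _),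
    η, hη0, fun i v hv => ?_⟩
  have h1 : |p i + v - p i| < 3 * η := by rw [add_sub_cancel_left]; linarith
  rw [hG, glue_near mk hγ e2 h1]
  simp only [hudef, hR, add_sub_cancel_left]
  rw [hχ1]
  · ring
  · rw [abs_div, abs_of_pos hη0, div_le_one hη0]; exact hv.le

/-! ### Periodic orbits of lifts -/

namespace IsCircleLift

variable {d : ℤ} {F : ℝ → ℝ} {q : ℕ} {M : ℤ} {z : ℝ}

/-- The orbit of a periodic point depends on the exponent modulo the period only, up to integers. -/
theorem exists_iterate_eq_mod (L : IsCircleLift 1 d F) (hz : F^[q] z = z + M) (j : ℕ) :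
    ∃ n : ℤ, F^[j] z = F^[j % q] z + n := by
  have hmul : ∀ k : ℕ, ∃ n : ℤ, F^[q * k] z = z + n := fun k => by
    induction k with
    | zero => exact ⟨0, by simp⟩
    | succ k ih =>
      obtain ⟨n, hn⟩ := ih
      refine ⟨M + d ^ q * n, ?_⟩
      rw [mul_add, mul_one, add_comm, iterate_add_apply, hn, (L.iterate le_rfl q).map_add_int, hz]
      push_cast; ring
  obtain ⟨n, hn⟩ := hmul (j / q)
  refine ⟨d ^ (j % q) * n, ?_⟩
  conv_lhs => rw [← Nat.mod_add_div j q]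
  rw [iterate_add_apply, hn, (L.iterate le_rfl _).map_add_int]
  push_cast; ring

/-- The multiplier of a periodic orbit does not depend on the point. -/
theorem deriv_iterate_orbit (L : IsCircleLift 1 d F) (hz : F^[q] z = z + M) (j : ℕ) (n : ℤ) :
    deriv F^[q] (F^[j] z + n) = deriv F^[q] z := by
  have Lq := L.iterate le_rfl q
  have Lj := L.iterate le_rfl j
  rw [Lq.deriv_add_int]
  have h1 : F^[q] ∘ F^[j] = F^[j] ∘ F^[q] := by
    rw [← iterate_add, ← iterate_add, add_comm]
  have h2 := deriv_comp z (Lq.differentiable _) (Lj.differentiable z)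
  rw [h1, deriv_comp z (Lj.differentiable _) (Lq.differentiable z), hz, Lj.deriv_add_int,
    mul_comm] at h2
  exact (mul_right_cancel₀ (Lj.deriv_ne z) h2).symm

end IsCircleLift

theorem finite_translates (Z : Finset ℝ) (a b : ℝ) :
    ({x | ∃ z ∈ Z, ∃ n : ℤ, x = z + n} ∩ Set.Icc a b).Finite := by
  refine (Z.finite_toSet.biUnion fun z _ =>
    (Set.finite_Icc ⌈a - z⌉ ⌊b - z⌋).image fun n : ℤ => z + n).subset ?_
  rintro x ⟨⟨z, hz, n, rfl⟩, h1, h2⟩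
  refine Set.mem_biUnion (Finset.mem_coe.2 hz) ⟨n, ⟨?_, ?_⟩, rfl⟩
  · exact Int.ceil_le.2 (by linarith)
  · exact Int.le_floor.2 (by linarith)

/-- Two periodic orbits can be made hyperbolic by a `C¹`-small perturbation. -/
theorem IsCircleLift.exists_hyperbolic_orbits {d : ℤ} {F : ℝ → ℝ} (L : IsCircleLift ∞ d F) {q : ℕ}
    {M M' : ℤ} {z z' : ℝ} (hq : 0 < q) (hz : F^[q] z = z + M)
    (hz' : F^[q] z' = z' + M') {ε : ℝ} (hε : 0 < ε) :
    ∃ G, IsCircleLift ∞ d G ∧ C1Close ε F G ∧ (∀ j, G (F^[j] z) = F (F^[j] z)) ∧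
      (∀ j, G (F^[j] z') = F (F^[j] z')) ∧ deriv G^[q] z ≠ 1 ∧ deriv G^[q] z' ≠ 1 := by
  classical
  let Z : Finset ℝ := (Finset.range q).image (fun j => F^[j] z) ∪
    (Finset.range q).image fun j => F^[j] z'
  let S : Set ℝ := {x | ∃ w ∈ Z, ∃ n : ℤ, x = w + n}
  have memS : ∀ j, F^[j] z ∈ S ∧ F^[j] z' ∈ S := fun j => by
    obtain ⟨n, hn⟩ := L.one.exists_iterate_eq_mod hz j
    obtain ⟨n', hn'⟩ := L.one.exists_iterate_eq_mod hz' j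
    have := Finset.mem_range.2 (Nat.mod_lt j hq)
    exact ⟨⟨_, Finset.mem_union_left _ (Finset.mem_image_of_mem _ this), n, hn⟩,
      ⟨_, Finset.mem_union_right _ (Finset.mem_image_of_mem _ this), n', hn'⟩⟩
  obtain ⟨N, p, mk, hp, -⟩ := IsMarking.exists_of_locallyFinite (S := S) (α := z) (fun x => by
    constructor
    · rintro ⟨w, hw, n, hn⟩; exact ⟨w, hw, n - 1, by push_cast; linarith⟩
    · rintro ⟨w, hw, n, hn⟩; exact ⟨w, hw, n + 1, by push_cast; linarith⟩)
    (finite_translates Z) (memS 0).1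
  obtain ⟨ε', hε', haff⟩ := L.exists_affine_near mk hε
  obtain ⟨B, hB, hBF⟩ := L.one.exists_deriv_bound
  -- a factor close to one whose power avoids the inverses of the two multipliers
  obtain ⟨κ, hκ1, hκ2, hκ3, hκ4⟩ : ∃ κ : ℝ, 0 < κ ∧ |κ - 1| * B < ε' ∧
      κ ^ q * deriv F^[q] z ≠ 1 ∧ κ ^ q * deriv F^[q] z' ≠ 1 := by
    have hfin : ∀ A : ℝ, {κ : ℝ | 0 < κ ∧ κ ^ q * A = 1}.Finite := fun A => by
      refine Set.Subsingleton.finite fun a ha b hb => ?_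
      have hA : A ≠ 0 := by rintro rfl; simpa using ha.2
      have := mul_right_cancel₀ hA (ha.2.trans hb.2.symm)
      exact (pow_left_inj₀ ha.1.le hb.1.le hq.ne').1 this
    have hI : (Set.Ioo (1 : ℝ) (1 + ε' / B)).Infinite :=
      Set.Ioo_infinite (by have : 0 < ε' / B := by positivity
                           linarith)
    obtain ⟨κ, hκ, hκn⟩ := hI.exists_notMem_finite
      ((hfin (deriv F^[q] z)).union (hfin (deriv F^[q] z')))
    have h0 : 0 < κ := one_pos.trans hκ.1
    refine ⟨κ, h0, ?_, fun h => hκn (Or.inl ⟨h0, h⟩), fun h => hκn (Or.inr ⟨h0, h⟩)⟩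
    rw [abs_of_pos (by linarith [hκ.1]), ← lt_div_iff₀ hB]; linarith [hκ.2]
  obtain ⟨G, LG, hclose, δ, hδ, hG⟩ := haff (fun i => κ * deriv F (p i))
    (fun i => by rw [mk.map_add, L.deriv_add_one]) (fun i => by
      rw [← sub_one_mul, abs_mul]
      exact (by gcongr; exact hBF _ : _ ≤ |κ - 1| * B).trans_lt hκ2)
  have hGp : ∀ x ∈ S, G x = F x ∧ deriv G x = κ * deriv F x := fun x hx => by
    rw [← hp] at hx
    obtain ⟨i, rfl⟩ := hx
    refine ⟨by simpa using hG i 0 (by simpa using hδ), ?_⟩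
    have hev : G =ᶠ[𝓝 (p i)] fun y => F (p i) + κ * deriv F (p i) * (y - p i) := by
      filter_upwards [Metric.ball_mem_nhds (p i) hδ] with y hy
      have := hG i (y - p i) (by rwa [Metric.mem_ball, Real.dist_eq] at hy)
      rwa [add_sub_cancel] at this
    have hd : HasDerivAt (fun y => F (p i) + κ * deriv F (p i) * (y - p i))
        (κ * deriv F (p i) * 1) (p i) :=
      (((hasDerivAt_id _).sub_const _).const_mul _).const_add _
    rw [hev.deriv_eq, hd.deriv, mul_one]
  have hit : ∀ w, (∀ j, F^[j] w ∈ S) → deriv G^[q] w = κ ^ q * deriv F^[q] w := fun w hw => by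
    have hGj : ∀ j, G^[j] w = F^[j] w := fun j => by
      induction j with
      | zero => rfl
      | succ j ih => rw [iterate_succ_apply', iterate_succ_apply', ih, (hGp _ (hw j)).1]
    rw [LG.one.deriv_iterate, L.one.deriv_iterate,
      Finset.prod_congr rfl fun j _ => by rw [hGj, (hGp _ (hw j)).2], Finset.prod_mul_distrib,
      Finset.prod_const, Finset.card_range]
  refine ⟨G, LG, hclose, fun j => (hGp _ (memS j).1).1, fun j => (hGp _ (memS j).2).1, ?_, ?_⟩
  · rwa [hit z fun j => (memS j).1]
  · rwa [hit z' fun j => (memS j).2]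

/-! ### Fundamental arcs -/

/-- The arc `(α, β)` is permuted by the dynamics with exact period `q`, and its iterates together
with their endpoints cover the circle. -/
structure IsArc (q : ℕ) (M : ℤ) (α β : ℝ) (F : ℝ → ℝ) : Prop where
  lt : α < β
  le : β ≤ α + 1
  left : F^[q] α = α + M
  right : F^[q] β = β + M
  disjoint : ∀ y ∈ Set.Ioo α β, ∀ j, 0 < j → j < q → ∀ n : ℤ, F^[j] y + n ∉ Set.Ioo α β
  cover : ∀ x, ∃ (j : ℕ) (n : ℤ), F^[j] x + n ∈ Set.Icc α β

/-- In the orientation-preserving case, an arc joining the base point to the next point of its orbit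
is fundamental. -/
theorem IsBased.exists_arc {F : ℝ → ℝ} {q : ℕ} {M : ℤ} {α : ℝ} (L : IsCircleLift 1 1 F)
    (B : IsBased 1 q M α F) : ∃ β, IsArc q M α β F ∧ ∃ (j : ℕ) (n : ℤ), β = F^[j] α + n := by
  have hmono : ∀ j, StrictMono F^[j] := fun j => L.strictMono.iterate j
  have hint : ∀ (j : ℕ) (x : ℝ) (n : ℤ), F^[j] (x + n) = F^[j] x + n := fun j x n => by
    have := (L.iterate le_rfl j).map_add_int x n
    simpa using this
  let Z : Finset ℝ := (Finset.range q).image fun j => F^[j] α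
  let S : Set ℝ := {x | ∃ z ∈ Z, ∃ n : ℤ, x = z + n}
  have memS : ∀ (j : ℕ) (n : ℤ), F^[j] α + n ∈ S := fun j n => by
    obtain ⟨k, hk⟩ := L.exists_iterate_eq_mod B.iterate_eq j
    exact ⟨_, Finset.mem_image_of_mem _ (Finset.mem_range.2 (Nat.mod_lt j B.q_pos)), k + n, by
      rw [hk]; push_cast; ring⟩
  have memS' : ∀ x ∈ S, ∃ (j : ℕ) (n : ℤ), j < q ∧ x = F^[j] α + n := by
    rintro x ⟨z, hz, n, rfl⟩
    obtain ⟨j, hj, rfl⟩ := Finset.mem_image.1 hz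
    exact ⟨j, n, Finset.mem_range.1 hj, rfl⟩
  have hS1 : ∀ x, x + 1 ∈ S ↔ x ∈ S := fun x => by
    constructor
    · rintro ⟨w, hw, n, hn⟩; exact ⟨w, hw, n - 1, by push_cast; linarith⟩
    · rintro ⟨w, hw, n, hn⟩; exact ⟨w, hw, n + 1, by push_cast; linarith⟩
  obtain ⟨N, p, mk, hp, hp0⟩ := IsMarking.exists_of_locallyFinite hS1 (finite_translates Z)
    (α := α) (by simpa using memS 0 0)
  -- the orbit is invariant and the dynamics shifts its points
  have hinv : ∀ x, F x ∈ Set.range p ↔ x ∈ Set.range p := fun x => by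
    rw [hp]
    constructor
    · intro hx
      obtain ⟨j, n, -, hj⟩ := memS' _ hx
      have h1 : F x = F (F^[j + q - 1] α + (n - M : ℤ)) := by
        rw [show F (F^[j + q - 1] α + (n - M : ℤ)) = F (F^[j + q - 1] α) + (n - M : ℤ) by
          simpa using hint 1 (F^[j + q - 1] α) (n - M), ← iterate_succ_apply' F,
          show (j + q - 1).succ = j + q by have := B.q_pos; omega, iterate_add_apply,
          B.iterate_eq, hint, hj]
        push_cast; ring
      rw [L.injective h1]; exact memS _ _
    · intro hx
      obtain ⟨j, n, -, rfl⟩ := memS' _ hx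
      have : F (F^[j] α + n) = F^[j + 1] α + n := by
        rw [iterate_succ_apply']; simpa using hint 1 (F^[j] α) n
      rw [this]; exact memS _ _
  obtain ⟨m, hm⟩ := mk.exists_shift L hinv
  have hmj : ∀ (j : ℕ) (i : ℤ), F^[j] (p i) = p (i + j * m) := fun j i => by
    induction j with
    | zero => simp
    | succ j ih => rw [iterate_succ_apply', ih, hm]; congr 1; push_cast; ring
  have hp1 : p (0 + N) = α + 1 := by rw [mk.map_add, hp0]
  have hN := mk.pos
  have hlt : α < p 1 := by rw [← hp0]; exact mk.strictMono (by norm_num)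
  obtain ⟨jβ, nβ, -, hβ⟩ := memS' (p 1) (hp ▸ ⟨1, rfl⟩)
  refine ⟨p 1, ⟨hlt, ?_, B.iterate_eq, ?_, fun y hy j hj0 hjq n hn => ?_, fun x => ?_⟩, jβ, nβ, hβ⟩
  · rw [← hp1]; exact mk.strictMono.monotone (by omega)
  · rw [hβ, hint, ← iterate_add_apply, add_comm q, iterate_add_apply, B.iterate_eq, hint]; ring
  · rw [← hp0] at hy hn
    have h1 := hmono j hy.1
    have h2 := hmono j hy.2
    rw [hmj] at h1 h2
    have h3 : F^[j] y + n ∈ Set.Ioo (p (0 + j * m + N * n)) (p (0 + j * m + N * n + 1)) := by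
      rw [mk.map_add_mul, show (0 : ℤ) + j * m + N * n + 1 = 1 + j * m + N * n by ring,
        mk.map_add_mul]
      exact ⟨by linarith, by linarith⟩
    have h4 := mk.index_unique h3 (j := 0) (by simpa using hn)
    have h5 := hmj j 0
    rw [show (0 : ℤ) + j * m = 0 + N * (-n) by linarith, mk.map_add_mul, hp0] at h5
    have := Nat.le_of_dvd hj0 (B.preserving rfl j (-n) h5)
    omega
  · obtain ⟨i, hi1, hi2⟩ := mk.exists_mem_Ico x
    obtain ⟨j, n, hjq, hi⟩ := memS' (p i) (hp ▸ ⟨i, rfl⟩)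
    -- a further iterate brings the left end of the arc containing `x` to `α`
    have h0 : F^[q - j] (p i) = p 0 + (M + n : ℤ) := by
      rw [hi, hint, ← iterate_add_apply, Nat.sub_add_cancel hjq.le, B.iterate_eq, hp0]
      push_cast; ring
    have h1 := (hmono (q - j)).monotone hi1
    have h2 := (hmono (q - j)).monotone hi2.le
    have h3 : p (i + 1 + (q - j : ℕ) * m) = p 1 + (M + n : ℤ) := by
      rw [hmj, ← mk.map_add_mul] at h0
      have := mk.strictMono.injective h0
      rw [← mk.map_add_mul]; congr 1; linarith
    rw [hmj, h3] at h2
    rw [h0, hp0] at h1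
    exact ⟨q - j, -(M + n), by push_cast at h1 ⊢; linarith, by push_cast at h2 ⊢; linarith⟩

/-- In the orientation-reversing case, the arc between two fixed points is fundamental. -/
theorem isArc_of_reversing {F : ℝ → ℝ} {α β : ℝ} (L : IsCircleLift 1 (-1) F) (hα : F α = α)
    (hβ : F β = β - 1) (h1 : α < β) (h2 : β < α + 1) : IsArc 2 0 α β F := by
  have hanti := L.strictAnti
  have hint : ∀ (x : ℝ) (n : ℤ), F (x + n) = F x - n := fun x n => by
    have := L.map_add_int x n; push_cast at this; linarith
  have hβ2 : F (β - 1) = β := by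
    have := hint (β - 1) 1
    push_cast at this
    rw [sub_add_cancel, hβ] at this; linarith
  refine ⟨h1, h2.le, by simp [hα], by simp [hβ, hβ2], fun y hy j hj0 hj2 n hn => ?_, fun x => ?_⟩
  · obtain rfl : j = 1 := by omega
    rw [iterate_one] at hn
    have h3 := hanti hy.1
    have h4 := hanti hy.2
    rw [hα] at h3
    rw [hβ] at h4
    have h5 : (0 : ℝ) < n := by linarith [hn.1]
    have h6 : (n : ℝ) < 1 := by linarith [hn.2]
    have h7 : 0 < n := by exact_mod_cast h5
    have h8 : n < 1 := by exact_mod_cast h6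
    omega
  · have k1 := Int.floor_le (x - α)
    have k2 := Int.lt_floor_add_one (x - α)
    set n := ⌊x - α⌋
    by_cases hx : x - n ≤ β
    · exact ⟨0, -n, by push_cast; simp only [iterate_zero, id]; linarith,
        by push_cast; simp only [iterate_zero, id]; linarith⟩
    · push Not at hx
      refine ⟨1, n + 1, ?_⟩
      have h3 := hanti hx
      have h4 := hanti (show x - n < α + (1 : ℤ) by push_cast; linarith)
      have h5 := hint x (-n)
      push_cast at h5
      rw [← sub_eq_add_neg] at h5
      rw [h5, hβ] at h3
      rw [h5, hint, hα] at h4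
      push_cast at h4 ⊢
      rw [iterate_one]
      exact ⟨by linarith, by linarith⟩

namespace IsArc

variable {d : ℤ} {F : ℝ → ℝ} {q : ℕ} {M : ℤ} {α β z : ℝ}

/-- The orbits of the endpoints avoid the arc. -/
theorem endpoint_notMem (A : IsArc q M α β F) (L : IsCircleLift 1 d F) (hq : 0 < q)
    (hz : z = α ∨ z = β) (j : ℕ) (n : ℤ) : F^[j] z + n ∉ Set.Ioo α β := by
  have hzq : F^[q] z = z + M := by rcases hz with rfl | rfl; exacts [A.left, A.right]
  have hlow : ∀ k, 0 < k → k < q → ∀ n : ℤ, F^[k] z + n ∉ Set.Ioo α β := fun k hk hkq n hn => by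
    have hc : ContinuousAt (fun y => F^[k] y + n) z :=
      ((L.iterate le_rfl k).continuous.add continuous_const).continuousAt
    have hev := hc.eventually (isOpen_Ioo.mem_nhds hn)
    have hcl : z ∈ closure (Set.Ioo α β) := by
      rw [closure_Ioo A.lt.ne]
      rcases hz with rfl | rfl
      exacts [Set.left_mem_Icc.2 A.lt.le, Set.right_mem_Icc.2 A.lt.le]
    obtain ⟨y, hy, hyI⟩ := mem_closure_iff_nhds.1 hcl _ hev
    exact A.disjoint y hyI k hk hkq n hy
  obtain ⟨k, hk⟩ := L.exists_iterate_eq_mod hzq j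
  rw [hk, add_assoc, ← Int.cast_add]
  rcases Nat.eq_zero_or_pos (j % q) with h0 | h0
  · rw [h0, iterate_zero, id]
    intro hn
    have hle := A.le
    rcases hz with rfl | rfl
    · have h1 : (0 : ℝ) < (k + n : ℤ) := by linarith [hn.1]
      have h2 : ((k + n : ℤ) : ℝ) < 1 := by linarith [hn.2]
      have h3 : 0 < k + n := by exact_mod_cast h1
      have h4 : k + n < 1 := by exact_mod_cast h2
      omega
    · have h1 : ((k + n : ℤ) : ℝ) < 0 := by linarith [hn.2]
      have h2 : (-1 : ℝ) < (k + n : ℤ) := by linarith [hn.1]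
      have h3 : k + n < 0 := by exact_mod_cast h1
      have h4 : -1 < k + n := by exact_mod_cast h2
      omega
  · exact hlow _ h0 (Nat.mod_lt _ hq) _

end IsArc

/-! ### Hyperbolicity by Sard's theorem -/

/-- A smooth periodic function vanishing exactly outside the translates of a given interval. -/
theorem exists_bump {α β : ℝ} (h1 : α < β) (h2 : β ≤ α + 1) : ∃ b : ℝ → ℝ, ContDiff ℝ ∞ b ∧
    (∀ x, b (x + 1) = b x) ∧ (∀ x ∈ Set.Ioo α β, 0 < b x) ∧
    ∀ x : ℝ, (∀ n : ℤ, x + n ∉ Set.Ioo α β) → b x = 0 ∧ deriv b x = 0 := by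
  set g : ℝ → ℝ := fun x => Real.sin (Real.pi * (x - α)) * Real.sin (Real.pi * (β - x)) with hg
  have hgs : ContDiff ℝ ∞ g := by
    apply ContDiff.mul <;> exact Real.contDiff_sin.comp (by fun_prop)
  have hbs : ContDiff ℝ ∞ fun x => expNegInvGlue (g x) := expNegInvGlue.contDiff.comp hgs
  have hg1 : ∀ x, g (x + 1) = g x := fun x => by
    simp only [hg]
    rw [show Real.pi * (x + 1 - α) = Real.pi * (x - α) + Real.pi by ring,
      show Real.pi * (β - (x + 1)) = Real.pi * (β - x) - Real.pi by ring, Real.sin_add_pi,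
      Real.sin_sub_pi]
    ring
  have hpi := Real.pi_pos
  refine ⟨fun x => expNegInvGlue (g x), hbs, fun x => by simp only [hg1], fun x hx => ?_,
    fun x hx => ?_⟩
  · refine expNegInvGlue.pos_of_pos (mul_pos ?_ ?_) <;> apply Real.sin_pos_of_pos_of_lt_pi <;>
      nlinarith [hx.1, hx.2]
  · have h0 : expNegInvGlue (g x) = 0 := by
      refine expNegInvGlue.zero_of_nonpos ?_
      have k1 := Int.floor_le (x - α)
      have k2 := Int.lt_floor_add_one (x - α)
      set n := ⌊x - α⌋
      have hper : Periodic g (1 : ℝ) := hg1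
      have h3 : g (x - n) = g x := by simpa using hper.sub_int_mul_eq n (x := x)
      rw [← h3]
      rcases eq_or_lt_of_le (show α ≤ x - n by linarith) with he | hlt
      · simp [hg, ← he]
      refine mul_nonpos_of_nonneg_of_nonpos ?_ ?_
      · apply Real.sin_nonneg_of_nonneg_of_le_pi <;> nlinarith
      · have h4 := hx (-n)
        push_cast at h4
        rw [← sub_eq_add_neg, Set.mem_Ioo, not_and, not_lt] at h4
        have h5 := h4 hlt
        apply Real.sin_nonpos_of_nonpos_of_neg_pi_le <;> nlinarith
    refine ⟨h0, IsLocalMin.deriv_eq_zero (Filter.Eventually.of_forall fun y => ?_)⟩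
    simp only [h0]
    exact expNegInvGlue.nonneg _

open MeasureTheory in
/-- Sard's theorem on the line: almost every value of a differentiable function is regular. -/
theorem exists_regular_value {s : Set ℝ} {T T' : ℝ → ℝ} (h : ∀ x ∈ s, HasDerivAt T (T' x) x)
    {η : ℝ} (hη : 0 < η) : ∃ θ ∈ Set.Ioo 0 η, ∀ x ∈ s, T x = θ → T' x ≠ 0 := by
  have h0 : volume (T '' {x ∈ s | T' x = 0}) = 0 := by
    refine addHaar_image_eq_zero_of_det_fderivWithin_eq_zero volume (f' := fun _ => 0)
      (fun x hx => ?_) fun x _ => by simp [ContinuousLinearMap.det]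
    have h1 := (h x hx.1).hasFDerivAt.hasFDerivWithinAt (s := {x ∈ s | T' x = 0})
    rw [hx.2] at h1
    simpa using h1
  by_contra! hcon
  have hsub : Set.Ioo 0 η ⊆ T '' {x ∈ s | T' x = 0} := fun θ hθ => by
    obtain ⟨x, hx, h1, h2⟩ := hcon θ hθ
    exact ⟨x, ⟨hx, h2⟩, h1⟩
  have := measure_mono_null hsub h0
  rw [Real.volume_Ioo] at this
  simp at this
  linarith

/-- If the end points of a fundamental arc are hyperbolic, then every periodic point can be made
hyperbolic: `F` is composed with a diffeomorphism supported in the arc, which moves the return map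
to the arc along a vector field, and Sard's theorem provides a transverse value of the parameter. -/
theorem IsArc.exists_hyperbolic {d : ℤ} {F : ℝ → ℝ} {q : ℕ} {M : ℤ} {α β : ℝ}
    (A : IsArc q M α β F) (L : IsCircleLift ∞ d F) (B : IsBased d q M α F)
    (hα : deriv F^[q] α ≠ 1) (hβ : deriv F^[q] β ≠ 1) {ε : ℝ} (hε : 0 < ε) :
    ∃ H, IsCircleLift ∞ d H ∧ C1Close ε F H ∧ IsBased d q M α H ∧
      ∀ x, H^[q] x = x + M → deriv H^[q] x ≠ 1 := by
  obtain ⟨b, hb, hb1, hbpos, hb0⟩ := exists_bump A.lt A.le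
  have hbd : ∀ x, HasDerivAt b (deriv b x) x := fun x =>
    (hb.differentiable (by simp) x).hasDerivAt
  have Lq := L.iterate (by simp) q
  obtain ⟨K, LK, hKl, hKr⟩ := Lq.one.exists_inverse le_rfl
  obtain ⟨ε₁, hε₁, hclose⟩ := L.one.close_comp (IsCircleLift.id (r := 1)) hε
  obtain ⟨ε₂, hε₂, hopen⟩ := (IsCircleLift.id (r := 1)).of_close
  obtain ⟨Cb, hCb0, hCb⟩ := exists_bound_of_periodic hb.continuous hb1
  obtain ⟨Cd, hCd0, hCd⟩ := exists_bound_of_periodic (φ := deriv b)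
    (hb.continuous_deriv (by simp)) (fun x => by rw [← deriv_comp_add_const]; simp only [hb1])
  set η := min ε₁ ε₂ / (Cb + Cd) with hη
  have hη0 : 0 < η := by positivity
  -- the parameter value at which a point of the arc becomes periodic
  set T : ℝ → ℝ := fun x => (K (x + M) - x) / b x with hT
  set T' : ℝ → ℝ := fun x =>
    ((deriv K (x + M) - 1) * b x - (K (x + M) - x) * deriv b x) / b x ^ 2 with hT'
  have hTd : ∀ x ∈ Set.Ioo α β, HasDerivAt T (T' x) x := fun x hx => by
    have h1 : HasDerivAt (fun x => K (x + M)) (deriv K (x + M)) x :=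
      (LK.hasDerivAt (x + M)).comp_add_const x M
    exact (h1.sub (hasDerivAt_id x)).div (hbd x) (hbpos x hx).ne'
  obtain ⟨θ, ⟨hθ0, hθη⟩, hreg⟩ := exists_regular_value hTd hη0
  have hθb : θ * (Cb + Cd) < min ε₁ ε₂ := by rwa [hη, lt_div_iff₀ (by positivity)] at hθη
  set ψ : ℝ → ℝ := fun x => x + θ * b x with hψ
  have hψs : ContDiff ℝ ∞ ψ := contDiff_id.add (contDiff_const.mul hb)
  have hψd : ∀ x, HasDerivAt ψ (1 + θ * deriv b x) x := fun x =>
    (hasDerivAt_id x).add ((hbd x).const_mul θ)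
  have hψc : C1Close (min ε₁ ε₂) id ψ := fun x => by
    rw [(hψd x).deriv, deriv_id]
    simp only [hψ, id, sub_add_cancel_left, abs_neg, abs_mul, abs_of_pos hθ0]
    exact ⟨by nlinarith [hCb x], by nlinarith [hCd x]⟩
  have Lψ : IsCircleLift ∞ 1 ψ := hopen ∞ ψ hψs (fun x => by simp only [hψ, hb1]; push_cast; ring)
    (hψc.mono (min_le_right _ _))
  have hψm := Lψ.one.strictMono
  set H := F ∘ ψ with hH
  have LH : IsCircleLift ∞ d H := by simpa using L.comp (by simp) Lψ
  have hFH : C1Close ε F H := by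
    have := hclose F ψ L.one.differentiable Lψ.one.differentiable (C1Close.refl hε₁ F)
      (hψc.mono (min_le_left _ _))
    rwa [Function.comp_id] at this
  have hψout : ∀ x : ℝ, (∀ n : ℤ, x + n ∉ Set.Ioo α β) → ψ x = x ∧ deriv H x = deriv F x :=
    fun x hx => by
      obtain ⟨k1, k2⟩ := hb0 x hx
      have k3 : ψ x = x := by simp [hψ, k1]
      refine ⟨k3, ?_⟩
      rw [hH, deriv_comp x (L.one.differentiable _) (hψd x).differentiableAt, (hψd x).deriv, k3, k2]
      ring
  have hψα : ψ α = α := (hψout α fun n => A.endpoint_notMem L.one B.q_pos (Or.inl rfl) 0 n).1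
  have hψβ : ψ β = β := (hψout β fun n => A.endpoint_notMem L.one B.q_pos (Or.inr rfl) 0 n).1
  have hψI : ∀ y ∈ Set.Ioo α β, ψ y ∈ Set.Ioo α β := fun y hy =>
    ⟨by have := hψm hy.1; rwa [hψα] at this, by have := hψm hy.2; rwa [hψβ] at this⟩
  -- orbits of the end points
  have hend : ∀ z, z = α ∨ z = β →
      (∀ j, H (F^[j] z) = F (F^[j] z)) ∧ deriv H^[q] z = deriv F^[q] z := fun z hz => by
    have h1 : ∀ j, ψ (F^[j] z) = F^[j] z ∧ deriv H (F^[j] z) = deriv F (F^[j] z) := fun j =>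
      hψout _ fun n => A.endpoint_notMem L.one B.q_pos hz j n
    have h2 : ∀ j, H (F^[j] z) = F (F^[j] z) := fun j => by
      simp only [hH, Function.comp_apply, (h1 j).1]
    have h3 : ∀ j, H^[j] z = F^[j] z := fun j => by
      induction j with
      | zero => rfl
      | succ j ih => rw [iterate_succ_apply', iterate_succ_apply', ih, h2]
    refine ⟨h2, ?_⟩
    rw [LH.one.deriv_iterate, L.one.deriv_iterate]
    exact Finset.prod_congr rfl fun j _ => by rw [h3, (h1 j).2]
  -- the return map on the arc
  have hret : ∀ y ∈ Set.Ioo α β, H^[q] y = F^[q] (ψ y) := fun y hy => by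
    have : ∀ j, 0 < j → j ≤ q → H^[j] y = F^[j] (ψ y) := fun j => by
      induction j with
      | zero => intro h; omega
      | succ j ih =>
        intro _ hj
        rw [iterate_succ_apply', iterate_succ_apply']
        rcases Nat.eq_zero_or_pos j with rfl | hj0
        · rfl
        · rw [ih hj0 (by omega), hH, Function.comp_apply,
            (hψout _ fun n => A.disjoint _ (hψI y hy) j hj0 (by omega) n).1]
    exact this q B.q_pos le_rfl
  have harc : ∀ y ∈ Set.Ioo α β, H^[q] y = y + M → deriv H^[q] y ≠ 1 := fun y hy hyM hd1 => by
    have hby := hbpos y hy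
    have hKψ : K (y + M) = ψ y := by rw [← hyM, hret y hy, hKl]
    have hTy : T y = θ := by
      simp only [hT, hKψ, hψ, add_sub_cancel_left]
      field_simp
    have hev : H^[q] =ᶠ[𝓝 y] F^[q] ∘ ψ := by
      filter_upwards [isOpen_Ioo.mem_nhds hy] with w hw using hret w hw
    rw [hev.deriv_eq, deriv_comp y (Lq.one.differentiable _) (hψd y).differentiableAt,
      (hψd y).deriv] at hd1
    have hKd : deriv F^[q] (ψ y) * deriv K (y + M) = 1 := by
      have h2 : HasDerivAt (F^[q] ∘ K) (deriv F^[q] (K (y + M)) * deriv K (y + M)) (y + M) :=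
        (Lq.one.hasDerivAt _).comp _ (LK.hasDerivAt _)
      rw [show F^[q] ∘ K = id from funext hKr, hKψ] at h2
      exact (h2.unique (hasDerivAt_id _))
    have h3 : deriv K (y + M) = 1 + θ * deriv b y :=
      mul_left_cancel₀ (Lq.one.deriv_ne _) (hKd.trans hd1.symm)
    refine hreg y hy hTy ?_
    simp only [hT', hKψ, h3, hψ]
    rw [show (1 + θ * deriv b y - 1) * b y - (y + θ * b y - y) * deriv b y = 0 by ring, zero_div]
  refine ⟨H, LH, hFH, (B.congr (hend α (Or.inl rfl)).1).1, fun x hx => ?_⟩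
  -- the first iterate that reaches the closed arc
  classical
  have hex := A.cover x
  set j := Nat.find hex
  obtain ⟨n, hn⟩ := Nat.find_spec hex
  have hmin : ∀ i < j, ∀ n : ℤ, F^[i] x + n ∉ Set.Ioo α β := fun i hi n h =>
    Nat.find_min hex hi ⟨n, Set.Ioo_subset_Icc_self h⟩
  have hHj : ∀ i ≤ j, H^[i] x = F^[i] x := fun i => by
    induction i with
    | zero => intro _; rfl
    | succ i ih =>
      intro hi
      rw [iterate_succ_apply', iterate_succ_apply', ih (by omega), hH, Function.comp_apply,
        (hψout _ (hmin i (by omega))).1]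
  change F^[j] x + n ∈ _ at hn
  rw [← hHj j le_rfl] at hn
  have hdM : ∀ i : ℕ, d ^ i * M = M := fun i => by
    induction i with
    | zero => simp
    | succ i ih => rw [pow_succ, mul_assoc, B.deg_mul, ih]
  have hper : H^[q] (H^[j] x + n) = H^[j] x + n + M := by
    rw [(LH.one.iterate le_rfl q).map_add_int, B.deg_pow, ← iterate_add_apply, add_comm q,
      iterate_add_apply, hx, (LH.one.iterate le_rfl j).map_add_int, ← Int.cast_mul, hdM]
    push_cast; ring
  rw [← LH.one.deriv_iterate_orbit hx j n]
  rcases eq_or_lt_of_le hn.1 with h | h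
  · rw [← h, (hend α (Or.inl rfl)).2]; exact hα
  rcases eq_or_lt_of_le hn.2 with h' | h'
  · rw [h', (hend β (Or.inr rfl)).2]; exact hβ
  · exact harc _ ⟨h, h'⟩ hper

/-- Diffeomorphisms with a base point and only hyperbolic periodic points are dense. -/
theorem IsBased.exists_hyperbolic {d : ℤ} {F : ℝ → ℝ} {q : ℕ} {M : ℤ} {α : ℝ}
    (B : IsBased d q M α F) (L : IsCircleLift ∞ d F) {ε : ℝ} (hε : 0 < ε) :
    ∃ H, IsCircleLift ∞ d H ∧ C1Close ε F H ∧ IsBased d q M α H ∧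
      ∀ x, H^[q] x = x + M → deriv H^[q] x ≠ 1 := by
  have hε2 := half_pos hε
  have key : ∃ G β, IsCircleLift ∞ d G ∧ C1Close (ε / 2) F G ∧ IsBased d q M α G ∧
      IsArc q M α β G ∧ deriv G^[q] α ≠ 1 ∧ deriv G^[q] β ≠ 1 := by
    rcases L.deg with rfl | rfl
    · obtain ⟨G, LG, hFG, hα, -, hd, -⟩ :=
        L.exists_hyperbolic_orbits B.q_pos B.iterate_eq B.iterate_eq hε2
      have BG := (B.congr hα).1
      obtain ⟨β, A, j, n, hβ⟩ := BG.exists_arc LG.one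
      refine ⟨G, β, LG, hFG, BG, A, hd, ?_⟩
      rwa [hβ, LG.one.deriv_iterate_orbit BG.iterate_eq]
    · obtain ⟨rfl, hα⟩ := B.reversing rfl
      have hM : M = 0 := by have := B.deg_mul; omega
      subst hM
      have hα1 : F (α + 1) = α - 1 := by rw [L.map_add_one, hα]; push_cast; ring
      obtain ⟨β, hβI, hβ⟩ : ∃ β ∈ Set.Ioo α (α + 1), F β - β = -1 := by
        have hc : ContinuousOn (fun x => F x - x) (Set.Icc α (α + 1)) :=
          (L.one.continuous.sub continuous_id).continuousOn
        have := intermediate_value_Ioo' (by linarith) hc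
        obtain ⟨β, h1, h2⟩ := this (show (-1 : ℝ) ∈ _ from ⟨by linarith, by linarith⟩)
        exact ⟨β, h1, h2⟩
      have hβ' : F β = β - 1 := by linarith
      have hβ2 : F^[2] β = β + (0 : ℤ) := by
        have := L.one.map_add_int β (-1)
        push_cast at this
        rw [iterate_succ_apply, iterate_one, hβ', sub_eq_add_neg, this, hβ']
        push_cast; ring
      obtain ⟨G, LG, hFG, hjα, hjβ, hd, hd'⟩ :=
        L.exists_hyperbolic_orbits two_pos B.iterate_eq hβ2 hε2
      refine ⟨G, β, LG, hFG, (B.congr hjα).1, isArc_of_reversing LG.one ?_ ?_ hβI.1 hβI.2, hd, hd'⟩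
      · simpa [hα] using hjα 0
      · simpa [hβ'] using hjβ 0
  obtain ⟨G, β, LG, hFG, BG, A, hd, hd'⟩ := key
  obtain ⟨H, LH, hGH, BH, hH⟩ := A.exists_hyperbolic LG BG hd hd' hε2
  refine ⟨H, LH, ?_, BH, hH⟩
  have := hFG.trans hGH
  rwa [add_halves] at this

/-! ### Linearization near the periodic points -/

/-- The zero set of a periodic function with simple zeros does not grow under a `C¹`-small
perturbation which keeps these zeros. -/
theorem exists_persistence {g : ℝ → ℝ} (hg : ContDiff ℝ 1 g) (hp : ∀ x, g (x + 1) = g x)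
    (hyp : ∀ x, g x = 0 → deriv g x ≠ 0) : ∃ ε, 0 < ε ∧ ∀ g₁, Differentiable ℝ g₁ →
      C1Close ε g g₁ → (∀ x, g x = 0 → g₁ x = 0) → ∀ x, g₁ x = 0 → g x = 0 := by
  have hd : ∀ x, HasDerivAt g (deriv g x) x := fun x =>
    (hg.differentiable one_ne_zero x).hasDerivAt
  have hc : Continuous (deriv g) := hg.continuous_deriv le_rfl
  have hp' : ∀ x, deriv g (x + 1) = deriv g x := fun x => by
    rw [← deriv_comp_add_const]; simp only [hp]
  obtain ⟨m, hm, hmb⟩ := exists_pos_bound_of_periodic (φ := fun x => |g x| + |deriv g x|)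
    (hg.continuous.abs.add hc.abs) (fun x => by rw [hp, hp']) (fun x => by
      by_cases h : g x = 0
      · have := abs_pos.2 (hyp x h); positivity
      · have := abs_pos.2 h; positivity)
  obtain ⟨η, hη, hu⟩ := uniformContinuous_of_periodic hc hp' (show 0 < m / 4 by positivity)
  refine ⟨min (m / 4) (m * η / 8), by positivity, fun g₁ hg₁ hclose hz x hx => ?_⟩
  have h1 := (hclose x).1
  rw [hx, sub_zero] at h1
  have h2 := h1.trans_le (min_le_left _ _)
  have h3 := h1.trans_le (min_le_right _ _)
  have h4 := hmb x
  obtain ⟨σ, hσ, hσx⟩ : ∃ σ : ℝ, |σ| = 1 ∧ σ * deriv g x = |deriv g x| := by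
    rcases le_total 0 (deriv g x) with h | h
    · exact ⟨1, by simp, by rw [abs_of_nonneg h, one_mul]⟩
    · exact ⟨-1, by simp, by rw [abs_of_nonpos h]; ring⟩
  have hσ0 : σ ≠ 0 := by rintro rfl; simp at hσ
  have hslope : ∀ y, |x - y| < η → m / 2 ≤ σ * deriv g y := fun y hy => by
    have k1 := hu x y hy
    have k2 : |σ * deriv g x - σ * deriv g y| < m / 4 := by
      rwa [← mul_sub, abs_mul, hσ, one_mul]
    have := abs_lt.1 k2
    linarith [this.2]
  have hd' : ∀ y, HasDerivAt (fun y => σ * g y) (σ * deriv g y) y := fun y => (hd y).const_mul σ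
  have hgrow : ∀ a b, x - η / 2 ≤ a → a ≤ b → b ≤ x + η / 2 →
      m / 2 * (b - a) ≤ σ * g b - σ * g a := fun a b ha hab hb => by
    refine Convex.mul_sub_le_image_sub_of_le_deriv (D := Set.Icc a b) (f := fun y => σ * g y)
      (convex_Icc _ _) (fun y _ => (hd' y).continuousAt.continuousWithinAt)
      (fun y _ => (hd' y).differentiableAt.differentiableWithinAt) (fun y hy => ?_) a
      (Set.left_mem_Icc.2 hab) b (Set.right_mem_Icc.2 hab) hab
    rw [(hd' y).deriv]
    rw [interior_Icc] at hy
    exact hslope y (by rw [abs_lt]; constructor <;> linarith [hy.1, hy.2])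
  have h5 : |σ * g x| < m * η / 8 := by rwa [abs_mul, hσ, one_mul]
  rw [abs_lt] at h5
  obtain ⟨y, hy, hy0⟩ : ∃ y ∈ Set.Icc (x - η / 2) (x + η / 2), σ * g y = 0 := by
    have k1 := hgrow (x - η / 2) x le_rfl (by linarith) (by linarith)
    have k2 := hgrow x (x + η / 2) (by linarith) (by linarith) le_rfl
    have k3 : 0 < m * η := by positivity
    exact intermediate_value_Icc (f := fun y => σ * g y) (by linarith)
      (continuous_const.mul hg.continuous).continuousOn
      ⟨by nlinarith, by nlinarith⟩
  have hgy : g y = 0 := (mul_eq_zero.1 hy0).resolve_left hσ0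
  have hrolle : ∀ a b, x - η / 2 ≤ a → a < b → b ≤ x + η / 2 → g₁ a = 0 → g₁ b ≠ 0 :=
    fun a b ha hab hb h0 h0' => by
      obtain ⟨z, hz, hz0⟩ := exists_deriv_eq_zero hab hg₁.continuous.continuousOn (h0.trans h0'.symm)
      have k1 := (hclose z).2
      rw [hz0, sub_zero] at k1
      have k2 := hslope z (by rw [abs_lt]; constructor <;> linarith [hz.1, hz.2])
      have k3 : σ * deriv g z ≤ |deriv g z| := by
        refine (le_abs_self _).trans ?_
        rw [abs_mul, hσ, one_mul]
      linarith [min_le_left (m / 4) (m * η / 8)]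
  rcases lt_trichotomy x y with h | h | h
  · exact absurd (hz y hgy) (hrolle x y (by linarith) h hy.2 hx)
  · rwa [h]
  · exact absurd hx (hrolle y x hy.1 h (by linarith) (hz y hgy))

/-- A diffeomorphism which is affine near its periodic points, all of them hyperbolic; those whose
multiplier is that of the base point `p 0` belong to its orbit. -/
structure IsLinearized (d : ℤ) (F : ℝ → ℝ) (q : ℕ) (M : ℤ) (N : ℕ) (p : ℤ → ℝ) (s : ℤ → ℝ)
    (δ : ℝ) : Prop where
  isLift : IsCircleLift ∞ d F
  mark : IsMarking N p
  based : IsBased d q M (p 0) F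
  δ_pos : 0 < δ
  near : ∀ i u, |u| < δ → F (p i + u) = F (p i) + s i * u
  periodic_iff : ∀ x, F^[q] x = x + M ↔ x ∈ Set.range p
  multiplier_ne : ∀ i, deriv F^[q] (p i) ≠ 1
  base : ∀ i, deriv F^[q] (p i) = deriv F^[q] (p 0) → ∃ (j : ℕ) (n : ℤ), F^[j] (p 0) = p i + n

/-- The set of periodic points is invariant. -/
theorem IsBased.periodic_map_iff {d : ℤ} {F : ℝ → ℝ} {q : ℕ} {M : ℤ} {α : ℝ}
    (B : IsBased d q M α F) (L : IsCircleLift 1 d F) (x : ℝ) :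
    F^[q] (F x) = F x + M ↔ F^[q] x = x + M := by
  have h : F (x + M) = F x + M := by rw [L.map_add_int, ← Int.cast_mul, B.deg_mul]
  rw [← h, ← iterate_succ_apply, iterate_succ_apply', L.injective.eq_iff]

/-- A diffeomorphism with hyperbolic periodic points is `C¹`-close to one which is affine near them.
The slopes are multiplied along the base orbit by a factor close to one, which separates its
multiplier from those of the other orbits. -/
theorem IsBased.exists_linearized {d : ℤ} {F : ℝ → ℝ} {q : ℕ} {M : ℤ} {α : ℝ}
    (B : IsBased d q M α F) (L : IsCircleLift ∞ d F)
    (hyp : ∀ x, F^[q] x = x + M → deriv F^[q] x ≠ 1) {ε : ℝ} (hε : 0 < ε) :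
    ∃ G N p s δ, IsLinearized d G q M N p s δ ∧ C1Close ε F G := by
  have Lq := L.one.iterate le_rfl q
  rw [B.deg_pow] at Lq
  set g : ℝ → ℝ := fun x => F^[q] x - x - M with hg
  have hgs : ContDiff ℝ 1 g := (Lq.contDiff.sub contDiff_id).sub contDiff_const
  have hderiv : ∀ G : ℝ → ℝ, Differentiable ℝ G → ∀ x, HasDerivAt (fun x => G x - x - M)
      (deriv G x - 1) x := fun G hG x =>
    ((hG x).hasDerivAt.sub (hasDerivAt_id x)).sub_const _
  have hg0 : ∀ x, g x = 0 ↔ F^[q] x = x + M := fun x => by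
    simp only [hg]; constructor <;> intro h <;> linarith
  have hg1 : ∀ x, g (x + 1) = g x := fun x => by
    simp only [hg, Lq.map_add_one]; push_cast; ring
  have hgd : ∀ x, g x = 0 → deriv g x ≠ 0 := fun x hx h => by
    rw [hg, (hderiv _ Lq.differentiable x).deriv] at h
    exact hyp x ((hg0 x).1 hx) (by linarith)
  -- the periodic points are isolated
  obtain ⟨N, p, mk, hp, hp0⟩ := IsMarking.exists_of_locallyFinite (S := {x | g x = 0}) (α := α)
    (fun x => by simp only [Set.mem_ofPred_eq, hg1])
    (fun a b => by
      by_contra hinf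
      obtain ⟨x, -, hx⟩ := Set.Infinite.exists_accPt_of_subset_isCompact hinf isCompact_Icc
        Set.inter_subset_right
      rw [accPt_iff_frequently] at hx
      have hev : ∀ᶠ y in 𝓝 x, y ≠ x → g y ≠ 0 := by
        refine eventually_nhdsWithin_iff (s := {x}ᶜ).1 ?_
        by_cases h : g x = 0
        · have := (hderiv _ Lq.differentiable x).eventually_ne (c := 0) (by
            have := hyp x ((hg0 x).1 h)
            exact sub_ne_zero.2 this)
          exact this
        · exact (hgs.continuous.continuousAt.eventually_ne h).filter_mono nhdsWithin_le_nhds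
      obtain ⟨y, hy1, hy2⟩ := (hx.and_eventually hev).exists
      exact hy2 hy1.1 hy1.2.1)
    ((hg0 α).2 B.iterate_eq)
  subst hp0
  have hmem : ∀ x, x ∈ Set.range p ↔ F^[q] x = x + M := fun x => by rw [hp, ← hg0]; rfl
  have hmap : ∀ x, F x ∈ Set.range p ↔ x ∈ Set.range p := fun x => by
    rw [hmem, hmem, B.periodic_map_iff L.one]
  have hiter : ∀ i j, F^[j] (p i) ∈ Set.range p := fun i j => by
    induction j with
    | zero => exact ⟨i, rfl⟩
    | succ j ih => rw [iterate_succ_apply', hmap]; exact ih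
  -- the orbit of the base point
  let O : ℝ → Prop := fun x => ∃ (j : ℕ) (n : ℤ), F^[j] (p 0) = x + n
  have hO1 : ∀ (x : ℝ) (n : ℤ), O (x + n) ↔ O x := fun x n => by
    constructor
    · rintro ⟨j, k, h⟩; exact ⟨j, n + k, by rw [h]; push_cast; ring⟩
    · rintro ⟨j, k, h⟩; exact ⟨j, k - n, by rw [h]; push_cast; ring⟩
  have hOF : ∀ x, O x → O (F x) := by
    rintro x ⟨j, n, h⟩
    exact ⟨j + 1, d * n, by rw [iterate_succ_apply', h, L.map_add_int]; push_cast; ring⟩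
  have hOit : ∀ i j, O (F^[j] (p i)) ↔ O (p i) := fun i j => by
    have hup : ∀ j x, O x → O (F^[j] x) := fun j x hx => by
      induction j with
      | zero => exact hx
      | succ j ih => rw [iterate_succ_apply']; exact hOF _ ih
    refine ⟨fun h => ?_, hup j _⟩
    have hback : ∀ k, O (F^[q * k] (p i)) → O (p i) := fun k => by
      induction k with
      | zero => exact fun h => h
      | succ k ih =>
        intro h
        refine ih ?_
        rw [mul_add, mul_one, iterate_add_apply, (hmem _).1 ⟨i, rfl⟩,
          (L.iterate (by simp) (q * k)).map_add_int, ← Int.cast_mul, hO1] at h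
        exact h
    refine hback j ?_
    have hjq : j ≤ q * j := Nat.le_mul_of_pos_left _ B.q_pos
    have := hup (q * j - j) _ h
    rwa [← iterate_add_apply, Nat.sub_add_cancel hjq] at this
  obtain ⟨ε₁, hε₁, hpers⟩ := exists_persistence hgs hg1 hgd
  obtain ⟨ε₂, hε₂, hit⟩ := L.one.close_iterate q hε₁
  obtain ⟨ε', hε', haff⟩ := L.exists_affine_near mk (show 0 < min ε ε₂ by positivity)
  obtain ⟨b, hb, hbF⟩ := L.one.exists_deriv_bound
  have Λper : ∀ i, deriv F^[q] (p (i + N)) = deriv F^[q] (p i) := fun i => by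
    rw [mk.map_add, Lq.deriv_add_one]
  -- a factor close to one which separates the multiplier of the base point from all others
  obtain ⟨κ, hκ1, hκ2, hκ3, hκ4⟩ : ∃ κ : ℝ, 0 < κ ∧ |κ - 1| * b < ε' ∧
      κ ^ q * deriv F^[q] (p 0) ≠ 1 ∧
      ∀ i, deriv F^[q] (p i) ≠ κ ^ q * deriv F^[q] (p 0) := by
    have hA := Lq.deriv_ne (p 0)
    have hfin : ∀ c : ℝ, {κ : ℝ | 0 < κ ∧ κ ^ q * deriv F^[q] (p 0) = c}.Finite := fun c => by
      refine Set.Subsingleton.finite fun x hx y hy => ?_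
      have := mul_right_cancel₀ hA (hx.2.trans hy.2.symm)
      exact (pow_left_inj₀ hx.1.le hy.1.le B.q_pos.ne').1 this
    have hfin' : (⋃ i ∈ Finset.range N,
        {κ : ℝ | 0 < κ ∧ κ ^ q * deriv F^[q] (p 0) = deriv F^[q] (p (i : ℤ))}).Finite :=
      (Finset.range N).finite_toSet.biUnion fun i _ => hfin _
    have hI : (Set.Ioo (1 : ℝ) (1 + ε' / b)).Infinite :=
      Set.Ioo_infinite (by have : 0 < ε' / b := by positivity
                           linarith)
    obtain ⟨κ, hκ, hκn⟩ := hI.exists_notMem_finite ((hfin 1).union hfin')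
    have h0 : 0 < κ := one_pos.trans hκ.1
    refine ⟨κ, h0, ?_, fun h => hκn (Or.inl ⟨h0, h⟩), fun i h => hκn (Or.inr ?_)⟩
    · rw [abs_of_pos (by linarith [hκ.1]), ← lt_div_iff₀ hb]; linarith [hκ.2]
    · have hN : (0 : ℤ) < N := by exact_mod_cast mk.pos
      have h1 := Int.emod_nonneg i hN.ne'
      have h2 := Int.emod_lt_of_pos i hN
      refine Set.mem_biUnion (x := (i % N).toNat) (by simp; omega) ⟨h0, ?_⟩
      have h3 : Periodic (fun i => deriv F^[q] (p i)) (N : ℤ) := Λper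
      have h4 := h3.sub_int_mul_eq (i / N) (x := i)
      have h5 : i - (i / (N : ℤ) : ℤ) * N = i % N := by
        have := Int.emod_add_mul_ediv i N; linarith
      rw [Int.cast_id, h5] at h4
      rw [Int.toNat_of_nonneg h1, ← h, h4]
  classical
  set s : ℤ → ℝ := fun i => if O (p i) then κ * deriv F (p i) else deriv F (p i) with hs
  have hs1 : ∀ i, s (i + N) = s i := fun i => by
    have := hO1 (p i) 1
    push_cast at this
    simp only [hs, mk.map_add, L.deriv_add_one, this]
  obtain ⟨G, LG, hclose, δ, hδ, hG⟩ := haff s hs1 (fun i => by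
    simp only [hs]
    split_ifs
    · rw [← sub_one_mul, abs_mul]
      exact (by gcongr; exact hbF _ : _ ≤ |κ - 1| * b).trans_lt hκ2
    · simpa using hε')
  have hGp : ∀ i, G (p i) = F (p i) ∧ deriv G (p i) = s i := fun i => by
    refine ⟨by simpa using hG i 0 (by simpa using hδ), ?_⟩
    have hev : G =ᶠ[𝓝 (p i)] fun y => F (p i) + s i * (y - p i) := by
      filter_upwards [Metric.ball_mem_nhds (p i) hδ] with y hy
      have := hG i (y - p i) (by rwa [Metric.mem_ball, Real.dist_eq] at hy)
      rwa [add_sub_cancel] at this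
    have hd : HasDerivAt (fun y => F (p i) + s i * (y - p i)) (s i * 1) (p i) :=
      (((hasDerivAt_id _).sub_const _).const_mul _).const_add _
    rw [hev.deriv_eq, hd.deriv, mul_one]
  have hGF : ∀ x ∈ Set.range p, G x = F x := by rintro _ ⟨i, rfl⟩; exact (hGp i).1
  have hGj : ∀ j i, G^[j] (p i) = F^[j] (p i) := fun j i => by
    induction j with
    | zero => rfl
    | succ j ih => rw [iterate_succ_apply', iterate_succ_apply', ih, hGF _ (hiter i j)]
  have hmult : ∀ i, (O (p i) → deriv G^[q] (p i) = κ ^ q * deriv F^[q] (p 0)) ∧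
      (¬ O (p i) → deriv G^[q] (p i) = deriv F^[q] (p i)) := fun i => by
    have hder : ∀ j, deriv G (F^[j] (p i)) =
        if O (p i) then κ * deriv F (F^[j] (p i)) else deriv F (F^[j] (p i)) := fun j => by
      obtain ⟨k, hk⟩ := hiter i j
      rw [← hk, (hGp k).2]
      simp only [hs]
      rw [hk, hOit]
    rw [LG.one.deriv_iterate, Finset.prod_congr rfl fun j _ => by rw [hGj, hder]]
    constructor
    · intro hO
      simp only [if_pos hO, Finset.prod_mul_distrib, Finset.prod_const, Finset.card_range]
      rw [← L.one.deriv_iterate]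
      obtain ⟨j, n, h⟩ := hO
      have := L.one.deriv_iterate_orbit B.iterate_eq j (-n)
      rw [h] at this
      rw [← this]; congr 2; push_cast; ring
    · intro hO
      simp only [if_neg hO]
      rw [← L.one.deriv_iterate]
  have BG := (B.congr fun j => hGF _ (hiter 0 j)).1
  have hGq := hit G LG.one.differentiable (hclose.mono (min_le_right _ _))
  have hGqd : Differentiable ℝ G^[q] := (LG.one.iterate le_rfl q).differentiable
  refine ⟨G, N, p, s, δ, ⟨LG, mk, BG, hδ, fun i u hu => by rw [hG i u hu, (hGp i).1],
    fun x => ?_, fun i => ?_, fun i hi => ?_⟩, hclose.mono (min_le_left _ _)⟩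
  · constructor
    · intro hx
      rw [hp]
      refine hpers (fun x => G^[q] x - x - M)
        (fun x => (hderiv _ hGqd x).differentiableAt)
        (fun y => ?_) (fun y hy => ?_) x (by simp only [hx]; ring)
      · rw [hg, (hderiv _ Lq.differentiable y).deriv, (hderiv _ hGqd y).deriv]
        have := hGq y
        simpa using this
      · have : y ∈ Set.range p := hp ▸ hy
        obtain ⟨i, rfl⟩ := this
        simp only [hGj]
        exact hy
    · rintro ⟨i, rfl⟩
      rw [hGj]; exact (hmem _).1 ⟨i, rfl⟩
  · by_cases hO : O (p i)
    · rw [(hmult i).1 hO]; exact hκ3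
    · rw [(hmult i).2 hO]; exact hyp _ ((hmem _).1 ⟨i, rfl⟩)
  · by_cases hO : O (p i)
    · obtain ⟨j, n, h⟩ := hO
      exact ⟨j, n, by rw [hGj, h]⟩
    · rw [(hmult i).2 hO, (hmult 0).1 ⟨0, 0, by simp⟩] at hi
      exact absurd hi (hκ4 i)

/-! ### Time functions of a hyperbolic diffeomorphism -/

/-- Mutually inverse diffeomorphisms `K` and `G` whose fixed points are the points `p i`, near which
they are linear with alternately expanding and contracting exponents `lam i`. -/
structure IsHyperbolicPair (N : ℕ) (p : ℤ → ℝ) (lam : ℤ → ℝ) (δ : ℝ) (K G : ℝ → ℝ) : Prop where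
  mark : IsMarking N p
  lam_add : ∀ i, lam (i + N) = lam i
  alternate : ∀ i, lam i * lam (i + 1) < 0
  isLift : IsCircleLift ∞ 1 K
  isLift_inv : IsCircleLift ∞ 1 G
  left : LeftInverse G K
  right : RightInverse G K
  fixed_iff : ∀ x, K x = x ↔ x ∈ Set.range p
  δ_pos : 0 < δ
  gap : ∀ i, p i + 2 * δ ≤ p (i + 1)
  near : ∀ i u, |u| < δ → K (p i + u) = p i + Real.exp (lam i) * u
  near_inv : ∀ i u, |u| < δ → G (p i + u) = p i + Real.exp (-lam i) * u

/-- A smooth function off the points `p i` which increases by one along the orbits of `K`, and which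
is logarithmic near the repelling fixed points. -/
structure IsExpandingTime (N : ℕ) (p : ℤ → ℝ) (lam : ℤ → ℝ) (c : ℤ → ℤ → ℝ) (δ : ℝ) (K : ℝ → ℝ)
    (H : ℝ → ℝ) : Prop where
  map_add_one : ∀ x, H (x + 1) = H x
  map_apply : ∀ x ∉ Set.range p, H (K x) = H x + 1
  near : ∀ (i e : ℤ) (u : ℝ), e = 1 ∨ e = -1 → 0 < lam i → 0 < u → u < δ →
    H (p i + e * u) = Real.log u / lam i + c i e
  smooth : ∀ x ∉ Set.range p, ContDiffAt ℝ ∞ H x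
  deriv_ne : ∀ x ∉ Set.range p, deriv H x ≠ 0

theorem IsMarking.notMem_side {N : ℕ} {p : ℤ → ℝ} (mk : IsMarking N p) {i e : ℤ} {u : ℝ}
    (he : e = 1 ∨ e = -1) (h0 : 0 < u) (h1 : u < e * (p (i + e) - p i)) :
    p i + e * u ∉ Set.range p := by
  rcases he with rfl | rfl
  · refine mk.notMem_range (i := i) ⟨?_, ?_⟩ <;> push_cast at h1 ⊢ <;> linarith
  · refine mk.notMem_range (i := i + -1) ⟨?_, ?_⟩
    · push_cast at h1 ⊢; linarith
    · rw [neg_add_cancel_right]; push_cast; linarith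

/-- The iterates of a point under a continuous map of a half-line moving all points towards its end
converge to this end. -/
theorem exists_iterate_lt {D : ℝ → ℝ} (hD : Continuous D) {L : ℝ}
    (h : ∀ u ∈ Set.Ioo 0 L, 0 < D u ∧ D u < u) {u : ℝ} (hu : u ∈ Set.Ioo 0 L) {ρ : ℝ}
    (hρ : 0 < ρ) : ∃ n, 0 < D^[n] u ∧ D^[n] u < ρ := by
  by_contra! hcon
  have hmem : ∀ n, 0 < D^[n] u ∧ D^[n] u ≤ u := fun n => by
    induction n with
    | zero => exact ⟨hu.1, le_rfl⟩
    | succ n ih =>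
      rw [iterate_succ_apply']
      have := h _ ⟨ih.1, ih.2.trans_lt hu.2⟩
      exact ⟨this.1, this.2.le.trans ih.2⟩
  have hρu := hcon 0 hu.1
  obtain ⟨v, hv, hmin⟩ := (isCompact_Icc (a := ρ) (b := u)).exists_isMinOn ⟨u, hρu, le_rfl⟩
    (f := fun u => u - D u) (continuous_id.sub hD).continuousOn
  have hm : 0 < v - D v := sub_pos.2 (h v ⟨hρ.trans_le hv.1, hv.2.trans_lt hu.2⟩).2
  have hdec : ∀ n : ℕ, D^[n] u ≤ u - n * (v - D v) := fun n => by
    induction n with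
    | zero => simp
    | succ n ih =>
      have h1 : v - D v ≤ D^[n] u - D (D^[n] u) := hmin ⟨hcon n (hmem n).1, (hmem n).2⟩
      rw [iterate_succ_apply']; push_cast; linarith
  obtain ⟨n, hn⟩ := exists_nat_gt (u / (v - D v))
  rw [div_lt_iff₀ hm] at hn
  linarith [hdec n, (hmem n).1]

/-- `v` is a possible value at `x` of the expanding time: it is read off at an iterate of `x` by the
inverse map which is close to a repelling fixed point. -/
def IsTimeValue (p : ℤ → ℝ) (lam : ℤ → ℝ) (c : ℤ → ℤ → ℝ) (δ : ℝ) (G : ℝ → ℝ) (x v : ℝ) : Prop :=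
  ∃ (n : ℕ) (i e : ℤ) (u : ℝ), (e = 1 ∨ e = -1) ∧ 0 < lam i ∧ 0 < u ∧ u < δ ∧
    G^[n] x = p i + e * u ∧ v = Real.log u / lam i + c i e + n

namespace IsHyperbolicPair

variable {N : ℕ} {p : ℤ → ℝ} {lam : ℤ → ℝ} {c : ℤ → ℤ → ℝ} {δ : ℝ} {K G H H' : ℝ → ℝ}

theorem symm (P : IsHyperbolicPair N p lam δ K G) : IsHyperbolicPair N p (fun i => -lam i) δ G K :=
  ⟨P.mark, fun i => by rw [P.lam_add], fun i => by rw [neg_mul_neg]; exact P.alternate i,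
    P.isLift_inv, P.isLift, P.right, P.left, fun x => by
      rw [← P.fixed_iff]
      constructor <;> intro h
      · conv_lhs => rw [← h]
        exact P.right x
      · conv_lhs => rw [← h]
        exact P.left x,
    P.δ_pos, P.gap, P.near_inv, fun i u hu => by rw [neg_neg]; exact P.near i u hu⟩

theorem fixed (P : IsHyperbolicPair N p lam δ K G) (i : ℤ) : K (p i) = p i :=
  (P.fixed_iff _).2 ⟨i, rfl⟩

theorem mapsTo (P : IsHyperbolicPair N p lam δ K G) {i : ℤ} {x : ℝ}
    (hx : x ∈ Set.Ioo (p i) (p (i + 1))) (n : ℕ) : K^[n] x ∈ Set.Ioo (p i) (p (i + 1)) := by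
  induction n with
  | zero => exact hx
  | succ n ih =>
    rw [iterate_succ_apply']
    have h1 := P.isLift.strictMono ih.1
    have h2 := P.isLift.strictMono ih.2
    rw [P.fixed] at h1 h2
    exact ⟨h1, h2⟩

theorem notMem_iterate (P : IsHyperbolicPair N p lam δ K G) {x : ℝ} (hx : x ∉ Set.range p) (n : ℕ) :
    K^[n] x ∉ Set.range p := by
  obtain ⟨i, hi⟩ := P.mark.exists_mem_Ioo hx
  exact P.mark.notMem_range (P.mapsTo hi n)

theorem lam_ne (P : IsHyperbolicPair N p lam δ K G) (i : ℤ) : lam i ≠ 0 := fun h => by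
  have := P.alternate i
  rw [h, zero_mul] at this
  exact lt_irrefl _ this

theorem lt_gap (P : IsHyperbolicPair N p lam δ K G) (i : ℤ) {e : ℤ} (he : e = 1 ∨ e = -1) :
    2 * δ ≤ e * (p (i + e) - p i) := by
  rcases he with rfl | rfl
  · have := P.gap i
    push_cast; linarith
  · have := P.gap (i + -1)
    rw [neg_add_cancel_right] at this
    push_cast; linarith

/-- Every point off the fixed points lies on one side of a repelling fixed point. -/
theorem exists_side (P : IsHyperbolicPair N p lam δ K G) {x : ℝ} (hx : x ∉ Set.range p) :
    ∃ (i e : ℤ) (u : ℝ), (e = 1 ∨ e = -1) ∧ 0 < lam i ∧ 0 < u ∧ u < e * (p (i + e) - p i) ∧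
      x = p i + e * u := by
  obtain ⟨i, h1, h2⟩ := P.mark.exists_mem_Ioo hx
  rcases lt_or_gt_of_ne (P.lam_ne i) with h | h
  · have h3 := P.alternate i
    have h4 : 0 < lam (i + 1) := by
      by_contra hn; push Not at hn; nlinarith
    refine ⟨i + 1, -1, p (i + 1) - x, Or.inr rfl, h4, by linarith, ?_, by push_cast; ring⟩
    rw [add_neg_cancel_right]; push_cast; linarith
  · exact ⟨i, 1, x - p i, Or.inl rfl, h, by linarith, by push_cast; linarith, by push_cast; ring⟩

/-- All points off `p` converge to the repelling points under the inverse `G`. -/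
theorem exists_iterate_near (P : IsHyperbolicPair N p lam δ K G) {x : ℝ} (hx : x ∉ Set.range p)
    {ρ : ℝ} (hρ : 0 < ρ) : ∃ (n : ℕ) (i e : ℤ) (u : ℝ), (e = 1 ∨ e = -1) ∧ 0 < lam i ∧ 0 < u ∧
      u < ρ ∧ G^[n] x = p i + e * u := by
  obtain ⟨i, e, u, he, hl, h0, h1, rfl⟩ := P.exists_side hx
  have hee : (e : ℝ) * e = 1 := by rcases he with rfl | rfl <;> norm_num
  set D : ℝ → ℝ := fun u => e * (G (p i + e * u) - p i) with hD
  have hDc : Continuous D := by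
    have := P.isLift_inv.continuous
    fun_prop
  have hGm := P.isLift_inv.strictMono
  have hne : ∀ v ∈ Set.Ioo 0 (e * (p (i + e) - p i)), D v ≠ v := fun v hv h => by
    refine P.mark.notMem_side he hv.1 hv.2 ((P.symm.fixed_iff _).1 ?_)
    have : e * D v = e * v := by rw [h]
    simp only [hD, ← mul_assoc, hee, one_mul] at this
    linarith
  have hpos : ∀ v, 0 < v → 0 < D v := fun v hv => by
    have hf := P.symm.fixed i
    rcases he with rfl | rfl
    · have := hGm (show p i < p i + v by linarith)
      simp only [hD]; push_cast; rw [one_mul, one_mul]; linarith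
    · have := hGm (show p i - v < p i by linarith)
      simp only [hD]; push_cast; rw [neg_one_mul, neg_one_mul, ← sub_eq_add_neg]; linarith
  have hlt : ∀ v ∈ Set.Ioo 0 (e * (p (i + e) - p i)), D v < v := fun v hv => by
    by_contra! hcon
    have hδ := P.δ_pos
    have h2 : D (δ / 2) < δ / 2 := by
      simp only [hD]
      rw [P.near_inv i _ (by
        rw [abs_mul, abs_of_pos (half_pos hδ)]
        rcases he with rfl | rfl <;> norm_num <;> linarith), add_sub_cancel_left,
        show (e : ℝ) * (Real.exp (-lam i) * (e * (δ / 2))) = e * e * (Real.exp (-lam i) * (δ / 2))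
          by ring, hee, one_mul]
      have : Real.exp (-lam i) < 1 := by rw [Real.exp_lt_one_iff]; linarith
      nlinarith
    have h3 : δ / 2 ∈ Set.Ioo 0 (e * (p (i + e) - p i)) :=
      ⟨by linarith, by linarith [P.lt_gap i he]⟩
    obtain ⟨w, hw, hw0⟩ := isPreconnected_Ioo.intermediate_value₂ h3 hv hDc.continuousOn
      continuousOn_id h2.le hcon
    exact hne w hw hw0
  obtain ⟨n, hn0, hn1⟩ := exists_iterate_lt hDc (fun v hv => ⟨hpos v hv.1, hlt v hv⟩) ⟨h0, h1⟩ hρ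
  refine ⟨n, i, e, D^[n] u, he, hl, hn0, hn1, ?_⟩
  clear hn0 hn1
  induction n with
  | zero => rfl
  | succ n ih =>
    rw [iterate_succ_apply', iterate_succ_apply', ih]
    simp only [hD, ← mul_assoc, hee, one_mul, add_sub_cancel]

theorem iterate_inv_near (P : IsHyperbolicPair N p lam δ K G) {i e : ℤ} (he : e = 1 ∨ e = -1)
    (hl : 0 < lam i) {u : ℝ} (h0 : 0 < u) (h1 : u < δ) (k : ℕ) :
    G^[k] (p i + e * u) = p i + e * (u * Real.exp (-(k * lam i))) ∧
      u * Real.exp (-(k * lam i)) ≤ u := by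
  have hle : ∀ k : ℕ, u * Real.exp (-(k * lam i)) ≤ u := fun k => by
    have : Real.exp (-(k * lam i)) ≤ 1 := by rw [Real.exp_le_one_iff]; nlinarith [k.cast_nonneg (α := ℝ)]
    nlinarith
  refine ⟨?_, hle k⟩
  induction k with
  | zero => simp
  | succ k ih =>
    rw [iterate_succ_apply', ih, P.near_inv]
    · rw [show -(((k + 1 : ℕ) : ℝ) * lam i) = -lam i + -(k * lam i) by push_cast; ring, Real.exp_add]
      ring
    · rw [abs_mul, abs_of_pos (show 0 < u * Real.exp (-(k * lam i)) by positivity)]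
      have := hle k
      rcases he with rfl | rfl <;> norm_num <;> linarith

theorem timeValue_exists (P : IsHyperbolicPair N p lam δ K G) {x : ℝ} (hx : x ∉ Set.range p) :
    ∃ v, IsTimeValue p lam c δ G x v := by
  obtain ⟨n, i, e, u, he, hl, h0, h1, h⟩ := P.exists_iterate_near hx P.δ_pos
  exact ⟨_, n, i, e, u, he, hl, h0, h1, h, rfl⟩

/-- The value does not depend on the iterate, because `G` advances the logarithmic time by `-1`. -/
theorem timeValue_unique (P : IsHyperbolicPair N p lam δ K G) {x v v' : ℝ}
    (h : IsTimeValue p lam c δ G x v) (h' : IsTimeValue p lam c δ G x v') : v = v' := by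
  obtain ⟨n, i, e, u, he, hl, h0, h1, hx, rfl⟩ := h
  obtain ⟨n', i', e', u', he', hl', h0', h1', hx', rfl⟩ := h'
  wlog hn : n ≤ n' generalizing n i e u n' i' e' u'
  · exact (this n' i' e' u' he' hl' h0' h1' hx' n i e u he hl h0 h1 hx (by omega)).symm
  obtain ⟨k, rfl⟩ := Nat.exists_eq_add_of_le' hn
  obtain ⟨hk, hku⟩ := P.iterate_inv_near he hl h0 h1 k
  rw [iterate_add_apply, hx, hk] at hx'
  have hpos : 0 < u * Real.exp (-(k * lam i)) := by positivity
  have habs : ∀ e : ℤ, e = 1 ∨ e = -1 → ∀ (i : ℤ) (w : ℝ), 0 < w → |p i + e * w - p i| = w :=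
    fun e he i w hw => by
      rw [add_sub_cancel_left, abs_mul, abs_of_pos hw]
      rcases he with rfl | rfl <;> norm_num
  have hi : i = i' := by
    refine P.mark.index_eq_of_close P.gap (x := p i' + e' * u') ?_ ?_
    · rw [← hx', habs e he i _ hpos]; linarith
    · rw [habs e' he' i' _ h0']; linarith
  subst hi
  have hu : u * Real.exp (-(k * lam i)) = u' := by
    rw [← habs e he i _ hpos, hx', habs e' he' i _ h0']
  subst hu
  have hee : e = e' := by
    have h2 := mul_right_cancel₀ hpos.ne' (add_left_cancel hx')
    exact_mod_cast h2
  subst hee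
  rw [Real.log_mul h0.ne' (Real.exp_pos _).ne', Real.log_exp]
  push_cast; field_simp; ring

/-- The logarithmic time at the repelling points extends to the whole line by iterating `G`. -/
theorem exists_time (P : IsHyperbolicPair N p lam δ K G) (hc : ∀ i e, c (i + N) e = c i e) :
    ∃ H, IsExpandingTime N p lam c δ K H := by
  classical
  set H : ℝ → ℝ := fun x => if h : ∃ v, IsTimeValue p lam c δ G x v then h.choose else 0 with hH
  have hHv : ∀ x v, IsTimeValue p lam c δ G x v → H x = v := fun x v h => by
    have hex : ∃ v, IsTimeValue p lam c δ G x v := ⟨v, h⟩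
    simp only [hH, dif_pos hex]
    exact P.timeValue_unique hex.choose_spec h
  have hloc : ∀ x ∉ Set.range p, ContDiffAt ℝ ∞ H x ∧ deriv H x ≠ 0 := fun x hx => by
    obtain ⟨n, i, e, u, he, hl, h0, h1, h⟩ := P.exists_iterate_near hx P.δ_pos
    have hee : (e : ℝ) * e = 1 := by rcases he with rfl | rfl <;> norm_num
    have Ln := P.isLift_inv.iterate (by simp) n
    rw [one_pow] at Ln
    set U : ℝ → ℝ := fun y => e * (G^[n] y - p i) with hU
    have hUs : ContDiff ℝ ∞ U := contDiff_const.mul (Ln.contDiff.sub contDiff_const)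
    have hUx : U x = u := by simp only [hU, h, add_sub_cancel_left, ← mul_assoc, hee, one_mul]
    have hev : H =ᶠ[𝓝 x] fun y => Real.log (U y) / lam i + c i e + n := by
      filter_upwards [hUs.continuous.continuousAt.preimage_mem_nhds
        (Ioo_mem_nhds (hUx ▸ h0) (hUx ▸ h1))] with y hy
      refine hHv y _ ⟨n, i, e, U y, he, hl, hy.1, hy.2, ?_, rfl⟩
      simp only [hU, ← mul_assoc, hee, one_mul, add_sub_cancel]
    have hd : HasDerivAt (fun y => Real.log (U y) / lam i + c i e + n)
        (e * deriv G^[n] x / U x / lam i) x :=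
      (((((Ln.one.hasDerivAt x).sub_const (p i)).const_mul (e : ℝ)).log
        (hUx.symm ▸ h0.ne' : U x ≠ 0)).div_const _).add_const _ |>.add_const _
    refine ⟨ContDiffAt.congr_of_eventuallyEq ?_ hev, ?_⟩
    · exact (((hUs.contDiffAt.log (hUx ▸ h0.ne')).div_const _).add contDiffAt_const).add
        contDiffAt_const
    · rw [hev.deriv_eq, hd.deriv, hUx]
      have h2 := Ln.deriv_ne x
      have h3 : (e : ℝ) ≠ 0 := left_ne_zero_of_mul_eq_one hee
      have := h0.ne'
      have := hl.ne'
      positivity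
  refine ⟨H, fun x => ?_, fun x hx => ?_, fun i e u he hl h0 h1 => ?_, fun x hx => (hloc x hx).1,
    fun x hx => (hloc x hx).2⟩
  · have hiff : ∀ v, IsTimeValue p lam c δ G (x + 1) v ↔ IsTimeValue p lam c δ G x v := fun v => by
      have hG : ∀ n : ℕ, G^[n] (x + 1) = G^[n] x + 1 := fun n => by
        have := (P.isLift_inv.iterate (by simp) n).map_add_one x
        simpa using this
      constructor
      · rintro ⟨n, i, e, u, he, hl, h0, h1, h, rfl⟩
        have hm := P.mark.map_add (i - N)
        have hl' := P.lam_add (i - N)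
        have hc' := hc (i - N) e
        rw [sub_add_cancel] at hm hl' hc'
        rw [hG, hm] at h
        exact ⟨n, i - N, e, u, he, hl' ▸ hl, h0, h1, by linarith, by rw [← hl', ← hc']⟩
      · rintro ⟨n, i, e, u, he, hl, h0, h1, h, rfl⟩
        refine ⟨n, i + N, e, u, he, (P.lam_add i).symm ▸ hl, h0, h1, ?_, by rw [P.lam_add, hc]⟩
        rw [hG, h, P.mark.map_add]; ring
    by_cases h : ∃ v, IsTimeValue p lam c δ G x v
    · obtain ⟨v, hv⟩ := h
      rw [hHv x v hv, hHv _ v ((hiff v).2 hv)]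
    · have h' : ¬∃ v, IsTimeValue p lam c δ G (x + 1) v := by simpa only [hiff] using h
      simp only [hH, dif_neg h, dif_neg h']
  · obtain ⟨v, n, i, e, u, he, hl, h0, h1, h, hv⟩ := P.timeValue_exists (c := c) hx
    rw [hHv x v ⟨n, i, e, u, he, hl, h0, h1, h, hv⟩]
    refine hHv _ _ ⟨n + 1, i, e, u, he, hl, h0, h1, ?_, ?_⟩
    · rw [iterate_succ_apply, P.left, h]
    · rw [hv]; push_cast; ring
  · exact hHv _ _ ⟨0, i, e, u, he, hl, h0, h1, rfl, by simp⟩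

/-- An expanding time is determined by its germs at the repelling fixed points. -/
theorem eq_of_near (P : IsHyperbolicPair N p lam δ K G)
    (hH : ∀ x ∉ Set.range p, H (K x) = H x + 1) (hH' : ∀ x ∉ Set.range p, H' (K x) = H' x + 1)
    {ρ : ℝ} (hρ : 0 < ρ) (h : ∀ (i e : ℤ) (u : ℝ), e = 1 ∨ e = -1 → 0 < lam i → 0 < u → u < ρ →
      H (p i + e * u) = H' (p i + e * u)) {x : ℝ} (hx : x ∉ Set.range p) : H x = H' x := by
  have hit : ∀ H : ℝ → ℝ, (∀ x ∉ Set.range p, H (K x) = H x + 1) → ∀ n : ℕ,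
      H x = H (G^[n] x) + n := fun H hH n => by
    induction n with
    | zero => simp
    | succ n ih =>
      have := hH _ (P.symm.notMem_iterate hx (n + 1))
      rw [iterate_succ_apply', P.right] at this
      rw [ih, this, iterate_succ_apply']; push_cast; ring
  obtain ⟨n, i, e, u, he, hl, h0, h1, hn⟩ := P.exists_iterate_near hx hρ
  rw [hit H hH n, hit H' hH' n, hn, h i e u he hl h0 h1]

/-- An expanding time restricts to a chart of each interval. -/
theorem chart (P : IsHyperbolicPair N p lam δ K G) (T : IsExpandingTime N p lam c δ K H) :
    IsTimeChart N p H := by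
  refine ⟨P.mark, T.smooth, T.deriv_ne, fun i y => ?_⟩
  set x := (p i + p (i + 1)) / 2 with hx
  have hlt := P.mark.strictMono (show i < i + 1 by omega)
  have hxI : x ∈ Set.Ioo (p i) (p (i + 1)) := ⟨by linarith, by linarith⟩
  have hup : ∀ n : ℕ, H (K^[n] x) = H x + n := fun n => by
    induction n with
    | zero => simp
    | succ n ih =>
      rw [iterate_succ_apply', T.map_apply _ (P.mark.notMem_range (P.mapsTo hxI n)), ih]
      push_cast; ring
  have hdown : ∀ n : ℕ, H (G^[n] x) = H x - n := fun n => by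
    induction n with
    | zero => simp
    | succ n ih =>
      have := T.map_apply _ (P.mark.notMem_range (P.symm.mapsTo hxI (n + 1)))
      rw [iterate_succ_apply', P.right, ih] at this
      rw [iterate_succ_apply']; push_cast; linarith
  obtain ⟨n, hn⟩ := exists_nat_ge |y - H x|
  have := abs_le.1 hn
  refine isPreconnected_Ioo.intermediate_value (P.symm.mapsTo hxI n) (P.mapsTo hxI n)
    (fun z hz => (T.smooth z (P.mark.notMem_range hz)).continuousAt.continuousWithinAt) ⟨?_, ?_⟩
  · rw [hdown]; linarith [this.1]
  · rw [hup]; linarith [this.2]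

end IsHyperbolicPair

/-! ### Slow interpolation -/

theorem exists_smoothTransition_deriv_bound :
    ∃ C, 0 < C ∧ ∀ x, |deriv Real.smoothTransition x| ≤ C := by
  have hc : Continuous (deriv Real.smoothTransition) :=
    (Real.smoothTransition.contDiff (n := 1)).continuous_deriv le_rfl
  obtain ⟨C, hC⟩ := (isCompact_Icc (a := (0 : ℝ)) (b := 1)).exists_bound_of_continuousOn
    hc.continuousOn
  refine ⟨max C 1, by positivity, fun x => ?_⟩
  rcases lt_or_ge x 0 with h | h
  · have : Real.smoothTransition =ᶠ[𝓝 x] fun _ => 0 := by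
      filter_upwards [Iio_mem_nhds h] with y hy
      exact Real.smoothTransition.zero_of_nonpos (le_of_lt hy)
    rw [this.deriv_eq, deriv_const]; simp
  rcases le_or_gt x 1 with h' | h'
  · exact (hC x ⟨h, h'⟩).trans (le_max_left _ _)
  · have : Real.smoothTransition =ᶠ[𝓝 x] fun _ => 1 := by
      filter_upwards [Ioi_mem_nhds h'] with y hy
      exact Real.smoothTransition.one_of_one_le (le_of_lt hy)
    rw [this.deriv_eq, deriv_const]; simp

/-- An interpolation from `g`, for `t ≤ T - s`, to the identity, for `t ≥ T - s + 1 / δ`. -/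
noncomputable def interp (g : ℝ → ℝ) (T δ s t : ℝ) : ℝ :=
  t + (1 - Real.smoothTransition (δ * (t + s - T))) * (g t - t)

section Interp

variable {g : ℝ → ℝ} {T δ s t : ℝ}

theorem interp_of_le (hδ : 0 < δ) (h : t + s ≤ T) : interp g T δ s t = g t := by
  rw [interp, Real.smoothTransition.zero_of_nonpos (by nlinarith)]; ring

theorem interp_of_ge (hδ : 0 < δ) (h : T + 1 / δ ≤ t + s) : interp g T δ s t = t := by
  rw [interp, Real.smoothTransition.one_of_one_le]
  · ring
  · have : 1 / δ ≤ t + s - T := by linarith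
    rwa [div_le_iff₀' hδ] at this

theorem contDiff_interp (hg : ContDiff ℝ ∞ g) : ContDiff ℝ ∞ (interp g T δ s) := by
  have h : ContDiff ℝ ∞ fun t => Real.smoothTransition (δ * (t + s - T)) :=
    Real.smoothTransition.contDiff.comp (by fun_prop)
  exact contDiff_id.add ((contDiff_const.sub h).mul (hg.sub contDiff_id))

theorem hasDerivAt_interp (hg : Differentiable ℝ g) : HasDerivAt (interp g T δ s)
    (1 + (-(deriv Real.smoothTransition (δ * (t + s - T)) * δ) * (g t - t) +
      (1 - Real.smoothTransition (δ * (t + s - T))) * (deriv g t - 1))) t := by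
  have h1 : HasDerivAt (fun t => δ * (t + s - T)) δ t := by
    simpa using (((hasDerivAt_id t).add_const s).sub_const T).const_mul δ
  have h2 : HasDerivAt Real.smoothTransition (deriv Real.smoothTransition (δ * (t + s - T)))
      (δ * (t + s - T)) :=
    ((Real.smoothTransition.contDiff (n := 1)).differentiable one_ne_zero _).hasDerivAt
  have h3 : HasDerivAt (fun t => Real.smoothTransition (δ * (t + s - T)))
      (deriv Real.smoothTransition (δ * (t + s - T)) * δ) t :=
    HasDerivAt.comp (h₂ := Real.smoothTransition) t h2 h1
  exact (hasDerivAt_id t).add ((h3.const_sub 1).mul ((hg t).hasDerivAt.sub (hasDerivAt_id t)))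

end Interp

/-- If the interpolation between a lift `g` and the identity is slow enough, then its translates by
a bounded time differ by a `C¹`-small change of variables. -/
theorem exists_interp {g : ℝ → ℝ} (L : IsCircleLift ∞ 1 g) (T : ℝ) {a ε : ℝ} (ha0 : 0 ≤ a)
    (ha1 : a ≤ 1) (hε : 0 < ε) : ∃ δ₀, 0 < δ₀ ∧ ∀ δ, 0 < δ → δ < δ₀ →
      (∀ t, 0 < deriv (interp g T δ 0) t) ∧ ∃ e : ℝ → ℝ, ContDiff ℝ 1 e ∧ ∀ t,
        |e t| < ε ∧ |deriv e t| < ε ∧ interp g T δ a (t + e t) = interp g T δ 0 t ∧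
        (t + a ≤ T → e t = 0) ∧ (T + 1 / δ ≤ t → e t = 0) := by
  obtain ⟨C, hC, hCb⟩ := exists_smoothTransition_deriv_bound
  obtain ⟨W, hW, hWb⟩ := exists_bound_of_periodic (φ := fun t => g t - t)
    (L.continuous.sub continuous_id) (fun x => by rw [L.map_add_one]; push_cast; ring)
  obtain ⟨W', hW', hWb'⟩ := exists_bound_of_periodic (φ := fun t => deriv g t - 1)
    (L.one.continuous_deriv.sub continuous_const) (fun x => by rw [L.deriv_add_one])
  obtain ⟨m', hm', hmb⟩ := exists_pos_bound_of_periodic L.one.continuous_deriv L.deriv_add_one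
    fun x => by have := L.deriv_pos x; push_cast at this; linarith
  set m := min m' 1 with hm
  have hm0 : 0 < m := by positivity
  obtain ⟨ρ, hρ, hu⟩ := L.one.exists_deriv_uniform (show 0 < ε * m / 4 by positivity)
  set ν := min ε (min 1 ρ) with hν
  have hν0 : 0 < ν := by positivity
  have hνε : ν ≤ ε := min_le_left _ _
  have hν1 : ν ≤ 1 := (min_le_right _ _).trans (min_le_left _ _)
  have hνρ : ν ≤ ρ := (min_le_right _ _).trans (min_le_right _ _)
  set B := W + W' with hB
  refine ⟨m * ν / (20 * C * B), by positivity, fun δ hδ hδ₀ => ?_⟩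
  have hκ : 20 * (δ * C * B) < m * ν := by
    rw [lt_div_iff₀ (by positivity)] at hδ₀; linarith
  have hδC : 0 < δ * C := by positivity
  have hst : ∀ x, 0 ≤ Real.smoothTransition x ∧ Real.smoothTransition x ≤ 1 := fun x =>
    ⟨Real.smoothTransition.nonneg x, Real.smoothTransition.le_one x⟩
  have hstl : ∀ x y, |Real.smoothTransition x - Real.smoothTransition y| ≤ C * |x - y| :=
    fun x y => by
      have := Convex.norm_image_sub_le_of_norm_deriv_le (𝕜 := ℝ) (f := Real.smoothTransition)
        (s := Set.univ) (C := C) (x := y) (y := x)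
        (fun z _ => (Real.smoothTransition.contDiff (n := 1)).differentiable one_ne_zero z)
        (fun z _ => hCb z) convex_univ trivial trivial
      simpa using this
  -- the derivative of the cutoff contributes little
  have hsm : ∀ x t, |deriv Real.smoothTransition x * δ * (g t - t)| ≤ δ * C * B := fun x t => by
    rw [abs_mul, abs_mul, abs_of_pos hδ]
    calc _ ≤ C * δ * W := by gcongr; exacts [hCb x, hWb t]
      _ ≤ δ * C * B := by rw [mul_comm C δ]; gcongr; linarith
  have hder : ∀ s t, m / 2 ≤ deriv (interp g T δ s) t := fun s t => by
    rw [(hasDerivAt_interp L.one.differentiable).deriv]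
    have h1 := abs_le.1 (hsm (δ * (t + s - T)) t)
    have h2 := hst (δ * (t + s - T))
    set x := Real.smoothTransition (δ * (t + s - T))
    have h3 := (min_le_left m' 1).trans (hmb t)
    have h4 : m ≤ 1 := min_le_right _ _
    have h5 : m ≤ x * 1 + (1 - x) * deriv g t := by nlinarith
    nlinarith
  have hpos : ∀ s t, 0 < deriv (interp g T δ s) t := fun s t =>
    (by positivity : 0 < m / 2).trans_le (hder s t)
  refine ⟨hpos 0, ?_⟩
  have hclose : ∀ s t, |interp g T δ s t - t| ≤ W := fun s t => by
    rw [interp, add_sub_cancel_left, abs_mul]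
    have h2 := hst (δ * (t + s - T))
    calc _ ≤ 1 * W := by
          gcongr
          · rw [abs_le]; constructor <;> linarith [h2.1, h2.2]
          · exact hWb t
      _ = W := one_mul W
  have hsmooth : ∀ s, ContDiff ℝ ∞ (interp g T δ s) := fun s => contDiff_interp L.contDiff
  have hsurj : Surjective (interp g T δ a) := fun y =>
    mem_range_of_exists_le_of_exists_ge (hsmooth a).continuous
      ⟨y - W, by have := abs_le.1 (hclose a (y - W)); linarith [this.2]⟩
      ⟨y + W, by have := abs_le.1 (hclose a (y + W)); linarith [this.1]⟩
  obtain ⟨Ψ, hΨ, hΨl, hΨr⟩ := exists_inverse_of_deriv_pos (by simp) (hsmooth a) (hpos a) hsurj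
  set e : ℝ → ℝ := fun t => Ψ (interp g T δ 0 t) - t with he
  have hes : ContDiff ℝ ∞ e := (hΨ.comp (hsmooth 0)).sub contDiff_id
  have heq : ∀ t, interp g T δ a (t + e t) = interp g T δ 0 t := fun t => by
    simp only [he, add_sub_cancel]; exact hΨr _
  have hzero : ∀ t, interp g T δ a t = interp g T δ 0 t → e t = 0 := fun t h => by
    simp only [he, ← h, hΨl t, sub_self]
  have hηd : ∀ r r' : ℝ, |Real.smoothTransition (δ * (r + a - T)) -
      Real.smoothTransition (δ * (r' - T))| ≤ δ * C * (|r - r'| + 1) := fun r r' => by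
    refine (hstl _ _).trans ?_
    rw [← mul_sub, abs_mul, abs_of_pos hδ, show r + a - T - (r' - T) = r - r' + a by ring,
      ← mul_assoc, mul_comm C]
    gcongr
    refine (abs_add_le _ _).trans ?_
    gcongr
    rwa [abs_of_nonneg ha0]
  have hesmall : ∀ t, |e t| < ν := fun t => by
    have h1 : |interp g T δ a (t + e t) - interp g T δ a t| ≤ δ * C * W := by
      rw [heq, interp, interp, add_sub_add_left_eq_sub, ← sub_mul, abs_mul, add_zero,
        sub_sub_sub_cancel_left]
      have := hηd t t
      rw [sub_self, abs_zero, zero_add, mul_one] at this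
      gcongr
      exact hWb t
    have h2 : m / 2 * |e t| ≤ |interp g T δ a (t + e t) - interp g T δ a t| := by
      have hd := (hsmooth a).differentiable (by simp)
      have key : ∀ x y, x ≤ y → m / 2 * (y - x) ≤ interp g T δ a y - interp g T δ a x :=
        fun x y hxy => mul_sub_le_image_sub_of_le_deriv hd (hder a) hxy
      rcases le_total 0 (e t) with h | h
      · have := key t (t + e t) (by linarith)
        rw [abs_of_nonneg h]
        exact (le_trans (by linarith) this).trans (le_abs_self _)
      · have := key (t + e t) t (by linarith)
        rw [abs_of_nonpos h, abs_sub_comm]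
        exact (le_trans (by linarith) this).trans (le_abs_self _)
    have h3 : δ * C * W ≤ δ * C * B := by gcongr; linarith
    have h4 : m * |e t| < m * ν := by nlinarith
    exact lt_of_mul_lt_mul_left h4 hm0.le
  have hde : ∀ t, deriv (interp g T δ a) (t + e t) * (1 + deriv e t) = deriv (interp g T δ 0) t :=
    fun t => by
      have h1 : HasDerivAt (fun t => t + e t) (1 + deriv e t) t :=
        (hasDerivAt_id t).add (hes.differentiable (by simp) t).hasDerivAt
      have h0 : HasDerivAt (interp g T δ a) (deriv (interp g T δ a) (t + e t)) (t + e t) :=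
        ((hsmooth a).differentiable (by simp) _).hasDerivAt
      have h2 := h0.comp t h1
      rw [show interp g T δ a ∘ (fun t => t + e t) = interp g T δ 0 from funext heq] at h2
      exact h2.deriv.symm
  refine ⟨e, hes.of_le (by exact_mod_cast le_top), fun t => ⟨(hesmall t).trans_le hνε, ?_, heq t,
    fun h => hzero t ?_, fun h => hzero t ?_⟩⟩
  · have h1 : deriv (interp g T δ a) (t + e t) * deriv e t =
        deriv (interp g T δ 0) t - deriv (interp g T δ a) (t + e t) := by
      rw [← hde t]; ring
    have h2 : |deriv (interp g T δ 0) t - deriv (interp g T δ a) (t + e t)| < ε * m / 2 := by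
      rw [(hasDerivAt_interp L.one.differentiable).deriv,
        (hasDerivAt_interp L.one.differentiable).deriv, add_zero]
      have k1 := hsm (δ * (t - T)) t
      have k2 := hsm (δ * (t + e t + a - T)) (t + e t)
      have k3 := hu t (t + e t) (by
        rw [sub_add_cancel_left, abs_neg]; exact (hesmall t).trans_le hνρ)
      have k4 := hηd (t + e t) t
      rw [add_sub_cancel_left] at k4
      have k5 : |e t| ≤ 1 := (hesmall t).le.trans hν1
      have k6 := hst (δ * (t - T))
      set x := Real.smoothTransition (δ * (t - T))
      set y := Real.smoothTransition (δ * (t + e t + a - T))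
      have k7 : |(1 - x) * (deriv g t - deriv g (t + e t))| ≤ 1 * (ε * m / 4) := by
        rw [abs_mul]
        gcongr
        rw [abs_le]; constructor <;> linarith [k6.1, k6.2]
      have k8 : |(y - x) * (deriv g (t + e t) - 1)| ≤ δ * C * 2 * B := by
        rw [abs_mul]
        have k9 : |deriv g (t + e t) - 1| ≤ B := (hWb' _).trans (by linarith)
        have k10 : |y - x| ≤ δ * C * 2 := k4.trans (by gcongr; linarith)
        gcongr
      rw [abs_le] at k1 k2 k7 k8
      have k11 : m * ν ≤ m * ε := by gcongr
      have hid : (1 - x) * (deriv g t - 1) - (1 - y) * (deriv g (t + e t) - 1) =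
          (1 - x) * (deriv g t - deriv g (t + e t)) + (y - x) * (deriv g (t + e t) - 1) := by ring
      rw [abs_lt]
      constructor <;> linarith [k1.1, k1.2, k2.1, k2.2, k7.1, k7.2, k8.1, k8.2]
    rw [← h1, abs_mul, abs_of_pos (hpos _ _)] at h2
    have h3 := hder a (t + e t)
    by_contra hcon
    push Not at hcon
    have := mul_le_mul h3 hcon hε.le (hpos _ _).le
    linarith
  · rw [interp_of_le hδ h, interp_of_le hδ (by linarith)]
  · rw [interp_of_ge hδ (by linarith), interp_of_ge hδ (by linarith)]

/-! ### Time functions commuting with the dynamics -/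

/-- A map commuting with `K` shifts the expanding time by `r`, if it does so near the repelling
fixed points, where this amounts to an equation for the constants `c`. -/
theorem IsHyperbolicPair.time_map {N : ℕ} {p : ℤ → ℝ} {lam : ℤ → ℝ} {c : ℤ → ℤ → ℝ} {δ : ℝ}
    {K G H : ℝ → ℝ} (P : IsHyperbolicPair N p lam δ K G) (T : IsExpandingTime N p lam c δ K H)
    {d : ℤ} {F : ℝ → ℝ} (hd : d = 1 ∨ d = -1) (hmem : ∀ x, F x ∈ Set.range p ↔ x ∈ Set.range p)
    (hcomm : ∀ x, F (K x) = K (F x)) {δ' B r : ℝ} {s : ℤ → ℝ} (hδ' : 0 < δ') (hB : 0 < B)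
    (near : ∀ i u, |u| < δ' → F (p i + u) = F (p i) + s i * u)
    (hs : ∀ i, 0 < d * s i ∧ d * s i ≤ B)
    (hcoc : ∀ i k e, e = 1 ∨ e = -1 → F (p i) = p k →
      lam k = lam i ∧ c k (d * e) + Real.log (d * s i) / lam i = c i e + r) :
    ∀ x ∉ Set.range p, H (F x) = H x + r := by
  intro x hx
  have hdd : (d : ℝ) * d = 1 := by rcases hd with rfl | rfl <;> norm_num
  have := P.eq_of_near (H := H) (H' := fun x => H (F x) - r) T.map_apply (fun x hx => by
    rw [hcomm, T.map_apply _ ((hmem x).not.2 hx)]; ring)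
    (ρ := min (min δ δ') (δ / B)) (by have := P.δ_pos; positivity) (fun i e u he hl h0 hu => by
      have h1 := hu.trans_le ((min_le_left _ _).trans (min_le_left _ _))
      have h2 := hu.trans_le ((min_le_left _ _).trans (min_le_right _ _))
      have h3 := hu.trans_le (min_le_right _ _)
      rw [lt_div_iff₀ hB] at h3
      obtain ⟨k, hk⟩ := (hmem (p i)).2 ⟨i, rfl⟩
      obtain ⟨hlk, hck⟩ := hcoc i k e he hk.symm
      obtain ⟨hs1, hs2⟩ := hs i
      have hde : d * e = 1 ∨ d * e = -1 := by
        rcases hd with rfl | rfl <;> rcases he with rfl | rfl <;> norm_num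
      have hF : F (p i + e * u) = p k + (d * e : ℤ) * (d * s i * u) := by
        rw [near, ← hk]
        · push_cast
          rw [show (d : ℝ) * e * (d * s i * u) = d * d * (s i * (e * u)) by ring, hdd, one_mul]
        · rw [abs_mul, abs_of_pos h0]
          rcases he with rfl | rfl <;> norm_num <;> exact h2
      rw [T.near i e u he hl h0 h1, hF, T.near k _ _ hde (hlk ▸ hl) (by positivity) (by nlinarith),
        Real.log_mul hs1.ne' h0.ne', hlk]
      rw [add_div]; linarith) hx
  linarith

/-- Two time functions for the same dynamics, one of them adapted to the repelling, the other to the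
attracting periodic points. -/
structure IsTimePair (F : ℝ → ℝ) (q N : ℕ) (p : ℤ → ℝ) (lam : ℤ → ℝ) (c : ℤ → ℤ → ℝ)
    (δ : ℝ) (H H' : ℝ → ℝ) : Prop where
  lam_add : ∀ i, lam (i + N) = lam i
  alternate : ∀ i, lam i * lam (i + 1) < 0
  const_add : ∀ i e, c (i + N) e = c i e
  δ_pos : 0 < δ
  gap : ∀ i, p i + 2 * δ ≤ p (i + 1)
  chart : IsTimeChart N p H
  chart' : IsTimeChart N p H'
  map_add_one : ∀ x, H (x + 1) = H x
  map_add_one' : ∀ x, H' (x + 1) = H' x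
  map_apply : ∀ x ∉ Set.range p, H (F x) = H x + 1 / q
  map_apply' : ∀ x ∉ Set.range p, H' (F x) = H' x + 1 / q
  near : ∀ (i e : ℤ) (u : ℝ), e = 1 ∨ e = -1 → 0 < lam i → 0 < u → u < δ →
    H (p i + e * u) = Real.log u / lam i + c i e
  near' : ∀ (i e : ℤ) (u : ℝ), e = 1 ∨ e = -1 → lam i < 0 → 0 < u → u < δ →
    H' (p i + e * u) = Real.log u / lam i + c i e
  exists_next : ∀ i, ∀ x ∈ Set.Ioo (p i) (p (i + 1)),
    ∃ y ∈ Set.Ioo (p i) (p (i + 1)), H y = H x + 1 ∧ H' y = H' x + 1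

namespace IsLinearized

variable {d : ℤ} {F : ℝ → ℝ} {q : ℕ} {M : ℤ} {N : ℕ} {p : ℤ → ℝ} {s : ℤ → ℝ} {δ : ℝ}

theorem map_mem (Z : IsLinearized d F q M N p s δ) (x : ℝ) :
    F x ∈ Set.range p ↔ x ∈ Set.range p := by
  rw [← Z.periodic_iff, ← Z.periodic_iff, Z.based.periodic_map_iff Z.isLift.one]

theorem iterate_mem (Z : IsLinearized d F q M N p s δ) (i : ℤ) (j : ℕ) :
    F^[j] (p i) ∈ Set.range p := by
  induction j with
  | zero => exact ⟨i, rfl⟩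
  | succ j ih => rw [iterate_succ_apply', Z.map_mem]; exact ih

theorem slope (Z : IsLinearized d F q M N p s δ) (i : ℤ) : deriv F (p i) = s i := by
  have hev : F =ᶠ[𝓝 (p i)] fun y => F (p i) + s i * (y - p i) := by
    filter_upwards [Metric.ball_mem_nhds (p i) Z.δ_pos] with y hy
    have := Z.near i (y - p i) (by rwa [Metric.mem_ball, Real.dist_eq] at hy)
    rwa [add_sub_cancel] at this
  have hd : HasDerivAt (fun y => F (p i) + s i * (y - p i)) (s i * 1) (p i) :=
    (((hasDerivAt_id _).sub_const _).const_mul _).const_add _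
  rw [hev.deriv_eq, hd.deriv, mul_one]

/-- The iterates are affine near the periodic points too, with a uniform radius. -/
theorem iterate_near (Z : IsLinearized d F q M N p s δ) (j : ℕ) : ∃ δ', 0 < δ' ∧
    ∀ i u, |u| < δ' → F^[j] (p i + u) = F^[j] (p i) + deriv F^[j] (p i) * u := by
  induction j with
  | zero => exact ⟨1, one_pos, fun i u _ => by simp⟩
  | succ j ih =>
    obtain ⟨δ', hδ', h⟩ := ih
    have Lj := Z.isLift.one.iterate le_rfl j
    obtain ⟨B, hB, hBj⟩ := Lj.exists_deriv_bound
    have hδ := Z.δ_pos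
    refine ⟨min δ' (δ / B), by positivity, fun i u hu => ?_⟩
    obtain ⟨k, hk⟩ := Z.iterate_mem i j
    have h1 : |deriv F^[j] (p i) * u| < δ := by
      have := hu.trans_le (min_le_right _ _)
      rw [lt_div_iff₀' hB] at this
      rw [abs_mul]
      exact (by gcongr; exact hBj _ : _ ≤ B * |u|).trans_lt this
    rw [iterate_succ_apply', h i u (hu.trans_le (min_le_left _ _)), ← hk, Z.near k _ h1,
      iterate_succ_apply', iterate_succ', deriv_comp _ (Z.isLift.one.differentiable _)
      (Lj.differentiable _), ← hk, Z.slope]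
    ring

theorem lift_iterate (Z : IsLinearized d F q M N p s δ) : IsCircleLift ∞ 1 F^[q] := by
  have := Z.isLift.iterate (by simp) q
  rwa [Z.based.deg_pow] at this

theorem multiplier_pos (Z : IsLinearized d F q M N p s δ) (i : ℤ) : 0 < deriv F^[q] (p i) := by
  have := Z.lift_iterate.deriv_pos (p i)
  simpa using this

/-- Repelling and attracting periodic points alternate. -/
theorem alternate (Z : IsLinearized d F q M N p s δ) (i : ℤ) :
    Real.log (deriv F^[q] (p i)) * Real.log (deriv F^[q] (p (i + 1))) < 0 := by
  obtain ⟨δ', hδ', hnear⟩ := Z.iterate_near q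
  have hlt := Z.mark.strictMono (show i < i + 1 by omega)
  set u := min (δ' / 2) ((p (i + 1) - p i) / 3) with hu
  have hu0 : 0 < u := by have := sub_pos.2 hlt; positivity
  have hu1 : u < δ' := (min_le_left _ _).trans_lt (by linarith)
  have hu2 : 3 * u ≤ p (i + 1) - p i := by
    have := min_le_right (δ' / 2) ((p (i + 1) - p i) / 3)
    linarith
  have h1 := hnear i u (by rwa [abs_of_pos hu0])
  have h2 := hnear (i + 1) (-u) (by rwa [abs_neg, abs_of_pos hu0])
  rw [(Z.periodic_iff _).2 ⟨i, rfl⟩] at h1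
  rw [(Z.periodic_iff _).2 ⟨i + 1, rfl⟩] at h2
  set g : ℝ → ℝ := fun x => F^[q] x - x - M with hg
  have hgc : ContinuousOn g (Set.Icc (p i + u) (p (i + 1) + -u)) := by
    have := Z.lift_iterate.continuous
    fun_prop
  have hne : ∀ x ∈ Set.Icc (p i + u) (p (i + 1) + -u), g x ≠ 0 := fun x hx h => by
    refine Z.mark.notMem_range (i := i) ⟨by linarith [hx.1], by linarith [hx.2]⟩
      ((Z.periodic_iff x).1 ?_)
    simp only [hg] at h; linarith
  have hle : p i + u ≤ p (i + 1) + -u := by linarith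
  have g1 : g (p i + u) = (deriv F^[q] (p i) - 1) * u := by simp only [hg, h1]; ring
  have g2 : g (p (i + 1) + -u) = -((deriv F^[q] (p (i + 1)) - 1) * u) := by
    simp only [hg, h2]; ring
  have p1 := Z.multiplier_pos i
  have p2 := Z.multiplier_pos (i + 1)
  rcases lt_or_gt_of_ne (Z.multiplier_ne i) with h | h <;>
    rcases lt_or_gt_of_ne (Z.multiplier_ne (i + 1)) with h' | h'
  · obtain ⟨x, hx, hx0⟩ := intermediate_value_Icc hle hgc
      (show (0 : ℝ) ∈ _ from ⟨by rw [g1]; nlinarith, by rw [g2]; nlinarith⟩)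
    exact absurd hx0 (hne x hx)
  · exact mul_neg_of_neg_of_pos (Real.log_neg p1 h) (Real.log_pos h')
  · exact mul_neg_of_pos_of_neg (Real.log_pos h) (Real.log_neg p2 h')
  · obtain ⟨x, hx, hx0⟩ := intermediate_value_Icc' hle hgc
      (show (0 : ℝ) ∈ _ from ⟨by rw [g2]; nlinarith, by rw [g1]; nlinarith⟩)
    exact absurd hx0 (hne x hx)

theorem exists_hyperbolicPair (Z : IsLinearized d F q M N p s δ) : ∃ δ' G, IsHyperbolicPair N p
    (fun i => Real.log (deriv F^[q] (p i))) δ' (fun x => F^[q] x - M) G := by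
  have LK : IsCircleLift ∞ 1 fun x => F^[q] x - M := by
    simpa [sub_eq_add_neg] using Z.lift_iterate.add_const (-M)
  obtain ⟨G, LG, hl, hr⟩ := LK.exists_inverse (by simp)
  obtain ⟨δ₁, hδ₁, hnear⟩ := Z.iterate_near q
  obtain ⟨γ, hγ0, hγ⟩ := Z.mark.exists_gap
  have hΛ : ∀ i, deriv F^[q] (p (i + N)) = deriv F^[q] (p i) := fun i => by
    rw [Z.mark.map_add, Z.lift_iterate.deriv_add_one]
  obtain ⟨B, hB, hBb⟩ := exists_bound_of_int_periodic Z.mark.pos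
    (a := fun i => (deriv F^[q] (p i))⁻¹) (fun i => by rw [hΛ])
  have hK : ∀ i u, |u| < δ₁ → F^[q] (p i + u) - M = p i + deriv F^[q] (p i) * u := fun i u hu => by
    rw [hnear i u hu, (Z.periodic_iff _).2 ⟨i, rfl⟩]; ring
  refine ⟨min (γ / 2) (min δ₁ (δ₁ / B)), G, Z.mark, fun i => by rw [hΛ], Z.alternate, LK, LG, hl,
    hr, fun x => ?_, by positivity, fun i => ?_, fun i u hu => ?_, fun i u hu => ?_⟩
  · rw [← Z.periodic_iff]
    constructor <;> intro h <;> linarith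
  · have := hγ i
    linarith [min_le_left (γ / 2) (min δ₁ (δ₁ / B))]
  · rw [Real.exp_log (Z.multiplier_pos i)]
    exact hK i u (hu.trans_le ((min_le_right _ _).trans (min_le_left _ _)))
  · rw [Real.exp_neg, Real.exp_log (Z.multiplier_pos i)]
    have h1 := hu.trans_le ((min_le_right _ _).trans (min_le_right _ _))
    rw [lt_div_iff₀' hB] at h1
    have h2 := hK i ((deriv F^[q] (p i))⁻¹ * u) (by
      rw [abs_mul]
      exact (by gcongr; exact hBb i : _ ≤ B * |u|).trans_lt h1)
    rw [mul_inv_cancel_left₀ (Z.multiplier_pos i).ne'] at h2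
    rw [← h2]
    exact hl _

/-- The constants which make the local times at the periodic points compatible with the dynamics:
the sums along the orbits, up to a jump across the points which is the same for all of them. -/
theorem exists_constants (Z : IsLinearized d F q M N p s δ) : ∃ c : ℤ → ℤ → ℝ,
    (∀ i e, c (i + N) e = c i e) ∧
    (∀ i k e, e = 1 ∨ e = -1 → F (p i) = p k → c k (d * e) +
      Real.log (d * s i) / Real.log (deriv F^[q] (p i)) = c i e + 1 / q) ∧
    (d = 1 → ∑ i ∈ Finset.range N, (c i 1 - c i (-1)) ≠ 0) := by
  set lam : ℤ → ℝ := fun i => Real.log (deriv F^[q] (p i)) with hlam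
  set a : ℕ → ℤ → ℝ := fun j i => Real.log (deriv F^[j] (p i)) / lam i - j / q with ha
  have hq : (q : ℝ) ≠ 0 := by have := Z.based.q_pos; positivity
  have hl0 : ∀ i, lam i ≠ 0 := fun i h => by
    have := Z.alternate i
    rw [show Real.log (deriv F^[q] (p i)) = 0 from h, zero_mul] at this
    exact lt_irrefl _ this
  have hΛ : ∀ j i, deriv F^[j] (p (i + N)) = deriv F^[j] (p i) := fun j i => by
    rw [Z.mark.map_add, (Z.isLift.iterate (by simp) j).deriv_add_one]
  classical
  refine ⟨fun i e => 1 / q * ∑ j ∈ Finset.range q, a j i + if d = 1 ∧ e = 1 then 1 else 0,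
    fun i e => by simp only [ha, hlam, hΛ], fun i k e he hk => ?_, fun hd => ?_⟩
  · have hif : (d = 1 ∧ d * e = 1) ↔ (d = 1 ∧ e = 1) := by
      constructor <;> rintro ⟨rfl, h⟩ <;> simpa using h
    have hlk : lam k = lam i := by
      have := Z.isLift.one.deriv_iterate_orbit ((Z.periodic_iff _).2 ⟨i, rfl⟩) 1 0
      simp only [iterate_one, Int.cast_zero, add_zero, hk] at this
      simp only [hlam, this]
    have hlog : Real.log (d * s i) = Real.log (s i) := by
      rcases Z.isLift.deg with rfl | rfl <;> simp [Real.log_neg_eq_log]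
    have hsi := Z.isLift.deriv_ne (p i)
    have hstep : ∀ j, a j k = a (j + 1) i + 1 / q - Real.log (s i) / lam i := fun j => by
      have Lj := Z.isLift.one.iterate le_rfl j
      simp only [ha, hlk]
      rw [iterate_succ, deriv_comp _ (Lj.differentiable _) (Z.isLift.one.differentiable _), hk,
        Real.log_mul (Lj.deriv_ne _) hsi, Z.slope]
      push_cast; ring
    have hsum : ∑ j ∈ Finset.range q, a j k =
        ∑ j ∈ Finset.range q, a j i + 1 - q * (Real.log (s i) / lam i) := by
      have h1 := Finset.sum_range_succ (fun j => a j i) q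
      have h2 := Finset.sum_range_succ' (fun j => a j i) q
      have h3 : a 0 i = 0 := by simp [ha]
      have h4 : a q i = 0 := by
        have : a q i = lam i / lam i - q / q := rfl
        rw [this, div_self (hl0 i), div_self hq, sub_self]
      rw [Finset.sum_congr rfl fun j _ => hstep j, Finset.sum_sub_distrib, Finset.sum_add_distrib,
        Finset.sum_const, Finset.sum_const, Finset.card_range, nsmul_eq_mul, nsmul_eq_mul]
      rw [h1, h3, h4] at h2
      rw [show (q : ℝ) * (1 / q) = 1 by field_simp]
      linarith
    simp only [hif, hsum, hlog]
    rw [show Real.log (deriv F^[q] (p i)) = lam i from rfl]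
    field_simp; ring
  · have hN : (N : ℝ) ≠ 0 := by have := Z.mark.pos; positivity
    simpa [hd] using hN

/-- The two time functions come from `F^q` and its inverse. The constants of the logarithms are chosen
along the orbits so that `F` advances time by `1 / q` and, if `F` preserves the orientation, so that
the sum of the jumps is nonzero. -/
theorem exists_timePair (Z : IsLinearized d F q M N p s δ) :
    ∃ c δ' H H', IsTimePair F q N p (fun i => Real.log (deriv F^[q] (p i))) c δ' H H' ∧
      (d = 1 → ∑ i ∈ Finset.range N, (c i 1 - c i (-1)) ≠ 0) := by
  obtain ⟨δ', G, P⟩ := Z.exists_hyperbolicPair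
  obtain ⟨c, hc, hcoc, hsum⟩ := Z.exists_constants
  obtain ⟨H, T⟩ := P.exists_time hc
  obtain ⟨E, T'⟩ := P.symm.exists_time (c := fun i e => -c i e) (fun i e => by rw [hc])
  obtain ⟨B, hB, hBb⟩ := Z.isLift.one.exists_deriv_bound
  have hs : ∀ i, 0 < d * s i ∧ d * s i ≤ B := fun i => by
    rw [← Z.slope]
    refine ⟨Z.isLift.deriv_pos _, (le_abs_self _).trans ?_⟩
    rw [abs_mul]
    have := hBb (p i)
    rcases Z.isLift.deg with rfl | rfl <;> simpa using this
  have hlk : ∀ i k, F (p i) = p k →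
      Real.log (deriv F^[q] (p k)) = Real.log (deriv F^[q] (p i)) := fun i k hk => by
    have := Z.isLift.one.deriv_iterate_orbit ((Z.periodic_iff _).2 ⟨i, rfl⟩) 1 0
    simp only [iterate_one, Int.cast_zero, add_zero, hk] at this
    rw [this]
  have hK : ∀ x, F (F^[q] x - M) = F^[q] (F x) - M := fun x => by
    have h1 := Z.isLift.map_add_int (F^[q] x) (-M)
    have h2 : (d : ℝ) * M = M := by exact_mod_cast Z.based.deg_mul
    push_cast at h1
    rw [← sub_eq_add_neg] at h1
    rw [h1, mul_neg, h2, ← iterate_succ_apply' F, iterate_succ_apply]; ring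
  have hG : ∀ x, F (G x) = G (F x) := fun x => by
    have := hK (G x)
    rw [show F^[q] (G x) - M = x from P.right x] at this
    rw [this]
    exact (P.left _).symm
  have hT := P.time_map T Z.isLift.deg Z.map_mem hK Z.δ_pos hB Z.near hs
    (fun i k e he hk => ⟨hlk i k hk, hcoc i k e he hk⟩)
  have hT' := P.symm.time_map T' Z.isLift.deg Z.map_mem hG Z.δ_pos hB Z.near hs (r := -(1 / q))
    (fun i k e he hk => ⟨by rw [hlk i k hk], by
      have := hcoc i k e he hk
      rw [div_neg]; linarith⟩)
  have C' := P.symm.chart T'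
  refine ⟨c, δ', H, fun x => -E x, ⟨P.lam_add, P.alternate, hc, P.δ_pos, P.gap, P.chart T,
    ⟨Z.mark, fun x hx => (C'.smooth x hx).neg, fun x hx => ?_, fun i y => ?_⟩, T.map_add_one,
    fun x => by rw [T'.map_add_one], hT, fun x hx => ?_, T.near, fun i e u he hl h0 h1 => ?_,
    fun i x hx => ⟨_, P.mapsTo hx 1, T.map_apply x (Z.mark.notMem_range hx), ?_⟩⟩, hsum⟩
  · rw [deriv.fun_neg]; exact neg_ne_zero.2 (C'.deriv_ne x hx)
  · obtain ⟨x, hx, h⟩ := C'.surjOn i (-y)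
    exact ⟨x, hx, by rw [h, neg_neg]⟩
  · rw [hT' x hx]; ring
  · rw [T'.near i e u he (neg_pos.2 hl) h0 h1, div_neg]; ring
  · have := T'.map_apply _ (Z.mark.notMem_range (P.mapsTo hx 1))
    rw [iterate_one, P.left x] at this
    rw [iterate_one]; linarith

end IsLinearized

/-! ### Synchronization of the two time functions -/

theorem abs_exp_mul_sub_one_le {a b : ℝ} (ha : |a| ≤ 1) (hb : |b| ≤ 1) :
    |Real.exp a * (1 + b) - 1| ≤ 4 * |a| + |b| := by
  have h1 := Real.abs_exp_sub_one_le ha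
  have h2 : |1 + b| ≤ 2 := (abs_add_le _ _).trans (by rw [abs_one]; linarith)
  calc |Real.exp a * (1 + b) - 1| = |(Real.exp a - 1) * (1 + b) + b| := by ring_nf
    _ ≤ |(Real.exp a - 1) * (1 + b)| + |b| := abs_add_le _ _
    _ ≤ 2 * |a| * 2 + |b| := by rw [abs_mul]; gcongr
    _ = 4 * |a| + |b| := by ring

namespace IsTimePair

variable {F : ℝ → ℝ} {q N : ℕ} {p : ℤ → ℝ} {lam : ℤ → ℝ} {c : ℤ → ℤ → ℝ} {δ : ℝ} {H H' : ℝ → ℝ}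

theorem lam_ne (W : IsTimePair F q N p lam c δ H H') (i : ℤ) : lam i ≠ 0 := fun h => by
  have := W.alternate i
  rw [h, zero_mul] at this
  exact lt_irrefl _ this

theorem notMem (W : IsTimePair F q N p lam c δ H H') {i e : ℤ} (he : e = 1 ∨ e = -1) {u : ℝ}
    (h0 : 0 < u) (h1 : u < δ) : p i + e * u ∉ Set.range p := by
  refine W.chart.mark.notMem_side he h0 ?_
  rcases he with rfl | rfl
  · have := W.gap i
    push_cast; linarith
  · have := W.gap (i + -1)
    rw [neg_add_cancel_right] at this
    push_cast; linarith

theorem branch_add (W : IsTimePair F q N p lam c δ H H') (i : ℤ) (t : ℝ) :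
    timeBranch p H' (i + N) t = timeBranch p H' i t + 1 := by
  have h := W.chart'.branch_mem i t
  refine W.chart'.branch_eq ⟨?_, ?_⟩ ?_
  · rw [W.chart.mark.map_add]; linarith [h.1]
  · rw [show i + N + 1 = i + 1 + N by ring, W.chart.mark.map_add]; linarith [h.2]
  · rw [W.map_add_one', W.chart'.apply_branch]

/-- The expanding time as a function of the contracting one, on each interval. -/
theorem change_isCircleLift (W : IsTimePair F q N p lam c δ H H') (i : ℤ) :
    IsCircleLift ∞ 1 fun t => H (timeBranch p H' i t) := by
  have hn : ∀ t, timeBranch p H' i t ∉ Set.range p := fun t =>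
    W.chart.mark.notMem_range (W.chart'.branch_mem i t)
  refine IsCircleLift.of_deriv_ne (by simp) ?_ (Or.inl rfl) (fun t => ?_) fun t => ?_
  · rw [contDiff_iff_contDiffAt]
    exact fun t => (W.chart.smooth _ (hn t)).comp t (W.chart'.branch_contDiffAt i t).1
  · obtain ⟨y, hy, h1, h2⟩ := W.exists_next i _ (W.chart'.branch_mem i t)
    rw [W.chart'.apply_branch] at h2
    rw [W.chart'.branch_eq hy h2, h1]; simp
  · have h1 := (W.chart.differentiableAt (hn t)).hasDerivAt
    have h2 : HasDerivAt (fun t => H (timeBranch p H' i t)) _ t :=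
      HasDerivAt.comp t h1 (W.chart'.branch_contDiffAt i t).2
    rw [h2.deriv, fieldLift, if_neg (hn t)]
    exact mul_ne_zero (W.chart.deriv_ne _ (hn t)) (inv_ne_zero (W.chart'.deriv_ne _ (hn t)))

/-- Large contracting times are attained in the linear neighbourhoods of the attracting points. -/
theorem exists_late (W : IsTimePair F q N p lam c δ H H') : ∃ T, ∀ i, ∃ k e : ℤ,
    (e = 1 ∨ e = -1) ∧ lam k < 0 ∧ ∀ t, T < t → Real.exp (lam k * (t - c k e)) < δ ∧
      timeBranch p H' i t = p k + e * Real.exp (lam k * (t - c k e)) := by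
  have hper : ∀ e i, c (i + N) e + Real.log δ / lam (i + N) = c i e + Real.log δ / lam i :=
    fun e i => by rw [W.const_add, W.lam_add]
  obtain ⟨T₁, hT₁, h₁⟩ := exists_bound_of_int_periodic W.chart.mark.pos
    (a := fun i => c i 1 + Real.log δ / lam i) (hper 1)
  obtain ⟨T₂, hT₂, h₂⟩ := exists_bound_of_int_periodic W.chart.mark.pos
    (a := fun i => c i (-1) + Real.log δ / lam i) (hper (-1))
  have hexp : ∀ k e : ℤ, e = 1 ∨ e = -1 → lam k < 0 → ∀ t, T₁ + T₂ < t →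
      Real.exp (lam k * (t - c k e)) < δ := fun k e he hk t ht => by
    have h3 : c k e + Real.log δ / lam k < t := by
      rcases he with rfl | rfl
      · linarith [le_abs_self (c k 1 + Real.log δ / lam k), h₁ k]
      · linarith [le_abs_self (c k (-1) + Real.log δ / lam k), h₂ k]
    rw [← Real.lt_log_iff_exp_lt W.δ_pos]
    have h4 : Real.log δ / lam k < t - c k e := by linarith
    rwa [div_lt_iff_of_neg hk, mul_comm] at h4
  have hval : ∀ k e : ℤ, e = 1 ∨ e = -1 → lam k < 0 → ∀ t, T₁ + T₂ < t →
      H' (p k + e * Real.exp (lam k * (t - c k e))) = t := fun k e he hk t ht => by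
    rw [W.near' k e _ he hk (Real.exp_pos _) (hexp k e he hk t ht), Real.log_exp,
      mul_div_cancel_left₀ _ hk.ne]
    ring
  refine ⟨T₁ + T₂, fun i => ?_⟩
  have hgap := W.gap i
  have hδ := W.δ_pos
  rcases lt_or_gt_of_ne (W.lam_ne i) with h | h
  · refine ⟨i, 1, Or.inl rfl, h, fun t ht => ?_⟩
    have h3 := hexp i 1 (Or.inl rfl) h t ht
    refine ⟨h3, W.chart'.branch_eq ?_ (hval i 1 (Or.inl rfl) h t ht)⟩
    have := Real.exp_pos (lam i * (t - c i 1))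
    push_cast
    exact ⟨by linarith, by linarith⟩
  · have h' : lam (i + 1) < 0 := by
      have := W.alternate i
      by_contra hn; push Not at hn; nlinarith
    refine ⟨i + 1, -1, Or.inr rfl, h', fun t ht => ?_⟩
    have h3 := hexp (i + 1) (-1) (Or.inr rfl) h' t ht
    refine ⟨h3, W.chart'.branch_eq ?_ (hval (i + 1) (-1) (Or.inr rfl) h' t ht)⟩
    have := Real.exp_pos (lam (i + 1) * (t - c (i + 1) (-1)))
    push_cast
    exact ⟨by linarith, by linarith⟩

end IsTimePair

open Classical in
/-- The function equal to `Θ i ∘ H` on the interval `(p i, p (i + 1))`. -/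
noncomputable def piecewiseTime (p : ℤ → ℝ) (Θ : ℤ → ℝ → ℝ) (H : ℝ → ℝ) (x : ℝ) : ℝ :=
  if h : ∃ i, x ∈ Set.Ioo (p i) (p (i + 1)) then Θ h.choose (H x) else 0

open Classical in
/-- The map which on each interval `(p i, p (i + 1))` changes the time `t` into `t + e i t`. -/
noncomputable def timeShift (p : ℤ → ℝ) (e : ℤ → ℝ → ℝ) (H : ℝ → ℝ) (x : ℝ) : ℝ :=
  if h : ∃ i, x ∈ Set.Ioo (p i) (p (i + 1)) then
    timeBranch p H h.choose (H x + e h.choose (H x)) else x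

section Piecewise

variable {N : ℕ} {p : ℤ → ℝ} {Θ e : ℤ → ℝ → ℝ} {H : ℝ → ℝ} {i : ℤ} {x : ℝ}

theorem piecewiseTime_of_mem (mk : IsMarking N p) (hx : x ∈ Set.Ioo (p i) (p (i + 1))) :
    piecewiseTime p Θ H x = Θ i (H x) := by
  have h : ∃ i, x ∈ Set.Ioo (p i) (p (i + 1)) := ⟨i, hx⟩
  rw [piecewiseTime, dif_pos h, mk.index_unique h.choose_spec hx]

theorem timeShift_of_mem (mk : IsMarking N p) (hx : x ∈ Set.Ioo (p i) (p (i + 1))) :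
    timeShift p e H x = timeBranch p H i (H x + e i (H x)) := by
  have h : ∃ i, x ∈ Set.Ioo (p i) (p (i + 1)) := ⟨i, hx⟩
  rw [timeShift, dif_pos h, mk.index_unique h.choose_spec hx]

theorem timeShift_of_range (mk : IsMarking N p) (hx : x ∈ Set.range p) :
    timeShift p e H x = x := by
  rw [timeShift, dif_neg]
  rintro ⟨i, hi⟩
  exact mk.notMem_range hi hx

theorem IsMarking.mem_Ioo_add_one (mk : IsMarking N p) :
    x + 1 ∈ Set.Ioo (p (i + N)) (p (i + N + 1)) ↔ x ∈ Set.Ioo (p i) (p (i + 1)) := by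
  rw [show i + N + 1 = i + 1 + N by ring, mk.map_add, mk.map_add, Set.mem_Ioo, Set.mem_Ioo]
  simp

theorem piecewiseTime_add_one (mk : IsMarking N p) (hH : ∀ x, H (x + 1) = H x)
    (hΘ : ∀ i, Θ (i + N) = Θ i) (x : ℝ) : piecewiseTime p Θ H (x + 1) = piecewiseTime p Θ H x := by
  by_cases hx : ∃ i, x ∈ Set.Ioo (p i) (p (i + 1))
  · obtain ⟨i, hi⟩ := hx
    rw [piecewiseTime_of_mem mk hi, piecewiseTime_of_mem mk (mk.mem_Ioo_add_one.2 hi), hH, hΘ]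
  · rw [piecewiseTime, piecewiseTime, dif_neg hx, dif_neg]
    rintro ⟨i, hi⟩
    refine hx ⟨i - N, mk.mem_Ioo_add_one.1 ?_⟩
    rwa [sub_add_cancel]

end Piecewise

/-- A change of the contracting time, small in `C¹`, with support in the linear neighbourhoods of
the attracting points but away from these points, is realized by a diffeomorphism close to the
identity: near the attracting points, where the contracting time is logarithmic, this diffeomorphism
multiplies the distance by a factor close to one. -/
theorem IsTimePair.timeShift_close {F : ℝ → ℝ} {q N : ℕ} {p : ℤ → ℝ} {lam : ℤ → ℝ}
    {c : ℤ → ℤ → ℝ} {δ : ℝ} {H H' : ℝ → ℝ} (W : IsTimePair F q N p lam c δ H H') {T : ℝ}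
    (hT : ∀ i, ∃ k e : ℤ, (e = 1 ∨ e = -1) ∧ lam k < 0 ∧ ∀ t, T < t →
      Real.exp (lam k * (t - c k e)) < δ ∧
      timeBranch p H' i t = p k + e * Real.exp (lam k * (t - c k e))) {ε : ℝ} (hε : 0 < ε) :
    ∃ ε', 0 < ε' ∧ ∀ (e : ℤ → ℝ → ℝ) (ρ : ℝ), 0 < ρ → (∀ i, e (i + N) = e i) →
      (∀ i, ContDiff ℝ 1 (e i)) → (∀ i t, |e i t| < ε' ∧ |deriv (e i) t| < ε') →
      (∀ i t, t ≤ T + 2 → e i t = 0) →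
      (∀ k x, x ∉ Set.range p → |x - p k| < ρ → ∀ i, e i (H' x) = 0) →
      IsCircleLift 1 1 (timeShift p e H') ∧ C1Close ε id (timeShift p e H') := by
  have mk := W.chart.mark
  obtain ⟨b, hb, hlam⟩ := exists_bound_of_int_periodic mk.pos W.lam_add
  obtain ⟨ε₀, hε₀, hopen⟩ := (IsCircleLift.id (r := 1)).of_close
  have hδ := W.δ_pos
  set ε₁ := min ε ε₀ with hε₁
  have hε₁0 : 0 < ε₁ := by positivity
  set ε' := min (min 1 (1 / b)) (ε₁ / ((4 * b + 1) * (1 + δ))) with hε'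
  have hε'0 : 0 < ε' := by positivity
  have hε'1 : ε' ≤ 1 := (min_le_left _ _).trans (min_le_left _ _)
  have hε'b : b * ε' ≤ 1 := by
    have h : ε' ≤ 1 / b := (min_le_left _ _).trans (min_le_right _ _)
    rwa [le_div_iff₀' hb] at h
  have hε'ε : ε' * ((4 * b + 1) * (1 + δ)) ≤ ε₁ := (le_div_iff₀ (by positivity)).1 (min_le_right _ _)
  refine ⟨ε', hε'0, fun e ρ hρ heN hes hesmall hearly hlate => ?_⟩
  set ψ := timeShift p e H' with hψ
  have hψid : ∀ x, (∀ i, x ∈ Set.Ioo (p i) (p (i + 1)) → e i (H' x) = 0) → ψ x = x := fun x h => by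
    by_cases hx : x ∈ Set.range p
    · exact timeShift_of_range mk hx
    · obtain ⟨i, hi⟩ := mk.exists_mem_Ioo hx
      rw [hψ, timeShift_of_mem mk hi, h i hi, add_zero, W.chart'.branch_apply hi]
  -- the map is locally the identity or a multiplication of the distance to an attracting point
  have hloc : ∀ x, ψ =ᶠ[𝓝 x] id ∨ ∃ i k, |x - p k| < δ ∧ |lam k| ≤ b ∧ x ∉ Set.range p ∧
      HasDerivAt H' (1 / (x - p k) / lam k) x ∧ lam k ≠ 0 ∧ x - p k ≠ 0 ∧
      ψ =ᶠ[𝓝 x] fun y => p k + (y - p k) * Real.exp (lam k * e i (H' y)) := fun x => by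
    by_cases hx : x ∈ Set.range p
    · left
      obtain ⟨k, rfl⟩ := hx
      filter_upwards [Metric.ball_mem_nhds (p k) hρ] with y hy
      rw [Metric.mem_ball, Real.dist_eq] at hy
      exact hψid y fun i hi => hlate k y (mk.notMem_range hi) hy i
    obtain ⟨i, hi⟩ := mk.exists_mem_Ioo hx
    have hnhds := Ioo_mem_nhds hi.1 hi.2
    have hc := (W.chart'.differentiableAt hx).continuousAt
    rcases lt_or_ge (H' x) (T + 2) with h | h
    · left
      filter_upwards [hnhds, hc.preimage_mem_nhds (Iio_mem_nhds h)] with y hy hyT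
      refine hψid y fun j hj => hearly j _ (le_of_lt hyT)
    · right
      obtain ⟨k, s, hs, hk, hbr⟩ := hT i
      have hss : (s : ℝ) * s = 1 := by rcases hs with rfl | rfl <;> norm_num
      have hform : ∀ y ∈ Set.Ioo (p i) (p (i + 1)), T < H' y →
          y - p k = s * Real.exp (lam k * (H' y - c k s)) := fun y hy hyT => by
        have := (hbr _ hyT).2
        rw [W.chart'.branch_apply hy] at this
        linarith
      have hxT : T + 1 < H' x := by linarith
      have hxf := hform x hi (by linarith)
      have habs : |x - p k| = Real.exp (lam k * (H' x - c k s)) := by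
        rw [hxf, abs_mul, abs_of_pos (Real.exp_pos _)]
        rcases hs with rfl | rfl <;> norm_num
      have hne : x - p k ≠ 0 := by
        rw [← abs_pos, habs]; exact Real.exp_pos _
      have hevT : ∀ᶠ y in 𝓝 x, y ∈ Set.Ioo (p i) (p (i + 1)) ∧ T + 1 < H' y := by
        filter_upwards [hnhds, hc.preimage_mem_nhds (Ioi_mem_nhds hxT)] with y hy hyT using ⟨hy, hyT⟩
      refine ⟨i, k, by rw [habs]; exact (hbr _ (by linarith)).1, hlam k, hx, ?_, hk.ne, hne, ?_⟩
      · have h1 : HasDerivAt (fun y => Real.log (y - p k) / lam k + c k s)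
            (1 / (x - p k) / lam k) x :=
          ((((hasDerivAt_id x).sub_const (p k)).log hne).div_const _).add_const _
        refine h1.congr_of_eventuallyEq ?_
        filter_upwards [hevT] with y hy
        have h2 := hform y hy.1 (by linarith [hy.2])
        have h3 : Real.log (y - p k) = lam k * (H' y - c k s) := by
          rw [h2]
          rcases hs with rfl | rfl <;> simp [Real.log_neg_eq_log]
        rw [h3, mul_div_cancel_left₀ _ hk.ne]; ring
      · filter_upwards [hevT] with y hy
        have h2 := hform y hy.1 (by linarith [hy.2])
        have h3 := (hesmall i (H' y)).1
        have h4 := abs_lt.1 (h3.trans_le hε'1)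
        rw [hψ, timeShift_of_mem mk hy.1, (hbr _ (by linarith [hy.2, h4.1])).2, h2, mul_assoc,
          ← Real.exp_add]
        ring_nf
  have hsmooth : ContDiff ℝ 1 ψ := by
    rw [contDiff_iff_contDiffAt]
    intro x
    rcases hloc x with h | ⟨i, k, -, -, hx, -, -, -, h⟩
    · exact contDiffAt_id.congr_of_eventuallyEq h
    · refine ContDiffAt.congr_of_eventuallyEq ?_ h
      have h1 : ContDiffAt ℝ 1 (fun y => e i (H' y)) x :=
        (hes i).contDiffAt.comp x ((W.chart'.smooth x hx).of_le (by exact_mod_cast le_top))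
      exact contDiffAt_const.add ((contDiffAt_id.sub contDiffAt_const).mul
        (contDiffAt_const.mul h1).exp)
  have hclose : C1Close ε₁ id ψ := fun x => by
    rw [deriv_id]
    rcases hloc x with h | ⟨i, k, hxk, hkb, hx, hH', hk, hne, h⟩
    · rw [h.deriv_eq, h.eq_of_nhds, deriv_id]
      simpa using hε₁0
    · obtain ⟨h1, h2⟩ := hesmall i (H' x)
      have hed : HasDerivAt (e i) (deriv (e i) (H' x)) (H' x) :=
        ((hes i).differentiable one_ne_zero _).hasDerivAt
      have hcomp : HasDerivAt (fun y => e i (H' y)) (deriv (e i) (H' x) * (1 / (x - p k) / lam k))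
          x := HasDerivAt.comp x hed hH'
      have hd : HasDerivAt (fun y => p k + (y - p k) * Real.exp (lam k * e i (H' y))) _ x :=
        (((hasDerivAt_id x).sub_const (p k)).mul (hcomp.const_mul (lam k)).exp).const_add (p k)
      have hd' : deriv ψ x = Real.exp (lam k * e i (H' x)) * (1 + deriv (e i) (H' x)) := by
        rw [h.deriv_eq, hd.deriv]
        simp only [id]
        field_simp
      have ha : |lam k * e i (H' x)| ≤ b * ε' := by rw [abs_mul]; gcongr
      have hpos : 0 < ε' * ((4 * b + 1) * δ) := by positivity
      rw [hd', h.eq_of_nhds]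
      constructor
      · rw [id, show x - (p k + (x - p k) * Real.exp (lam k * e i (H' x))) =
          -((x - p k) * (Real.exp (lam k * e i (H' x)) - 1)) by ring, abs_neg, abs_mul]
        have h3 := Real.abs_exp_sub_one_le (ha.trans hε'b)
        calc _ ≤ δ * (2 * (b * ε')) := by gcongr; exact h3.trans (by gcongr)
          _ < ε₁ := by nlinarith [mul_pos hb hε'0, mul_pos (mul_pos hb hε'0) hδ, mul_pos hε'0 hδ]
      · rw [abs_sub_comm]
        have h3 := abs_exp_mul_sub_one_le (ha.trans hε'b) (h2.le.trans hε'1)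
        calc _ ≤ 4 * (b * ε') + ε' := h3.trans (by gcongr)
          _ < ε₁ := by nlinarith
  refine ⟨hopen 1 ψ hsmooth (fun x => ?_) (hclose.mono (min_le_right _ _)),
    hclose.mono (min_le_left _ _)⟩
  rw [Int.cast_one]
  by_cases hx : x ∈ Set.range p
  · have hx1 : x + 1 ∈ Set.range p := by simpa using (mk.add_int_mem (x := x) 1).2 hx
    rw [hψ, timeShift_of_range mk hx, timeShift_of_range mk hx1]
  · obtain ⟨i, hi⟩ := mk.exists_mem_Ioo hx
    rw [hψ, timeShift_of_mem mk hi, timeShift_of_mem mk (mk.mem_Ioo_add_one.2 hi), W.map_add_one',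
      heN, W.branch_add]

/-- Near the repelling points the time `H'` is early, and near the attracting points it is late. -/
theorem IsTimePair.exists_early_late {F : ℝ → ℝ} {q N : ℕ} {p : ℤ → ℝ} {lam : ℤ → ℝ}
    {c : ℤ → ℤ → ℝ} {δ : ℝ} {H H' : ℝ → ℝ} (W : IsTimePair F q N p lam c δ H H') {T : ℝ}
    (hT : ∀ i, ∃ k e : ℤ, (e = 1 ∨ e = -1) ∧ lam k < 0 ∧ ∀ t, T < t →
      Real.exp (lam k * (t - c k e)) < δ ∧
      timeBranch p H' i t = p k + e * Real.exp (lam k * (t - c k e))) (T' : ℝ) :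
    ∃ ρ, 0 < ρ ∧ ρ ≤ δ ∧ ∀ (k e : ℤ) (u : ℝ), e = 1 ∨ e = -1 → 0 < u → u < ρ →
      (0 < lam k → H' (p k + e * u) ≤ T) ∧ (lam k < 0 → T' ≤ H' (p k + e * u)) := by
  have mk := W.chart.mark
  have hper : ∀ e i, Real.exp (lam (i + N) * (T' - c (i + N) e)) =
      Real.exp (lam i * (T' - c i e)) := fun e i => by rw [W.const_add, W.lam_add]
  obtain ⟨ρ₁, hρ₁, h₁⟩ := exists_pos_le_of_int_periodic mk.pos
    (a := fun i => Real.exp (lam i * (T' - c i 1))) (hper 1) fun i => Real.exp_pos _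
  obtain ⟨ρ₂, hρ₂, h₂⟩ := exists_pos_le_of_int_periodic mk.pos
    (a := fun i => Real.exp (lam i * (T' - c i (-1)))) (hper (-1)) fun i => Real.exp_pos _
  have hδ := W.δ_pos
  refine ⟨min δ (min ρ₁ ρ₂), by positivity, min_le_left _ _, fun k e u he h0 hu => ?_⟩
  have hu1 := hu.trans_le (min_le_left _ _)
  have hu2 := hu.trans_le ((min_le_right _ _).trans (min_le_left _ _))
  have hu3 := hu.trans_le ((min_le_right _ _).trans (min_le_right _ _))
  refine ⟨fun hk => ?_, fun hk => ?_⟩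
  · by_contra! hcon
    obtain ⟨i, hi⟩ := mk.exists_mem_Ioo (W.notMem he h0 hu1)
    obtain ⟨l, s, hs, hl, hbr⟩ := hT i
    obtain ⟨hlt, heq⟩ := hbr _ hcon
    rw [W.chart'.branch_apply hi] at heq
    have habs : ∀ e : ℤ, e = 1 ∨ e = -1 → ∀ (i : ℤ) (w : ℝ), 0 < w → |p i + e * w - p i| = w :=
      fun e he i w hw => by
        rw [add_sub_cancel_left, abs_mul, abs_of_pos hw]
        rcases he with rfl | rfl <;> norm_num
    have hkl : k = l := by
      refine mk.index_eq_of_close W.gap (x := p k + e * u) ?_ ?_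
      · rw [habs e he k u h0]; linarith
      · rw [heq, habs s hs l _ (Real.exp_pos _)]; linarith
    rw [hkl] at hk
    linarith
  · rw [W.near' k e u he hk h0 hu1]
    have h3 : u ≤ Real.exp (lam k * (T' - c k e)) := by
      rcases he with rfl | rfl
      · exact hu2.le.trans (h₁ k)
      · exact hu3.le.trans (h₂ k)
    have h4 : Real.log u ≤ lam k * (T' - c k e) := (Real.log_le_iff_le_exp h0).2 h3
    have h5 : T' - c k e ≤ Real.log u / lam k := by rwa [le_div_iff_of_neg hk, mul_comm]
    linarith

/-- A linearized diffeomorphism is `C¹`-close to one with a time function: the time adapted to the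
repelling points is slowly turned into the time adapted to the attracting points. -/
theorem IsLinearized.exists_model {d : ℤ} {F : ℝ → ℝ} {q : ℕ} {M : ℤ} {N : ℕ} {p : ℤ → ℝ}
    {s : ℤ → ℝ} {δ : ℝ} (Z : IsLinearized d F q M N p s δ) {ε : ℝ} (hε : 0 < ε) :
    ∃ G lam c ρ h, IsModel d G q M N p lam c ρ h ∧ C1Close ε F G := by
  obtain ⟨c, δ', H, H', W, hsum⟩ := Z.exists_timePair
  set lam : ℤ → ℝ := fun i => Real.log (deriv F^[q] (p i)) with hlam
  have mk := Z.mark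
  have hq : (0 : ℝ) < q := by exact_mod_cast Z.based.q_pos
  have hq1 : (1 : ℝ) / q ≤ 1 := by
    rw [div_le_one hq]; exact_mod_cast Z.based.q_pos
  have hq0 : (0 : ℝ) ≤ 1 / q := by positivity
  obtain ⟨T, hT⟩ := W.exists_late
  obtain ⟨ε₁, hε₁, hclose⟩ := Z.isLift.one.close_comp (IsCircleLift.id (r := 1)) hε
  obtain ⟨ε₂, hε₂, hshift⟩ := W.timeShift_close hT hε₁
  set g : ℤ → ℝ → ℝ := fun i t => H (timeBranch p H' i t) with hg
  have Lg : ∀ i, IsCircleLift ∞ 1 (g i) := W.change_isCircleLift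
  have hgN : ∀ i, g (i + N) = g i := fun i => funext fun t => by
    simp only [hg, W.branch_add, W.map_add_one]
  -- the parameters of the interpolation depend on the function `g i` only, hence periodically on `i`
  have hint := fun g (L : IsCircleLift ∞ 1 g) => exists_interp L (T + 3) hq0 hq1 hε₂
  choose η hη hint using hint
  have hηN : ∀ i, η (g (i + N)) (Lg (i + N)) = η (g i) (Lg i) := fun i => by simp only [hgN]
  obtain ⟨η₀, hη₀, hη₀i⟩ := exists_pos_le_of_int_periodic mk.pos (a := fun i => η (g i) (Lg i)) hηN
    fun i => hη _ _
  have hκ0 := half_pos hη₀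
  set κ := η₀ / 2 with hκ
  have hκi : ∀ i, κ < η (g i) (Lg i) := fun i => by have := hη₀i i; linarith
  have hex : ∀ i, ∃ e : ℝ → ℝ, ContDiff ℝ 1 e ∧ ∀ t, |e t| < ε₂ ∧ |deriv e t| < ε₂ ∧
      interp (g i) (T + 3) κ (1 / q) (t + e t) = interp (g i) (T + 3) κ 0 t ∧
      (t + 1 / q ≤ T + 3 → e t = 0) ∧ (T + 3 + 1 / κ ≤ t → e t = 0) :=
    fun i => (hint _ (Lg i) κ hκ0 (hκi i)).2
  obtain ⟨e, he, heN⟩ : ∃ e : ℤ → ℝ → ℝ, (∀ i, ContDiff ℝ 1 (e i) ∧ ∀ t, |e i t| < ε₂ ∧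
      |deriv (e i) t| < ε₂ ∧
      interp (g i) (T + 3) κ (1 / q) (t + e i t) = interp (g i) (T + 3) κ 0 t ∧
      (t + 1 / q ≤ T + 3 → e i t = 0) ∧ (T + 3 + 1 / κ ≤ t → e i t = 0)) ∧
      ∀ i, e (i + N) = e i := by
    refine ⟨fun i => Classical.epsilon fun e : ℝ → ℝ => ContDiff ℝ 1 e ∧ ∀ t, |e t| < ε₂ ∧
      |deriv e t| < ε₂ ∧
      interp (g i) (T + 3) κ (1 / q) (t + e t) = interp (g i) (T + 3) κ 0 t ∧
      (t + 1 / q ≤ T + 3 → e t = 0) ∧ (T + 3 + 1 / κ ≤ t → e t = 0),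
      fun i => Classical.epsilon_spec (hex i), fun i => by simp only [hgN]⟩
  obtain ⟨ρ, hρ, hρδ, hnear⟩ := W.exists_early_late hT (T + 3 + 1 / κ)
  obtain ⟨Lψ, hψ⟩ := hshift e ρ hρ heN (fun i => (he i).1)
    (fun i t => ⟨((he i).2 t).1, ((he i).2 t).2.1⟩)
    (fun i t ht => ((he i).2 t).2.2.2.1 (by linarith)) (fun k x hx hxk i => by
      obtain ⟨a, u, ha, hu, rfl⟩ : ∃ (a : ℤ) (u : ℝ), (a = 1 ∨ a = -1) ∧ 0 < u ∧
          x = p k + a * u := by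
        rcases lt_trichotomy x (p k) with h | h | h
        · exact ⟨-1, p k - x, Or.inr rfl, by linarith, by push_cast; ring⟩
        · exact absurd ⟨k, h.symm⟩ hx
        · exact ⟨1, x - p k, Or.inl rfl, by linarith, by push_cast; ring⟩
      have hu' : u < ρ := by
        rw [add_sub_cancel_left, abs_mul, abs_of_pos hu] at hxk
        rcases ha with rfl | rfl <;> simpa using hxk
      have h1 := hnear k a u ha hu hu'
      rcases lt_or_gt_of_ne (W.lam_ne k) with hk | hk
      · exact ((he i).2 _).2.2.2.2 (h1.2 hk)
      · exact ((he i).2 _).2.2.2.1 (by linarith [h1.1 hk]))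
  set ψ := timeShift p e H' with hψdef
  set Θ : ℤ → ℝ → ℝ := fun i => interp (g i) (T + 3) κ 0 with hΘ
  set h := piecewiseTime p Θ H' with hh
  have hΘN : ∀ i, Θ (i + N) = Θ i := fun i => by simp only [hΘ, hgN]
  have hgH : ∀ i, ∀ x ∈ Set.Ioo (p i) (p (i + 1)), g i (H' x) = H x := fun i x hx => by
    simp only [hg, W.chart'.branch_apply hx]
  have hψmem : ∀ i, ∀ x ∈ Set.Ioo (p i) (p (i + 1)), ψ x ∈ Set.Ioo (p i) (p (i + 1)) ∧
      H' (ψ x) = H' x + e i (H' x) := fun i x hx => by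
    rw [hψdef, timeShift_of_mem mk hx]
    exact ⟨W.chart'.branch_mem _ _, W.chart'.apply_branch _ _⟩
  have hψrange : ∀ x, ψ x ∈ Set.range p ↔ x ∈ Set.range p := fun x => by
    constructor
    · intro hx
      by_contra hn
      obtain ⟨i, hi⟩ := mk.exists_mem_Ioo hn
      exact mk.notMem_range (hψmem i x hi).1 hx
    · intro hx
      rwa [hψdef, timeShift_of_range mk hx]
  have hGp : ∀ x ∈ Set.range p, (F ∘ ψ) x = F x := fun x hx => by
    rw [Function.comp_apply, hψdef, timeShift_of_range mk hx]
  obtain ⟨BG, hGj⟩ := Z.based.congr fun j => hGp _ (Z.iterate_mem 0 j)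
  have hGit : ∀ i, (F ∘ ψ)^[q] (p i) = p i + M := fun i => by
    rw [← (Z.periodic_iff _).2 ⟨i, rfl⟩]
    generalize q = n
    induction n with
    | zero => rfl
    | succ n ih => rw [iterate_succ_apply', iterate_succ_apply', ih, hGp _ (Z.iterate_mem i n)]
  have hder : ∀ i, ∀ x ∈ Set.Ioo (p i) (p (i + 1)), ContDiffAt ℝ ∞ h x ∧ deriv h x ≠ 0 :=
    fun i x hx => by
      have hxn := mk.notMem_range hx
      have hev : h =ᶠ[𝓝 x] fun y => Θ i (H' y) := by
        filter_upwards [Ioo_mem_nhds hx.1 hx.2] with y hy using piecewiseTime_of_mem mk hy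
      have hΘs : ContDiff ℝ ∞ (Θ i) := contDiff_interp (Lg i).contDiff
      have hs := W.chart'.smooth x hxn
      have hd1 : HasDerivAt (Θ i) (deriv (Θ i) (H' x)) (H' x) :=
        (hΘs.differentiable (by simp) _).hasDerivAt
      have hd : HasDerivAt (fun y => Θ i (H' y)) (deriv (Θ i) (H' x) * deriv H' x) x :=
        HasDerivAt.comp x hd1 (W.chart'.differentiableAt hxn).hasDerivAt
      refine ⟨(hΘs.contDiffAt.comp x hs).congr_of_eventuallyEq hev, ?_⟩
      rw [hev.deriv_eq, hd.deriv]
      exact mul_ne_zero ((hint _ (Lg i) κ hκ0 (hκi i)).1 _).ne' (W.chart'.deriv_ne x hxn)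
  refine ⟨F ∘ ψ, lam, c, ρ, h, ⟨⟨mk, W.lam_ne, W.lam_add, W.alternate,
    piecewiseTime_add_one mk W.map_add_one' hΘN, hρ, fun i => ?_, fun i a u ha h0 hu => ?_,
    fun x hx => ?_, fun x hx => ?_⟩, ?_, Z.based.q_pos, Z.based.deg_pow, fun x => ?_,
    fun x hx => ?_, hGit, fun i hi => ?_, fun hd => ⟨BG.preserving hd, hsum hd⟩,
    fun hd => ⟨(Z.based.reversing hd).1, 0, ?_⟩⟩, ?_⟩
  · linarith [W.gap i]
  · have hxn := W.notMem (i := i) ha h0 (hu.trans_le hρδ)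
    obtain ⟨j, hj⟩ := mk.exists_mem_Ioo hxn
    have h1 := hnear i a u ha h0 hu
    rw [hh, piecewiseTime_of_mem mk hj]
    rcases lt_or_gt_of_ne (W.lam_ne i) with hi | hi
    · simp only [hΘ]
      rw [interp_of_ge hκ0 (by linarith [h1.2 hi]), W.near' i a u ha hi h0 (hu.trans_le hρδ)]
    · simp only [hΘ]
      rw [interp_of_le hκ0 (by linarith [h1.1 hi]), hgH j _ hj,
        W.near i a u ha hi h0 (hu.trans_le hρδ)]
  · obtain ⟨i, hi⟩ := mk.exists_mem_Ioo hx
    exact (hder i x hi).1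
  · obtain ⟨i, hi⟩ := mk.exists_mem_Ioo hx
    exact (hder i x hi).2
  · have := Z.isLift.one.comp le_rfl Lψ
    rwa [mul_one] at this
  · rw [Function.comp_apply, Z.map_mem, hψrange]
  · obtain ⟨i, hi⟩ := mk.exists_mem_Ioo hx
    obtain ⟨hψi, hψt⟩ := hψmem i x hi
    have hψn := mk.notMem_range hψi
    obtain ⟨j, hj⟩ := mk.exists_mem_Ioo ((Z.map_mem _).not.2 hψn)
    rw [Function.comp_apply, hh, piecewiseTime_of_mem mk hi, piecewiseTime_of_mem mk hj,
      W.map_apply' _ hψn, hψt]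
    have hsync := ((he i).2 (H' x)).2.2.1
    -- the change of time is equivariant
    have hgj : g j (H' x + e i (H' x) + 1 / q) = g i (H' x + e i (H' x)) + 1 / q := by
      rw [← hψt, ← W.map_apply' _ hψn, hgH j _ hj, hgH i _ hψi, W.map_apply _ hψn]
    simp only [hΘ]
    rw [← hsync, interp, interp, hgj, add_zero]
    ring
  · obtain ⟨j, n, hj⟩ := Z.base i (Real.log_injOn_pos (Z.multiplier_pos i) (Z.multiplier_pos 0) hi)
    exact ⟨j, n, by rw [hGj, hj]⟩
  · rw [(BG.reversing hd).2]; simp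
  · have := hclose F ψ Z.isLift.one.differentiable Lψ.differentiable (C1Close.refl hε₁ F) hψ
    rwa [Function.comp_id] at this

/-! ### Density -/

/-- Every diffeomorphism is `C¹`-close to one with a time function. -/
theorem IsCircleLift.exists_model_close {d : ℤ} {F : ℝ → ℝ} (L : IsCircleLift 1 d F) {ε : ℝ}
    (hε : 0 < ε) : ∃ G q M N p lam c δ h, IsModel d G q M N p lam c δ h ∧ C1Close ε F G := by
  have hε5 : 0 < ε / 5 := by positivity
  obtain ⟨F₁, L₁, h₁⟩ := L.exists_smooth_close hε5
  obtain ⟨F₂, q, M, α, L₂, h₂, B₂⟩ := L₁.exists_based hε5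
  obtain ⟨F₃, L₃, h₃, B₃, hyp⟩ := B₂.exists_hyperbolic L₂ hε5
  obtain ⟨F₄, N, p, s, δ, Z, h₄⟩ := B₃.exists_linearized L₃ hyp hε5
  obtain ⟨F₅, lam, c, ρ, h, m, h₅⟩ := Z.exists_model hε5
  exact ⟨F₅, q, M, N, p, lam, c, ρ, h, m,
    ((((h₁.trans h₂).trans h₃).trans h₄).trans h₅).mono (by linarith)⟩

/-- Closeness of lifts implies closeness in the `C¹` topology of the group. -/
theorem exists_close_mem {f : circleDiff 1} {d : ℤ} {F : ℝ → ℝ} (hf : IsLiftOf f d F)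
    {U : Set (circleDiff 1)} (hU : U ∈ 𝓝 f) : ∃ ε, 0 < ε ∧ ∀ (g : circleDiff 1) (G : ℝ → ℝ),
      IsLiftOf g d G → C1Close ε F G → g ∈ U := by
  rw [circleDiffTopology, mem_nhds_induced] at hU
  obtain ⟨V, hV, hVU⟩ := hU
  obtain ⟨A, hA, B, hB, hAB⟩ := mem_nhds_prod_iff.1 hV
  obtain ⟨ε₁, hε₁, h₁⟩ := (UniformFun.hasBasis_nhds_of_basis _ _ _
    Metric.uniformity_basis_dist).mem_iff.1 hA
  obtain ⟨ε₂, hε₂, h₂⟩ := (UniformFun.hasBasis_nhds_of_basis _ _ _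
    Metric.uniformity_basis_dist).mem_iff.1 hB
  refine ⟨min ε₁ ε₂, lt_min hε₁ hε₂, fun g G hg hFG => hVU (hAB ⟨h₁ fun z => ?_, h₂ fun z => ?_⟩)⟩
  · induction z using QuotientAddGroup.induction_on with
    | H x =>
      change dist (f.1 (x : UnitAddCircle)) (g.1 (x : UnitAddCircle)) < ε₁
      rw [hf.map_coe, hg.map_coe, dist_eq_norm, ← AddCircle.coe_sub, UnitAddCircle.norm_eq]
      have := round_le (F x - G x) 0
      rw [Int.cast_zero, sub_zero] at this
      exact this.trans_lt ((hFG x).1.trans_le (min_le_left _ _))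
  · induction z using QuotientAddGroup.induction_on with
    | H x =>
      change dist (circleDeriv f.1 (x : UnitAddCircle)) (circleDeriv g.1 (x : UnitAddCircle)) < ε₂
      rw [circleDeriv_coe hf.isLift.continuous hf.map_coe,
        circleDeriv_coe hg.isLift.continuous hg.map_coe, Real.dist_eq]
      exact (hFG x).2.trans_le (min_le_right _ _)

theorem theorem1 :
    ∃ D : Set (circleDiff 1), Dense D ∧ ∀ f ∈ D,
      IsMorseSmaleDiffeo f ∧
      (periodicPts f.1).Nonempty ∧
      ∃ q : ℕ,
        (OrientationReversing f.1 → q = 2) ∧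
        (¬ OrientationReversing f.1 → ∀ x ∈ periodicPts f.1, minimalPeriod f.1 x = q) ∧
        ∃ (X : UnitAddCircle → ℝ) (Φ : ℝ → UnitAddCircle → UnitAddCircle),
          IsMorseSmaleField X ∧ IsFlowOf X Φ ∧
          (∀ t x, f.1 (Φ t x) = Φ t (f.1 x)) ∧
          (∀ x, (f ^ q).1 x = Φ 1 x) ∧
          ∃ e : Multiplicative (ℝ × ZMod q) ≃* Subgroup.centralizer ({f} : Set (circleDiff 1)),
            ∀ t x, (e (Multiplicative.ofAdd (t, 0))).1.1 x = Φ t x := by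
  refine ⟨{f | ∃ d F q M N p lam c δ h, IsLiftOf f d F ∧ IsModel d F q M N p lam c δ h}, ?_, ?_⟩
  · intro f
    rw [mem_closure_iff_nhds]
    intro U hU
    obtain ⟨d, F, hF⟩ := exists_isLiftOf f
    obtain ⟨ε, hε, hmem⟩ := exists_close_mem hF hU
    obtain ⟨G, q, M, N, p, lam, c, δ, h, m, hFG⟩ := hF.isLift.exists_model_close hε
    obtain ⟨g, hg⟩ := m.isLift.exists_diff
    have hgG : IsLiftOf g d G := ⟨m.isLift, hg⟩
    exact ⟨g, hmem g G hgG hFG, d, G, q, M, N, p, lam, c, δ, h, hgG, m⟩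
  · rintro f ⟨d, F, q, M, N, p, lam, c, δ, h, hf, m⟩
    exact m.main hf
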